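/- For integers $g,p\ge 0$ with $2g-2+p>0$, let $\mathrm{Graph}(g,p)/\mathrm{Sym}_p$ be the set of isomorphism classes of finite connected graphs (loops and multiple edges allowed) of rank $g$ (that is, with first Betti number $g$) having $p$ vertices of valence $1$ (the marked vertices, which carry no labels), $2g-2+p$ vertices of valence $3$, and no other vertices. A Whitehead move on an edge $e$ joining two distinct vertices of valence $3$ collapses $e$ and reopens the resulting vertex of valence $4$ in one of the two other ways, i.e. according to one of the two other partitions into pairs of the four half-edges at it. Let $d_W$ be the path metric on $\mathrm{Graph}(g,p)/\mathrm{Sym}_p$ in which two distinct classes are at distance $1$ if and only if they differ by a single Whitehead move. Then there is a constant $K>0$, independent of $g$ and $p$, such that for all integers $g,p\ge 0$ with $2g-2+p>0$, the set $\mathrm{Graph}(g,p)/\mathrm{Sym}_p$ is non-empty, any two of its elements are joined by a finite sequence of Whitehead moves, its diameter is finite, $$\operatorname{diam}_W\big(\mathrm{Graph}(g,p)/\mathrm{Sym}_p\big)\le K\,\big(g\log(g+p)+(g+p)\big),$$ and, if $(g,p)$ is none of $(0,3),(0,4),(0,5),(1,1)$ (for which the space is a single point, of diameter $0$), $$\frac1K\,\big(g\log(g+p)+(g+p)\big)\le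 \operatorname{diam}_W\big(\mathrm{Graph}(g,p)/\mathrm{Sym}_p\big).$$ -/

import Mathlib

/-- A finite graph, possibly with loops and multiple edges, presented by its vertices and its
half-edges: `base h` is the vertex at which the half-edge `h` is attached, and `opp h` is the other
half of the edge containing `h`. -/
structure FinMultigraph : Type 1 where
  V : Type
  H : Type
  finiteV : Finite V
  finiteH : Finite H
  base : H → V
  opp : H → H
  opp_opp : ∀ h, opp (opp h) = h
  opp_ne : ∀ h, opp h ≠ h

namespace FinMultigraph

/-- The valence of a vertex: a loop counts twice. -/
noncomputable def valence (G : FinMultigraph) (v : G.V) : ℕ :=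
  Nat.card {h : G.H // G.base h = v}

/-- The edges are the unordered pairs `{h, opp h}` of half-edges. -/
def edges (G : FinMultigraph) : Set (Sym2 G.H) :=
  Set.range fun h => s(h, G.opp h)

/-- The simple graph on the vertices joining distinct vertices that share an edge. -/
def adjacency (G : FinMultigraph) : SimpleGraph G.V :=
  SimpleGraph.fromRel fun u v => ∃ h, G.base h = u ∧ G.base (G.opp h) = v

def IsConnected (G : FinMultigraph) : Prop := G.adjacency.Connected

/-- The rank `|E| - |V| + 1` of a connected graph (the rank of its fundamental group). -/
noncomputable def rank (G : FinMultigraph) : ℤ :=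
  (Nat.card G.edges : ℤ) - (Nat.card G.V : ℤ) + 1

/-- An isomorphism of graphs, given by bijections of vertices and of half-edges. -/
structure Iso (G G' : FinMultigraph) where
  onV : G.V ≃ G'.V
  onH : G.H ≃ G'.H
  base_onH : ∀ h, G'.base (onH h) = onV (G.base h)
  opp_onH : ∀ h, G'.opp (onH h) = onH (G.opp h)

namespace Iso

def refl (G : FinMultigraph) : Iso G G :=
  ⟨Equiv.refl _, Equiv.refl _, fun _ => rfl, fun _ => rfl⟩

def symm {G G' : FinMultigraph} (f : Iso G G') : Iso G' G where
  onV := f.onV.symm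
  onH := f.onH.symm
  base_onH h := by
    rw [Equiv.eq_symm_apply, ← f.base_onH, Equiv.apply_symm_apply]
  opp_onH h := by
    rw [Equiv.eq_symm_apply, ← f.opp_onH, Equiv.apply_symm_apply]

def trans {G G' G'' : FinMultigraph} (f : Iso G G') (f' : Iso G' G'') : Iso G G'' where
  onV := f.onV.trans f'.onV
  onH := f.onH.trans f'.onH
  base_onH h := by simp [f'.base_onH, f.base_onH]
  opp_onH h := by simp [f'.opp_onH, f.opp_onH]

end Iso

open Classical in
/-- The graph obtained from `G` by exchanging the points of attachment of the half-edges
`a` and `b`. -/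
noncomputable def exchange (G : FinMultigraph) (a b : G.H) : FinMultigraph where
  V := G.V
  H := G.H
  finiteV := G.finiteV
  finiteH := G.finiteH
  base := fun x => G.base (Equiv.swap a b x)
  opp := G.opp
  opp_opp := G.opp_opp
  opp_ne := G.opp_ne

/-- `G'` is obtained from `G` by a Whitehead move on the edge `e = {h, opp h}`, which joins two
distinct vertices of valence three. If `a, a'` are the other half-edges at one endpoint of `e` and
`b, b'` those at the other endpoint, then collapsing `e` gives a vertex carrying `a, a', b, b'`;
the two ways of reopening it in a different direction separate `{b, a'}` from `{a, b'}`,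
respectively `{b', a'}` from `{b, a}`: exchange `a` with `b`, respectively `a` with `b'`. -/
def WhiteheadMove (G G' : FinMultigraph) : Prop :=
  ∃ h a b : G.H,
    G.base h ≠ G.base (G.opp h) ∧
    G.valence (G.base h) = 3 ∧ G.valence (G.base (G.opp h)) = 3 ∧
    G.base a = G.base h ∧ a ≠ h ∧
    G.base b = G.base (G.opp h) ∧ b ≠ G.opp h ∧
    Nonempty (Iso (G.exchange a b) G')

end FinMultigraph

/-- A connected graph of rank `g` with `p` (marked, unlabeled) vertices of valence one and `2g-2+p`
vertices of valence three, and no others. -/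
structure MarkedGraph (g p : ℕ) : Type 1 extends FinMultigraph where
  connected : toFinMultigraph.IsConnected
  rank_eq : toFinMultigraph.rank = (g : ℤ)
  valence_eq : ∀ v, toFinMultigraph.valence v = 1 ∨ toFinMultigraph.valence v = 3
  card_one : Nat.card {v // toFinMultigraph.valence v = 1} = p
  card_three : (Nat.card {v // toFinMultigraph.valence v = 3} : ℤ) = 2 * (g : ℤ) - 2 + (p : ℤ)

/-- Two graphs are identified if they are isomorphic; the marked vertices carry no labels. -/
def markedGraphSetoid (g p : ℕ) : Setoid (MarkedGraph g p) where
  r G G' := Nonempty (FinMultigraph.Iso G.toFinMultigraph G'.toFinMultigraph)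
  iseqv :=
    { refl := fun G => ⟨FinMultigraph.Iso.refl G.toFinMultigraph⟩
      symm := fun ⟨f⟩ => ⟨f.symm⟩
      trans := fun ⟨f⟩ ⟨f'⟩ => ⟨f.trans f'⟩ }

/-- The space of graphs of rank `g` with `p` unlabeled marked vertices, up to isomorphism. -/
def GraphSpace (g p : ℕ) : Type 1 := Quotient (markedGraphSetoid g p)

/-- Two distinct points of the space of graphs are adjacent if they differ by one Whitehead move.
The metric of Whitehead moves is the path metric of this simple graph. -/
def whiteheadGraph (g p : ℕ) : SimpleGraph (GraphSpace g p) :=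
  SimpleGraph.fromRel fun X Y => ∃ G G' : MarkedGraph g p,
    Quotient.mk (markedGraphSetoid g p) G = X ∧ Quotient.mk (markedGraphSetoid g p) G' = Y ∧
    FinMultigraph.WhiteheadMove G.toFinMultigraph G'.toFinMultigraph

/-!
A graph is recorded by its vertex system, the multiset of its trivalent vertices, each of them being
the multiset of the names of the three edges arriving there; an edge to a marked vertex has its name
in the system only once. Up to renaming, the vertex system determines the graph
(`FinMultigraph.nonempty_iso_of_presents`, `MarkedGraph.exists_presents`), and a Whitehead move on
an edge `e` replaces two triples `e x y`, `e z w` by `e x z`, `e y w` (`VertexSystem.Step`). All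
estimates are made for vertex systems.

*Upper bound.* A connected graph with `n = 2 * g - 2 + p` trivalent vertices is cut open to a
spanning tree, a binary tree with `n` vertices in which a cut edge shows as a pair of leaves with
the same name. Whitehead moves act on it as rotations. Linearly many rotations turn the tree into a
comb, and, halving the length of the spine again and again, into a tree of depth `O(log n)`
(`NTree.exists_shallow`). Now each of at most `g` pairs of leaves is pulled to the root along paths
of length `O(log n)` and becomes a loop there (`NTree.exists_loopComb`); what remains is rotated
into a comb. The result is a normal form, which is the same for all graphs with given `g` and `p`
(`NTree.exists_normalForm`, `NTree.renaming_of_isNormalForm`).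

*Linear lower bound.* A Whitehead move changes the number of vertices that carry a loop or two
marked vertices by at most two, and this number varies between at most `2` (and `0` for positive
rank) and at least `g + p / 2` (`VertexSystem.Steps.ends_le`, `VertexSystem.exists_many_ends`).

*Logarithmic lower bound.* Counting the graphs in a ball by the choices made at each move would cost
a factor `n` for each move. Instead, every vertex is given the list of those moves in which it takes
part, each with the half-edge of the edge concerned and the half-edge to be moved. A move takes
place as soon as both ends of an edge ask for it. Moves that are possible at the same time commute,
so by the Church-Rosser property the result depends only on the lists
(`VertexSystem.Execute.unique`), and `D` moves are coded in a word of length `n + 2 * D` over ten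
letters (`VertexSystem.exists_code`). On the other hand, a cycle with `k = g - 1` chords can be
formed in `(k + p).descFactorial k` ways from the choices of the partners, and a graph occurs in
this way at most `n * 27 ^ n` times, since one vertex and the numbering of the half-edges determine
the walk along the cycle (`VertexSystem.cycle_eq_of_maps`). Comparing the logarithms gives
`g log (g + p) ≤ C * (g + p + D)`, where `D` is the diameter (`MarkedGraph.log_le_diam`), and the
linear lower bound absorbs `g + p`.
-/

/-! ### Vertex systems and Whitehead steps -/

/-- The vertex with the three (not necessarily distinct) edge names `x`, `y`, `z`. -/
def tri {E : Type} (x y z : E) : Multiset E := {x, y, z}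

/-- A graph whose vertices have valence one or three is recorded by its *vertex system*: the
multiset of its trivalent vertices, each of them given as the multiset of the names of the three
edges arriving there. An edge joining two trivalent vertices has its name in the system twice
(possibly in one triple, for a loop), an edge to a vertex of valence one has it once. -/
abbrev VertexSystem (E : Type) : Type := Multiset (Multiset E)

namespace VertexSystem

variable {E F : Type}

theorem tri_swap_left (x y z : E) : tri x y z = tri y x z := by
  simp only [tri, Multiset.insert_eq_cons]; exact Multiset.cons_swap x y {z}

theorem tri_swap_right (x y z : E) : tri x y z = tri x z y := by
  simp only [tri, Multiset.insert_eq_cons]; congr 1; exact Multiset.cons_swap y z 0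

theorem tri_rotate (x y z : E) : tri x y z = tri y z x := by
  rw [tri_swap_left, tri_swap_right]

/-- A Whitehead move seen on the vertex system: the edge `e` separates the pairs `x, y` and `z, w`
before the move and the pairs `x, z` and `y, w` after it. -/
def Step (S S' : VertexSystem E) : Prop :=
  ∃ (e x y z w : E) (M : VertexSystem E),
    S = tri e x y ::ₘ tri e z w ::ₘ M ∧ S' = tri e x z ::ₘ tri e y w ::ₘ M

theorem Step.symm {S S' : VertexSystem E} (h : Step S S') : Step S' S := by
  obtain ⟨e, x, y, z, w, M, rfl, rfl⟩ := h
  exact ⟨e, x, z, y, w, M, rfl, rfl⟩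

theorem Step.add_right {S S' : VertexSystem E} (h : Step S S') (M : VertexSystem E) :
    Step (S + M) (S' + M) := by
  obtain ⟨e, x, y, z, w, N, rfl, rfl⟩ := h
  exact ⟨e, x, y, z, w, N + M, by simp, by simp⟩

theorem Step.map {S S' : VertexSystem E} (h : Step S S') (f : E → F) :
    Step (S.map (Multiset.map f)) (S'.map (Multiset.map f)) := by
  obtain ⟨e, x, y, z, w, M, rfl, rfl⟩ := h
  exact ⟨f e, f x, f y, f z, f w, M.map (Multiset.map f), by simp [tri], by simp [tri]⟩

/-- The names at the trivalent vertices are not changed by a Whitehead move. -/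
theorem Step.join_eq {S S' : VertexSystem E} (h : Step S S') : S'.join = S.join := by
  obtain ⟨e, x, y, z, w, M, rfl, rfl⟩ := h
  simp only [Multiset.join_cons, ← add_assoc]
  congr 1
  classical
  ext a
  simp only [tri, Multiset.insert_eq_cons, Multiset.count_add, Multiset.count_cons,
    Multiset.count_singleton]
  ring

/-- `Steps k S S'`: the system `S'` is obtained from `S` by exactly `k` Whitehead steps. -/
inductive Steps : ℕ → VertexSystem E → VertexSystem E → Prop
  | refl (S) : Steps 0 S S
  | tail {k S T U} : Steps k S T → Step T U → Steps (k + 1) S U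

theorem Steps.trans {j k : ℕ} {S T U : VertexSystem E} (h : Steps j S T) (h' : Steps k T U) :
    Steps (j + k) S U := by
  induction h' with
  | refl => exact h
  | tail _ hs ih => exact (ih h).tail hs

theorem Steps.symm {k : ℕ} {S T : VertexSystem E} (h : Steps k S T) : Steps k T S := by
  induction h with
  | refl => exact .refl _
  | tail _ hs ih =>
    have := ((Steps.refl _).tail hs.symm).trans ih
    rwa [zero_add, add_comm] at this

theorem Steps.add_right {k : ℕ} {S T : VertexSystem E} (h : Steps k S T) (M : VertexSystem E) :
    Steps k (S + M) (T + M) := by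
  induction h with
  | refl => exact .refl _
  | tail _ hs ih => exact ih.tail (hs.add_right M)

theorem Steps.join_eq {k : ℕ} {S T : VertexSystem E} (h : Steps k S T) : T.join = S.join := by
  induction h with
  | refl => rfl
  | tail _ hs ih => rw [hs.join_eq, ih]

/-- `Within k S S'`: the system `S'` is obtained from `S` by at most `k` Whitehead steps. -/
def Within (k : ℕ) (S S' : VertexSystem E) : Prop := ∃ j ≤ k, Steps j S S'

theorem Within.refl (k : ℕ) (S : VertexSystem E) : Within k S S := ⟨0, k.zero_le, .refl S⟩

theorem Within.of_step {S T : VertexSystem E} (h : Step S T) : Within 1 S T :=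
  ⟨1, le_rfl, (Steps.refl S).tail h⟩

theorem Within.mono {j k : ℕ} {S T : VertexSystem E} (h : Within j S T) (hjk : j ≤ k) :
    Within k S T := by
  obtain ⟨i, hi, hs⟩ := h
  exact ⟨i, hi.trans hjk, hs⟩

theorem Within.trans {j k : ℕ} {S T U : VertexSystem E} (h : Within j S T) (h' : Within k T U) :
    Within (j + k) S U := by
  obtain ⟨i, hi, hs⟩ := h
  obtain ⟨i', hi', hs'⟩ := h'
  exact ⟨i + i', by omega, hs.trans hs'⟩

theorem Within.symm {k : ℕ} {S T : VertexSystem E} (h : Within k S T) : Within k T S := by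
  obtain ⟨i, hi, hs⟩ := h
  exact ⟨i, hi, hs.symm⟩

theorem Within.add_right {k : ℕ} {S T : VertexSystem E} (h : Within k S T) (M : VertexSystem E) :
    Within k (S + M) (T + M) := by
  obtain ⟨i, hi, hs⟩ := h
  exact ⟨i, hi, hs.add_right M⟩

theorem Within.add_left {k : ℕ} {S T : VertexSystem E} (h : Within k S T) (M : VertexSystem E) :
    Within k (M + S) (M + T) := by
  rw [add_comm M, add_comm M]; exact h.add_right M

theorem Within.cons {k : ℕ} {S T : VertexSystem E} (h : Within k S T) (v : Multiset E) :
    Within k (v ::ₘ S) (v ::ₘ T) := by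
  simpa using h.add_left {v}

theorem Within.join_eq {k : ℕ} {S T : VertexSystem E} (h : Within k S T) : T.join = S.join := by
  obtain ⟨i, -, hs⟩ := h
  exact hs.join_eq

/-- A vertex system is connected if a set of names that contains all or none of the names at each
vertex contains all or none of the names. -/
def Conn (S : VertexSystem E) : Prop :=
  ∀ N : Set E, (∀ v ∈ S, (∀ x ∈ v, x ∈ N) ∨ ∀ x ∈ v, x ∉ N) →
    (∀ v ∈ S, ∀ x ∈ v, x ∈ N) ∨ ∀ v ∈ S, ∀ x ∈ v, x ∉ N

@[simp]
theorem mem_tri {a x y z : E} : a ∈ tri x y z ↔ a = x ∨ a = y ∨ a = z := by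
  simp [tri]

theorem Step.conn {S S' : VertexSystem E} (h : Step S S') (hS : Conn S) : Conn S' := by
  obtain ⟨e, x, y, z, w, M, rfl, rfl⟩ := h
  intro N hN
  have key := hS N
  simp only [Multiset.mem_cons, forall_eq_or_imp, mem_tri] at hN key ⊢
  simp only [forall_eq] at hN key ⊢
  obtain ⟨h1, h2, h3⟩ := hN
  have := key ⟨by tauto, by tauto, h3⟩
  tauto

/-- Two vertex systems are renamings of each other if they agree up to a relabelling of the edges
that is injective on the names in use. -/
def Renaming (S : VertexSystem E) (S' : VertexSystem F) : Prop :=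
  ∃ f : E → F, Set.InjOn f {x | x ∈ S.join} ∧ S' = S.map (Multiset.map f)

end VertexSystem

/-! ### Binary trees with named edges -/

/-- A planar binary tree with named edges. The tree hangs on the edge `NTree.name`; an edge is
either the stalk of a leaf or the stalk of a trivalent vertex carrying two subtrees. Two edges
may have the same name: a name occurring at two leaves stands for one edge that is cut open. -/
inductive NTree (E : Type) : Type
  | leaf (x : E) : NTree E
  | node (x : E) (l r : NTree E) : NTree E

namespace NTree

open VertexSystem

variable {E F : Type}

/-- The name of the edge on which the tree hangs. -/
def name : NTree E → E
  | leaf x => x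
  | node x _ _ => x

/-- The vertex system formed by the trivalent vertices of a tree. -/
def tris : NTree E → VertexSystem E
  | leaf _ => 0
  | node x l r => tri x l.name r.name ::ₘ (l.tris + r.tris)

/-- The names of the leaves. -/
def leaves : NTree E → Multiset E
  | leaf x => {x}
  | node _ l r => l.leaves + r.leaves

/-- The names of the edges on which the trivalent vertices hang. -/
def nodeNames : NTree E → Multiset E
  | leaf _ => 0
  | node x l r => x ::ₘ (l.nodeNames + r.nodeNames)

/-- The number of trivalent vertices. -/
def nodes : NTree E → ℕ
  | leaf _ => 0
  | node _ l r => l.nodes + r.nodes + 1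

/-- The largest number of trivalent vertices on a path starting at the root. -/
def depth : NTree E → ℕ
  | leaf _ => 0
  | node _ l r => max l.depth r.depth + 1

/-- The tree with its edges renamed by `f`. -/
def map (f : E → F) : NTree E → NTree F
  | leaf x => leaf (f x)
  | node x l r => node (f x) (l.map f) (r.map f)

@[simp] theorem name_leaf (x : E) : (leaf x).name = x := rfl
@[simp] theorem name_node (x : E) (l r : NTree E) : (node x l r).name = x := rfl
@[simp] theorem tris_leaf (x : E) : (leaf x).tris = 0 := rfl
@[simp] theorem tris_node (x : E) (l r : NTree E) :
    (node x l r).tris = tri x l.name r.name ::ₘ (l.tris + r.tris) := rfl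
@[simp] theorem leaves_leaf (x : E) : (leaf x).leaves = {x} := rfl
@[simp] theorem leaves_node (x : E) (l r : NTree E) :
    (node x l r).leaves = l.leaves + r.leaves := rfl
@[simp] theorem nodeNames_leaf (x : E) : (leaf x).nodeNames = 0 := rfl
@[simp] theorem nodeNames_node (x : E) (l r : NTree E) :
    (node x l r).nodeNames = x ::ₘ (l.nodeNames + r.nodeNames) := rfl
@[simp] theorem nodes_leaf (x : E) : (leaf x).nodes = 0 := rfl
@[simp] theorem nodes_node (x : E) (l r : NTree E) :
    (node x l r).nodes = l.nodes + r.nodes + 1 := rfl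
@[simp] theorem depth_leaf (x : E) : (leaf x).depth = 0 := rfl
@[simp] theorem depth_node (x : E) (l r : NTree E) :
    (node x l r).depth = max l.depth r.depth + 1 := rfl

theorem name_map (f : E → F) (t : NTree E) : (t.map f).name = f t.name := by
  cases t <;> rfl

theorem tris_map (f : E → F) (t : NTree E) : (t.map f).tris = t.tris.map (Multiset.map f) := by
  induction t with
  | leaf => rfl
  | node x l r hl hr => simp [map, name_map, hl, hr, tri]

theorem card_tris (t : NTree E) : t.tris.card = t.nodes := by
  induction t with
  | leaf => rfl
  | node x l r hl hr => simp [hl, hr]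

theorem card_leaves (t : NTree E) : t.leaves.card = t.nodes + 1 := by
  induction t with
  | leaf => rfl
  | node x l r hl hr => simp [hl, hr]; ring

/-- Every edge of the tree has two ends, which lie at a trivalent vertex, at a leaf or at the
root. -/
theorem join_tris (t : NTree E) : t.tris.join + {t.name} = t.leaves + 2 • t.nodeNames := by
  induction t with
  | leaf x => simp
  | node x l r hl hr =>
    simp only [tris_node, Multiset.join_cons, Multiset.join_add, tri, name_node, leaves_node,
      nodeNames_node]
    have h1 : l.leaves + r.leaves + 2 • (x ::ₘ (l.nodeNames + r.nodeNames)) =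
        (l.leaves + 2 • l.nodeNames) + (r.leaves + 2 • r.nodeNames) + 2 • {x} := by
      rw [← Multiset.singleton_add, smul_add, smul_add]; abel
    rw [h1, ← hl, ← hr]
    simp only [Multiset.insert_eq_cons, ← Multiset.singleton_add]
    rw [two_smul]; abel

/-- Exchanging the two subtrees at the root does not change the vertex system. -/
theorem tris_comm (x : E) (l r : NTree E) : (node x l r).tris = (node x r l).tris := by
  simp only [tris_node]
  rw [tri_swap_right, add_comm]

/-- The rotation of a binary tree is a Whitehead move. -/
theorem within_rotate (x y : E) (a b c : NTree E) :
    Within 1 (node x (node y a b) c).tris (node x a (node y b c)).tris := by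
  refine Within.of_step ⟨y, x, c.name, a.name, b.name, a.tris + b.tris + c.tris, ?_, ?_⟩
  · simp only [tris_node, name_node]
    rw [tri_swap_left y x]
    simp [add_assoc]
  · simp only [tris_node, name_node]
    rw [tri_rotate y x a.name, tri_rotate x a.name y, tri_rotate a.name y x,
      tri_swap_right y c.name, tri_swap_left y x, tri_swap_right x y]
    simp [add_assoc]

theorem within_node {j k : ℕ} {l l' r r' : NTree E} (x : E) (hl : Within j l.tris l'.tris)
    (hr : Within k r.tris r'.tris) (hl' : l'.name = l.name) (hr' : r'.name = r.name) :
    Within (j + k) (node x l r).tris (node x l' r').tris := by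
  simp only [tris_node, hl', hr']
  exact ((hl.add_right _).trans (hr.add_left _)).cons _

/-! ### Spanning trees -/

/-- A vertex can be attached to a tree at a leaf. -/
theorem exists_grow_leaf (y a b : E) (t : NTree E) (h : y ∈ t.leaves) :
    ∃ t' : NTree E, t'.name = t.name ∧ t'.tris = tri y a b ::ₘ t.tris := by
  induction t with
  | leaf x =>
    obtain rfl : y = x := by simpa using h
    exact ⟨node y (leaf a) (leaf b), rfl, by simp⟩
  | node x l r hl hr =>
    rcases Multiset.mem_add.1 h with h | h
    · obtain ⟨t', h1, h2⟩ := hl h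
      exact ⟨node x t' r, rfl, by simp [h1, h2, Multiset.cons_swap]⟩
    · obtain ⟨t', h1, h2⟩ := hr h
      exact ⟨node x l t', rfl, by simp [h1, h2, Multiset.cons_swap]⟩

theorem exists_eq_tri_of_mem {v : Multiset E} (hv : v.card = 3) {y : E} (hy : y ∈ v) :
    ∃ a b, v = tri y a b := by
  obtain ⟨w, rfl⟩ := Multiset.exists_cons_of_mem hy
  obtain ⟨a, b, rfl⟩ := Multiset.card_eq_two.1 (by simpa using hv : w.card = 2)
  exact ⟨a, b, rfl⟩

open Classical in
/-- A connected vertex system is formed by the vertices of a tree, namely a spanning tree: a tree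
that does not yet contain all vertices can be enlarged at a leaf or at the root. If the given name
`x` belongs to an edge with only one trivalent end, then the tree can be hung on this edge. -/
theorem exists_spanning_tree {S : VertexSystem E} (hS : Conn S) (h3 : ∀ v ∈ S, v.card = 3)
    (h2 : ∀ x, S.join.count x ≤ 2) {x : E} (hx : x ∈ S.join) :
    ∃ t : NTree E, t.tris = S ∧ (S.join.count x = 1 → t.name = x) := by
  suffices H : ∀ k, k < S.card → ∃ (t : NTree E) (R : VertexSystem E), t.nodes = k + 1 ∧
      t.tris + R = S ∧ (S.join.count x = 1 → t.name = x) by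
    obtain ⟨v, hv, -⟩ := Multiset.mem_join.1 hx
    have hpos : 0 < S.card := Multiset.card_pos_iff_exists_mem.2 ⟨v, hv⟩
    obtain ⟨t, R, hn, hR, hname⟩ := H (S.card - 1) (by omega)
    have : R.card = 0 := by
      have := congrArg Multiset.card hR
      rw [Multiset.card_add, card_tris] at this
      omega
    rw [Multiset.card_eq_zero] at this
    subst this
    exact ⟨t, by simpa using hR, hname⟩
  intro k
  induction k with
  | zero =>
    intro _
    obtain ⟨v, hv, hxv⟩ := Multiset.mem_join.1 hx
    obtain ⟨a, b, rfl⟩ := exists_eq_tri_of_mem (h3 v hv) hxv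
    obtain ⟨R, rfl⟩ := Multiset.exists_cons_of_mem hv
    exact ⟨node x (leaf a) (leaf b), R, rfl, by simp, fun _ => rfl⟩
  | succ k ih =>
    intro hk
    obtain ⟨t, R, hn, hR, hname⟩ := ih (by omega)
    have hRcard : 0 < R.card := by
      have := congrArg Multiset.card hR
      rw [Multiset.card_add, card_tris] at this
      omega
    -- some vertex outside the tree has an edge in common with the tree
    obtain ⟨v, hv, y, hyv, hyt⟩ : ∃ v ∈ R, ∃ y ∈ v, y ∈ t.tris.join := by
      by_contra! hcon
      rcases hS {y | y ∈ t.tris.join} (by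
          intro v hv
          rw [← hR, Multiset.mem_add] at hv
          rcases hv with hv | hv
          · exact .inl fun y hy => Multiset.mem_join.2 ⟨v, hv, hy⟩
          · exact .inr fun y hy => hcon v hv y hy) with h | h
      · obtain ⟨v, hv⟩ := Multiset.card_pos_iff_exists_mem.1 hRcard
        have hvS : v ∈ S := by rw [← hR]; exact Multiset.mem_add.2 (.inr hv)
        obtain ⟨y, hy⟩ := Multiset.card_pos_iff_exists_mem.1 (by rw [h3 v hvS]; omega : 0 < v.card)
        exact hcon v hv y hy (h v hvS y hy)
      · obtain ⟨v, hv⟩ := Multiset.card_pos_iff_exists_mem.1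
          (by rw [card_tris]; omega : 0 < t.tris.card)
        have hvS : v ∈ S := by rw [← hR]; exact Multiset.mem_add.2 (.inl hv)
        obtain ⟨y, hy⟩ := Multiset.card_pos_iff_exists_mem.1 (by rw [h3 v hvS]; omega : 0 < v.card)
        exact h v hvS y hy (Multiset.mem_join.2 ⟨v, hv, hy⟩)
    have hvS : v ∈ S := by rw [← hR]; exact Multiset.mem_add.2 (.inr hv)
    obtain ⟨a, b, rfl⟩ := exists_eq_tri_of_mem (h3 v hvS) hyv
    obtain ⟨R', rfl⟩ := Multiset.exists_cons_of_mem hv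
    have hcount : t.tris.join.count y + 1 ≤ S.join.count y := by
      rw [← hR, Multiset.join_add, Multiset.join_cons, Multiset.count_add, Multiset.count_add]
      have : 1 ≤ (tri y a b).count y := Multiset.one_le_count_iff_mem.2 hyv
      omega
    have hy2 := h2 y
    have hjoin := congrArg (Multiset.count y) t.join_tris
    have hpos := Multiset.one_le_count_iff_mem.2 hyt
    rw [Multiset.count_add, Multiset.count_add, Multiset.count_nsmul] at hjoin
    by_cases hleaf : y ∈ t.leaves
    · obtain ⟨t', h1, h2'⟩ := exists_grow_leaf y a b t hleaf
      refine ⟨t', R', ?_, ?_, fun h => h1.trans (hname h)⟩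
      · rw [← card_tris, h2', Multiset.card_cons, card_tris, hn]
      · rw [h2', ← hR]; simp
    · -- the common edge is the one on which the tree hangs
      have hyroot : y = t.name := by
        by_contra hne
        rw [Multiset.count_eq_zero.2 hleaf, Multiset.count_singleton, if_neg hne] at hjoin
        omega
      refine ⟨node a t (leaf b), R', by simp [hn], ?_, fun h => ?_⟩
      · rw [← hR, tris_node, name_leaf, ← hyroot, tri_swap_left]; simp
      · have := hname h
        rw [← this, ← hyroot] at h
        omega

end NTree

namespace NTree

open VertexSystem

variable {E F : Type}

/-! ### Rotating a tree into a comb and into a shallow tree -/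

/-- The right comb with tip `r`: the entry `(x, t)` of the list is a vertex of the spine hanging
on the edge `x` and carrying the subtree `t`. -/
def comb : List (E × NTree E) → NTree E → NTree E
  | [], r => r
  | (x, t) :: L, r => node x t (comb L r)

@[simp] theorem comb_nil (r : NTree E) : comb [] r = r := rfl
@[simp] theorem comb_cons (x : E) (t : NTree E) (L : List (E × NTree E)) (r : NTree E) :
    comb ((x, t) :: L) r = node x t (comb L r) := rfl

/-- The right comb all of whose subtrees are leaves. -/
def plainComb : List (E × E) → E → NTree E
  | [], e => leaf e
  | (x, a) :: B, e => node x (leaf a) (plainComb B e)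

@[simp] theorem plainComb_nil (e : E) : plainComb [] e = leaf e := rfl
@[simp] theorem plainComb_cons (x a : E) (B : List (E × E)) (e : E) :
    plainComb ((x, a) :: B) e = node x (leaf a) (plainComb B e) := rfl

theorem plainComb_eq_comb (B : List (E × E)) (e : E) :
    plainComb B e = comb (B.map fun q => (q.1, leaf q.2)) (leaf e) := by
  induction B with
  | nil => rfl
  | cons q B ih => obtain ⟨x, a⟩ := q; simp [ih]

theorem nodes_plainComb (B : List (E × E)) (e : E) : (plainComb B e).nodes = B.length := by
  induction B with
  | nil => rfl
  | cons q B ih => obtain ⟨x, a⟩ := q; simp [ih]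

/-- A tree whose right subtree is a comb is rotated into a comb; every rotation moves one vertex
of the left subtree to the spine. -/
theorem exists_plainComb_of_node (l : NTree E) (x : E) (B : List (E × E)) (e : E) :
    ∃ (B' : List (E × E)) (e' : E), (plainComb B' e').name = x ∧
      (plainComb B' e').leaves = l.leaves + (plainComb B e).leaves ∧
      Within l.nodes (node x l (plainComb B e)).tris (plainComb B' e').tris := by
  induction l generalizing x B e with
  | leaf a => exact ⟨(x, a) :: B, e, rfl, rfl, Within.refl _ _⟩
  | node y a b ha hb =>
    obtain ⟨B₁, e₁, hn₁, hl₁, hw₁⟩ := hb y B e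
    obtain ⟨B₂, e₂, hn₂, hl₂, hw₂⟩ := ha x B₁ e₁
    refine ⟨B₂, e₂, hn₂, by rw [hl₂, hl₁, leaves_node, add_assoc], ?_⟩
    have h1 := within_rotate x y a b (plainComb B e)
    have h2 := within_node x (Within.refl 0 a.tris) hw₁ rfl hn₁
    exact ((h1.trans h2).trans hw₂).mono (by simp; omega)

/-- The subtrees are rotated into combs one after the other; with `n` vertices, `n` rotations
suffice. -/
theorem exists_plainComb (t : NTree E) :
    ∃ (B : List (E × E)) (e : E), (plainComb B e).name = t.name ∧
      (plainComb B e).leaves = t.leaves ∧ Within t.nodes t.tris (plainComb B e).tris := by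
  induction t with
  | leaf x => exact ⟨[], x, rfl, rfl, Within.refl _ _⟩
  | node x l r _ hr =>
    obtain ⟨B₁, e₁, hn₁, hl₁, hw₁⟩ := hr
    obtain ⟨B₂, e₂, hn₂, hl₂, hw₂⟩ := exists_plainComb_of_node l x B₁ e₁
    refine ⟨B₂, e₂, hn₂, by rw [hl₂, hl₁, leaves_node], ?_⟩
    have h2 := within_node x (Within.refl 0 l.tris) hw₁ rfl hn₁
    exact (h2.trans hw₂).mono (by simp; omega)

/-- Rotating at every other vertex of the spine of a comb halves its length. -/
theorem exists_comb_halved (r : NTree E) (d : ℕ) : ∀ L : List (E × NTree E),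
    (∀ q ∈ L, q.2.depth ≤ d) → ∃ L' : List (E × NTree E), L'.length = (L.length + 1) / 2 ∧
      (∀ q ∈ L', q.2.depth ≤ d + 1) ∧ (comb L' r).name = (comb L r).name ∧
      (comb L' r).leaves = (comb L r).leaves ∧
      Within (L.length / 2) (comb L r).tris (comb L' r).tris
  | [], _ => ⟨[], by simp, by simp, rfl, rfl, Within.refl _ _⟩
  | [q], h => ⟨[q], by simp, fun q' hq' => (h q' hq').trans (by omega), rfl, rfl, Within.refl _ _⟩
  | (x, t) :: (y, u) :: L, h => by
    obtain ⟨L', h1, h2, h3, h4, h5⟩ := exists_comb_halved r d L fun q hq => h q (by simp [hq])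
    have ht := h (x, t) (by simp)
    have hu := h (y, u) (by simp)
    simp only at ht hu
    refine ⟨(x, node y t u) :: L', by simp [h1]; omega, ?_, rfl, by simp [h4, add_assoc], ?_⟩
    · intro q hq
      rcases List.mem_cons.1 hq with rfl | hq
      · simp [ht, hu]
      · exact h2 q hq
    · have h6 := (within_rotate x y t u (comb L r)).symm
      have h7 := within_node x (Within.refl 0 (node y t u).tris) h5 rfl h3
      exact (h6.trans h7).mono (by simp; omega)

/-- Halving repeatedly, a comb of length `n` is turned into a tree of logarithmic depth by at most
`n / 2 + n / 4 + ⋯ ≤ n` rotations. -/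
theorem exists_shallow_of_comb (r : NTree E) (n : ℕ) : ∀ (d : ℕ) (L : List (E × NTree E)),
    L.length = n → (∀ q ∈ L, q.2.depth ≤ d) → r.depth ≤ d →
    ∃ t : NTree E, t.name = (comb L r).name ∧ t.leaves = (comb L r).leaves ∧
      t.depth ≤ d + Nat.clog 2 n + 1 ∧ Within n (comb L r).tris t.tris := by
  induction n using Nat.strong_induction_on with
  | _ n ih =>
    intro d L hL hd hr
    by_cases hn : n ≤ 1
    · refine ⟨comb L r, rfl, rfl, ?_, Within.refl _ _⟩
      match L, hL with
      | [], _ => simp; omega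
      | [(x, t)], _ =>
        have := hd (x, t) (by simp)
        simp at this ⊢
        omega
      | _ :: _ :: _, h => simp at h; omega
    · obtain ⟨L', h1, h2, h3, h4, h5⟩ := exists_comb_halved r d L hd
      obtain ⟨t, ht1, ht2, ht3, ht4⟩ := ih ((n + 1) / 2) (by omega) (d + 1) L' (by rw [h1, hL]) h2
        (by omega)
      refine ⟨t, ht1.trans h3, ht2.trans h4, ?_, (h5.trans ht4).mono (by omega)⟩
      rw [Nat.clog_of_two_le (by omega) (by omega : 2 ≤ n)]
      simp only [Nat.add_succ_sub_one]
      omega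

/-- A tree is rotated into a comb first and then into a tree of logarithmic depth, at a cost that is
linear in its size. -/
theorem exists_shallow (t : NTree E) :
    ∃ t' : NTree E, t'.name = t.name ∧ t'.leaves = t.leaves ∧
      t'.depth ≤ Nat.clog 2 t.nodes + 1 ∧ Within (2 * t.nodes) t.tris t'.tris := by
  obtain ⟨B, e, hn, hl, hw⟩ := exists_plainComb t
  have hB : B.length = t.nodes := by
    have := congrArg Multiset.card hl
    rw [card_leaves, card_leaves, nodes_plainComb] at this
    omega
  rw [plainComb_eq_comb] at hn hl hw
  obtain ⟨t', h1, h2, h3, h4⟩ := exists_shallow_of_comb (leaf e) t.nodes 0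
    (B.map fun q => (q.1, leaf q.2)) (by simpa using hB)
    (by intro q hq; obtain ⟨q', -, rfl⟩ := List.mem_map.1 hq; simp) (by simp)
  exact ⟨t', h1.trans hn, h2.trans hl, by omega, (hw.trans h4).mono (by omega)⟩

/-! ### Collecting the loops at the root -/

/-- A leaf of a tree is moved to the root along the path that joins them. -/
theorem exists_pull_leaf (y : E) (t : NTree E) (hy : y ∈ t.leaves) (ht : t.nodes ≠ 0) :
    ∃ (z : E) (t' : NTree E), z = t.name ∧ y ::ₘ t'.leaves = t.leaves ∧ t'.depth ≤ t.depth ∧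
      Within t.depth t.tris (node z (leaf y) t').tris := by
  induction t with
  | leaf x => simp at ht
  | node x l r hl hr =>
    -- by symmetry the leaf can be taken in the left subtree
    have main : ∀ l r : NTree E, y ∈ l.leaves → (l.nodes ≠ 0 → ∃ (z : E) (t' : NTree E),
        z = l.name ∧ y ::ₘ t'.leaves = l.leaves ∧ t'.depth ≤ l.depth ∧
        Within l.depth l.tris (node z (leaf y) t').tris) → ∃ (z : E) (t' : NTree E),
        z = x ∧ y ::ₘ t'.leaves = (node x l r).leaves ∧ t'.depth ≤ (node x l r).depth ∧
        Within (node x l r).depth (node x l r).tris (node z (leaf y) t').tris := by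
      intro l r hy ih
      cases l with
      | leaf a =>
        obtain rfl : y = a := by simpa using hy
        exact ⟨x, r, rfl, by simp, by simp, Within.refl _ _⟩
      | node a l₁ l₂ =>
        obtain ⟨z, t', rfl, h1, h2, h3⟩ := ih (by simp)
        refine ⟨x, node z t' r, rfl, ?_, ?_, ?_⟩
        · rw [leaves_node, leaves_node x, ← h1, Multiset.cons_add]
        · rw [depth_node, depth_node x]
          exact Nat.succ_le_succ (max_le_max h2 le_rfl)
        · have h4 := within_node x h3 (Within.refl 0 r.tris) rfl rfl
          have h5 := within_rotate x z (leaf y) t' r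
          refine (h4.trans h5).mono ?_
          rw [depth_node x]
          omega
    rcases Multiset.mem_add.1 hy with hy | hy
    · exact main l r hy (hl hy)
    · obtain ⟨z, t', h1, h2, h3, h4⟩ := main r l hy (hr hy)
      refine ⟨z, t', h1, by rw [h2, leaves_node, leaves_node, add_comm], ?_, ?_⟩
      · simp only [depth_node] at h3 ⊢; rwa [max_comm]
      · rw [tris_comm]
        simp only [depth_node] at h4 ⊢; rwa [max_comm]

/-- The right comb with tip `r` whose subtrees are loops: the entry `(x, z, y)` of the list is a
vertex hanging on the edge `x` and carrying a loop `y` on a stalk `z`. -/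
def loopComb : List (E × E × E) → NTree E → NTree E
  | [], r => r
  | (x, z, y) :: A, r => node x (node z (leaf y) (leaf y)) (loopComb A r)

@[simp] theorem loopComb_nil (r : NTree E) : loopComb [] r = r := rfl
@[simp] theorem loopComb_cons (x z y : E) (A : List (E × E × E)) (r : NTree E) :
    loopComb ((x, z, y) :: A) r = node x (node z (leaf y) (leaf y)) (loopComb A r) := rfl

/-- In a tree of depth at most `d`, the pairs of leaves with the same name are moved to the root
one after the other, at the cost of `2 * d + 1` moves for each of them, and become loops there. -/
theorem exists_loopComb (d : ℕ) (P : Multiset E) (hP : P ≠ 0) (Q : Multiset E) :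
    ∀ t : NTree E, t.depth ≤ d → t.leaves = P + 2 • Q →
    ∃ (A : List (E × E × E)) (r : NTree E), A.length = Q.card ∧ r.leaves = P ∧
      (A.map fun q => q.2.2 : Multiset E) = Q ∧
      (loopComb A r).name = t.name ∧
      Within (Q.card * (2 * d + 1)) t.tris (loopComb A r).tris := by
  induction Q using Multiset.induction with
  | empty => exact fun t _ ht => ⟨[], t, rfl, by simpa using ht, rfl, rfl, Within.refl _ _⟩
  | cons y Q ih =>
    intro t htd ht
    have hPpos : 0 < P.card := Multiset.card_pos.2 hP
    have ht' : t.leaves = y ::ₘ y ::ₘ (P + 2 • Q) := by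
      rw [ht, ← Multiset.singleton_add, ← Multiset.singleton_add, ← Multiset.singleton_add,
        smul_add, two_smul ℕ ({y} : Multiset E)]
      abel
    have hcard := congrArg Multiset.card ht'
    rw [card_leaves] at hcard
    simp only [Multiset.card_cons, Multiset.card_add] at hcard
    obtain ⟨x, t₁, rfl, hl₁, hd₁, hw₁⟩ := exists_pull_leaf y t (by simp [ht']) (by omega)
    rw [ht', Multiset.cons_inj_right] at hl₁
    have hcard₁ := congrArg Multiset.card hl₁
    rw [card_leaves] at hcard₁
    simp only [Multiset.card_cons, Multiset.card_add] at hcard₁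
    obtain ⟨z, t₂, rfl, hl₂, hd₂, hw₂⟩ := exists_pull_leaf y t₁ (by simp [hl₁]) (by omega)
    rw [hl₁, Multiset.cons_inj_right] at hl₂
    obtain ⟨A, r, hA, hr, hAQ, hn, hw⟩ := ih t₂ (by omega) hl₂
    refine ⟨(t.name, t₁.name, y) :: A, r, by simp [hA], hr, ?_, rfl, ?_⟩
    · rw [← hAQ]; rfl
    have h1 := within_node t.name (Within.refl 0 (leaf y).tris) hw₂ rfl rfl
    have h2 := (within_rotate t.name t₁.name (leaf y) (leaf y) t₂).symm
    have h3 := within_node t.name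
      (Within.refl 0 (node t₁.name (leaf y) (leaf y)).tris) hw rfl hn
    refine (((hw₁.trans h1).trans h2).trans h3).mono ?_
    rw [Multiset.card_cons, add_mul]
    omega

end NTree

/-! ### Normal forms -/

namespace VertexSystem

variable {E F : Type}

open Classical in
/-- The vertex systems of the connected graphs of rank `g` with `p` vertices of valence one and
`2 * g - 2 + p` vertices of valence three. -/
structure IsMarked (S : VertexSystem E) (g p : ℕ) : Prop where
  conn : Conn S
  card_vertex : ∀ v ∈ S, v.card = 3
  count_le : ∀ x, S.join.count x ≤ 2
  card : S.card + 2 = 2 * g + p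
  plain : {x | S.join.count x = 1}.ncard = p

open Classical in
theorem finite_plain (S : VertexSystem E) : {x | S.join.count x = 1}.Finite :=
  S.join.toFinset.finite_toSet.subset fun x hx => by
    simp only [Set.mem_ofPred_eq] at hx
    exact Multiset.mem_toFinset.2 (Multiset.one_le_count_iff_mem.1 hx.ge)

end VertexSystem

namespace NTree

open VertexSystem

variable {E F : Type}

open Classical in
theorem exists_eq_add_two_nsmul (L : Multiset E) (hL : ∀ x, L.count x ≤ 2) :
    ∃ P Q : Multiset E, L = P + 2 • Q ∧ ∀ x, P.count x ≤ 1 := by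
  refine ⟨L.dedup.filter (L.count · = 1), L.dedup.filter (L.count · = 2), ?_, fun x => ?_⟩
  · ext x
    have := hL x
    rw [Multiset.count_add, Multiset.count_nsmul, Multiset.count_filter, Multiset.count_filter,
      Multiset.count_dedup]
    have h0 : x ∈ L ↔ 1 ≤ L.count x := Multiset.one_le_count_iff_mem.symm
    simp only [h0]
    split_ifs <;> omega
  · exact (Multiset.count_le_of_le x (Multiset.filter_le _ _)).trans
      (Multiset.nodup_iff_count_le_one.1 L.nodup_dedup x)

/-- The names in the tree `loopComb A (plainComb B e)`, each of them listed once and without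
the name `e` of its tip. -/
def combNames (A : List (E × E × E)) (B : List (E × E)) : List E :=
  A.flatMap (fun q => [q.1, q.2.1, q.2.2]) ++ B.flatMap fun q => [q.1, q.2]

theorem leaves_plainComb (B : List (E × E)) (e : E) :
    (plainComb B e).leaves = (B.map Prod.snd : Multiset E) + {e} := by
  induction B with
  | nil => simp
  | cons q B ih =>
    obtain ⟨x, a⟩ := q
    simp [ih, ← Multiset.singleton_add, ← Multiset.cons_coe, add_assoc]

theorem leaves_loopComb (A : List (E × E × E)) (r : NTree E) :
    (loopComb A r).leaves = r.leaves + 2 • (A.map fun q => q.2.2 : Multiset E) := by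
  induction A with
  | nil => simp
  | cons q A ih =>
    obtain ⟨x, z, y⟩ := q
    simp only [loopComb_cons, leaves_node, leaves_leaf, ih, List.map_cons, ← Multiset.cons_coe,
      ← Multiset.singleton_add, smul_add, two_smul ℕ ({y} : Multiset E)]
    abel

theorem coe_combNames (A : List (E × E × E)) (B : List (E × E)) (e : E) :
    (combNames A B : Multiset E) = (loopComb A (plainComb B e)).nodeNames +
      (A.map fun q => q.2.2 : Multiset E) + (B.map Prod.snd : Multiset E) := by
  induction A with
  | nil =>
    induction B with
    | nil => simp [combNames]
    | cons q B ih =>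
      obtain ⟨x, a⟩ := q
      simp only [combNames, List.flatMap_nil, List.nil_append, loopComb_nil, List.map_nil,
        Multiset.coe_nil, add_zero, List.flatMap_cons, ← Multiset.coe_add, plainComb_cons,
        nodeNames_node, nodeNames_leaf, zero_add, List.map_cons, ← Multiset.cons_coe,
        ← Multiset.singleton_add] at ih ⊢
      rw [ih]; abel
  | cons q A ih =>
    obtain ⟨x, z, y⟩ := q
    simp only [combNames, List.flatMap_cons, ← Multiset.coe_add, loopComb_cons, nodeNames_node,
      nodeNames_leaf, add_zero, List.map_cons, ← Multiset.cons_coe, Multiset.coe_nil,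
      ← Multiset.singleton_add] at ih ⊢
    rw [add_assoc, ih]; abel

/-- The normal form for rank `g` and `p` plain leaves is the tree `loopComb A (plainComb B e)`
in which the only coincidences of names are those of the loops and the following ones: for `p = 0`
the tip is joined to the root, so that the loops sit on a circle; for `p = 1` the tip is joined to
the leaf next to it and forms one more loop; for `2 ≤ p` the tip is plain. -/
def IsNormalForm (g p : ℕ) (A : List (E × E × E)) (B : List (E × E)) (e : E) : Prop :=
  (combNames A B).Nodup ∧
    ((p = 0 ∧ A.length + 1 = g ∧ B = [] ∧ ∃ (z y : E) (A' : List (E × E × E)),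
        A = (e, z, y) :: A') ∨
      (p = 1 ∧ A.length + 1 = g ∧ ∃ z, B = [(z, e)]) ∨
      (2 ≤ p ∧ A.length = g ∧ B.length + 2 = p ∧ e ∉ combNames A B))

open Classical in
/-- A tree is brought to normal form in three rounds: it is made shallow, its loops are collected
at the root, and the remaining plain leaves are arranged along a comb. -/
theorem exists_comb_within (t : NTree E) (P Q : Multiset E) (hP : P ≠ 0)
    (ht : t.leaves = P + 2 • Q) :
    ∃ (A : List (E × E × E)) (B : List (E × E)) (e : E), A.length = Q.card ∧
      (A.map fun q => q.2.2 : Multiset E) = Q ∧ (plainComb B e).leaves = P ∧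
      (loopComb A (plainComb B e)).name = t.name ∧
      Within (2 * t.nodes + Q.card * (2 * Nat.clog 2 t.nodes + 3) + P.card) t.tris
        (loopComb A (plainComb B e)).tris := by
  obtain ⟨u, hu1, hu2, hu3, hu4⟩ := exists_shallow t
  obtain ⟨A, r, hA, hr, hAQ, hn, hw⟩ := exists_loopComb _ P hP Q u hu3 (hu2.trans ht)
  obtain ⟨B, e, hBn, hBl, hBw⟩ := exists_plainComb r
  have hrP : r.nodes ≤ P.card := by
    have := r.card_leaves
    rw [hr] at this
    omega
  have key : ∀ A : List (E × E × E), (loopComb A (plainComb B e)).name = (loopComb A r).name ∧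
      Within r.nodes (loopComb A r).tris (loopComb A (plainComb B e)).tris := by
    intro A
    induction A with
    | nil => exact ⟨hBn, hBw⟩
    | cons q A ih =>
      obtain ⟨x, z, y⟩ := q
      refine ⟨rfl, ?_⟩
      have := within_node x (Within.refl 0 (node z (leaf y) (leaf y)).tris) ih.2 rfl ih.1
      exact this.mono (by omega)
  refine ⟨A, B, e, hA, hAQ, hBl.trans hr, (key A).1.trans (hn.trans hu1), ?_⟩
  refine ((hu4.trans hw).trans (key A).2).mono ?_
  have : 2 * (Nat.clog 2 t.nodes + 1) + 1 = 2 * Nat.clog 2 t.nodes + 3 := by ring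
  rw [this]
  omega

open Classical in
/-- A marked graph is brought to normal form within a number of moves of order
`g log (g + p) + g + p`: cut it open to a spanning tree, which is hung on a plain edge if there is
one, and apply `exists_comb_within` to this tree. The leaves of the tree consist
of the plain edges, apart from the one on which it may hang, and of the cut edges, the latter
occurring twice (without plain edges, the edge at the root may be a single leaf). -/
theorem exists_normalForm {S : VertexSystem E} {g p : ℕ} (hS : S.IsMarked g p)
    (hgp : 2 < 2 * g + p) :
    ∃ (A : List (E × E × E)) (B : List (E × E)) (e : E), IsNormalForm g p A B e ∧
      Within (2 * S.card + g * (2 * Nat.clog 2 S.card + 3) + (p + 2)) S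
        (loopComb A (plainComb B e)).tris := by
  have hScard := hS.card
  obtain ⟨x, hx, hxp⟩ : ∃ x ∈ S.join, 1 ≤ p → S.join.count x = 1 := by
    rcases Nat.eq_zero_or_pos p with hp | hp
    · obtain ⟨v, hv⟩ := Multiset.card_pos_iff_exists_mem.1 (by omega : 0 < S.card)
      obtain ⟨x, hx⟩ := Multiset.card_pos_iff_exists_mem.1
        (by rw [hS.card_vertex v hv]; omega : 0 < v.card)
      exact ⟨x, Multiset.mem_join.2 ⟨v, hv, hx⟩, by omega⟩
    · obtain ⟨x, hx⟩ := Set.nonempty_of_ncard_ne_zero (by rw [hS.plain]; omega)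
      exact ⟨x, Multiset.one_le_count_iff_mem.1 hx.ge, fun _ => hx⟩
  obtain ⟨t, rfl, hname⟩ := exists_spanning_tree hS.conn hS.card_vertex hS.count_le hx
  replace hname : 1 ≤ p → t.name = x := fun h => hname (hxp h)
  have hcount : ∀ w, t.tris.join.count w + (if w = t.name then 1 else 0) =
      t.leaves.count w + 2 * t.nodeNames.count w := fun w => by
    have := congrArg (Multiset.count w) t.join_tris
    rwa [Multiset.count_add, Multiset.count_add, Multiset.count_nsmul,
      Multiset.count_singleton] at this
  have hle := hS.count_le
  have hroot : 1 ≤ t.nodeNames.count t.name := by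
    rw [Multiset.one_le_count_iff_mem]
    cases t with
    | leaf => simp at hx
    | node => simp
  have hLle : ∀ w, t.leaves.count w ≤ 2 := fun w => by
    have h1 := hcount w
    have h2 := hle w
    split_ifs at h1 with h
    · subst h; omega
    · omega
  have hlc := t.card_leaves
  rw [← card_tris] at hlc
  -- the count that shows that the names in a normal form are distinct
  have hnf : ∀ (A : List (E × E × E)) (B : List (E × E)) (e : E) (k : ℕ),
      (loopComb A (plainComb B e)).name = t.name →
      Within k t.tris (loopComb A (plainComb B e)).tris → ∀ w,
      t.tris.join.count w + (if w = t.name then 1 else 0) =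
        (((B.map Prod.snd : Multiset E).count w + if w = e then 1 else 0) +
          2 * (A.map fun q => q.2.2 : Multiset E).count w) +
        2 * (loopComb A (plainComb B e)).nodeNames.count w ∧
      (combNames A B).count w = (loopComb A (plainComb B e)).nodeNames.count w +
        (A.map fun q => q.2.2 : Multiset E).count w + (B.map Prod.snd : Multiset E).count w := by
    intro A B e k hn hw w
    constructor
    · have := congrArg (Multiset.count w) (loopComb A (plainComb B e)).join_tris
      rw [hw.join_eq, hn, leaves_loopComb, leaves_plainComb] at this
      simpa only [Multiset.count_add, Multiset.count_nsmul, Multiset.count_singleton] using this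
    · have := congrArg (Multiset.count w) (coe_combNames A B e)
      rw [Multiset.count_add, Multiset.count_add] at this
      rw [← this, Multiset.coe_count]
  obtain ⟨P, Q, hPQ, hP1⟩ := exists_eq_add_two_nsmul t.leaves hLle
  have hPQcard := congrArg Multiset.card hPQ
  rw [Multiset.card_add, Multiset.card_nsmul] at hPQcard
  have hPQcount : ∀ w, t.leaves.count w = P.count w + 2 * Q.count w := fun w => by
    rw [hPQ, Multiset.count_add, Multiset.count_nsmul]
  rcases Nat.eq_zero_or_pos p with hp | hp
  · -- without plain edges, only the root can be a single leaf
    have hno : ∀ w, t.tris.join.count w ≠ 1 := by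
      intro w hw
      have := hS.plain
      rw [hp, Set.ncard_eq_zero (finite_plain _)] at this
      exact this.le (show w ∈ {x | t.tris.join.count x = 1} from hw)
    have hPle : P ≤ {t.name} := by
      rw [Multiset.le_iff_count]
      intro w
      have h1 := hcount w
      have h2 := hle w
      have h3 := hPQcount w
      have h4 := hP1 w
      have h5 := hno w
      rw [Multiset.count_singleton]
      split_ifs at h1 ⊢ with h <;> omega
    have hPr : P = {t.name} := by
      refine Multiset.eq_of_le_of_card_le hPle ?_
      have := Multiset.card_le_card hPle
      rw [Multiset.card_singleton] at this ⊢
      omega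
    obtain ⟨A, B, e, hA, -, hB, hn, hw⟩ := exists_comb_within t P Q (by simp [hPr]) hPQ
    have hQ : Q.card + 1 = g := by
      rw [hPr, Multiset.card_singleton] at hPQcard
      omega
    have hB0 : B = [] := by
      have := congrArg Multiset.card hB
      rw [card_leaves, nodes_plainComb, hPr, Multiset.card_singleton] at this
      exact List.length_eq_zero_iff.1 (by omega)
    subst hB0
    have he : e = t.name := by
      rw [plainComb_nil, leaves_leaf, hPr] at hB
      exact Multiset.singleton_inj.1 hB
    subst he
    refine ⟨A, [], t.name, ⟨?_, .inl ⟨hp, by omega, rfl, ?_⟩⟩, ?_⟩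
    · rw [List.nodup_iff_count_le_one]
      intro w
      obtain ⟨h1, h2⟩ := hnf A [] t.name _ hn hw w
      have h3 := hle w
      rw [h2]
      simp only [List.map_nil, Multiset.coe_nil, Multiset.count_zero] at h1 ⊢
      split_ifs at h1 <;> omega
    · match A, hA, hn with
      | [], h, _ => simp at h; omega
      | (a, z, y) :: A', _, h => exact ⟨z, y, A', by simpa using h⟩
    · refine hw.mono ?_
      rw [card_tris, hPr, Multiset.card_singleton]
      have := Nat.mul_le_mul_right (2 * Nat.clog 2 t.nodes + 3) (show Q.card ≤ g by omega)
      omega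
  · -- the root is plain, and the other plain edges are the elements of `P`
    have hxname := hname hp
    have hx1 := hxp hp
    rw [← hxname] at hx1
    have hrl : t.leaves.count t.name = 0 := by
      have := hcount t.name
      rw [if_pos rfl] at this
      omega
    have hPcard : P.card + 1 = p := by
      have hset : {w | t.tris.join.count w = 1} = ((t.name ::ₘ P).toFinset : Set E) := by
        ext w
        simp only [Set.mem_ofPred_eq, Multiset.toFinset_cons, Finset.coe_insert, Set.mem_insert_iff,
          Finset.mem_coe, Multiset.mem_toFinset]
        have h1 := hcount w
        have h3 := hPQcount w
        have h4 := hP1 w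
        have h5 : w ∈ P ↔ 1 ≤ P.count w := Multiset.one_le_count_iff_mem.symm
        rw [h5]
        by_cases h : w = t.name
        · subst h; simp [hx1]
        · rw [if_neg h] at h1
          simp only [h, false_or]
          have h6 := hle w
          by_cases hl : 1 ≤ t.leaves.count w
          · omega
          · omega
      have hnd : (t.name ::ₘ P).Nodup := by
        rw [Multiset.nodup_cons]
        refine ⟨fun h => ?_, Multiset.nodup_iff_count_le_one.2 hP1⟩
        have := Multiset.one_le_count_iff_mem.2 h
        have := hPQcount t.name
        omega
      have := hS.plain
      rw [hset, Set.ncard_coe_finset, Multiset.toFinset_card_of_nodup hnd,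
        Multiset.card_cons] at this
      exact this
    have hQcard : Q.card = g := by omega
    rcases Nat.lt_or_ge p 2 with hp2 | hp2
    · -- with a single plain edge, one pair of leaves has to stay at the tip
      obtain rfl : p = 1 := by omega
      obtain rfl : P = 0 := by rw [← Multiset.card_eq_zero]; omega
      obtain ⟨y, hy⟩ := Multiset.card_pos_iff_exists_mem.1 (by omega : 0 < Q.card)
      obtain ⟨Q', rfl⟩ := Multiset.exists_cons_of_mem hy
      have hQ' : t.leaves = {y, y} + 2 • Q' := by
        rw [hPQ, zero_add, ← Multiset.singleton_add, smul_add, two_smul ℕ ({y} : Multiset E)]; rfl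
      obtain ⟨A, B, e, hA, hAQ, hB, hn, hw⟩ := exists_comb_within t {y, y} Q' (by simp) hQ'
      rw [Multiset.card_cons] at hQcard
      have hB1 : B.length = 1 := by
        have := congrArg Multiset.card hB
        rw [card_leaves, nodes_plainComb] at this
        simpa using this
      obtain ⟨⟨z, a⟩, rfl⟩ := List.length_eq_one_iff.1 hB1
      have hmem : ∀ w ∈ (plainComb [(z, a)] e).leaves, w = y := by
        intro w hw
        rw [hB] at hw
        simpa using hw
      obtain rfl : a = y := hmem a (by simp)
      obtain rfl : e = a := hmem e (by simp)
      refine ⟨A, [(z, e)], e, ⟨?_, .inr (.inl ⟨rfl, by omega, z, rfl⟩)⟩, ?_⟩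
      · rw [List.nodup_iff_count_le_one]
        intro w
        obtain ⟨h1, h2⟩ := hnf A [(z, e)] e _ hn hw w
        have h3 := hle w
        rw [h2]
        simp only [List.map_cons, List.map_nil, Multiset.coe_singleton,
          Multiset.count_singleton] at h1 ⊢
        split_ifs at h1 ⊢ <;> omega
      · refine hw.mono ?_
        rw [card_tris]
        have := Nat.mul_le_mul_right (2 * Nat.clog 2 t.nodes + 3) (show Q'.card ≤ g by omega)
        simp only [Multiset.insert_eq_cons, Multiset.card_cons, Multiset.card_singleton]
        omega
    · obtain ⟨A, B, e, hA, hAQ, hB, hn, hw⟩ := exists_comb_within t P Q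
        (by rw [← Multiset.card_pos]; omega) hPQ
      have hBlen : B.length + 2 = p := by
        have := congrArg Multiset.card hB
        rw [card_leaves, nodes_plainComb] at this
        omega
      have hle1 : ∀ w, (combNames A B).count w + (if w = e then 1 else 0) ≤ 1 := by
        intro w
        obtain ⟨h1, h2⟩ := hnf A B e _ hn hw w
        have h3 := hle w
        have h4 := hP1 w
        have h5 := hPQcount w
        rw [← hB, leaves_plainComb, Multiset.count_add, Multiset.count_singleton] at h4 h5
        rw [h2]
        by_cases h : w = t.name
        · subst h
          rw [hrl] at h5
          split_ifs at h1 h4 h5 ⊢ <;> omega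
        · rw [if_neg h] at h1
          split_ifs at h1 h4 h5 ⊢ <;> omega
      refine ⟨A, B, e, ⟨?_, .inr (.inr ⟨hp2, by omega, hBlen, fun h => ?_⟩)⟩, ?_⟩
      · rw [List.nodup_iff_count_le_one]
        intro w
        exact (Nat.le_add_right _ _).trans (hle1 w)
      · have h1 := hle1 e
        rw [if_pos rfl] at h1
        have := List.one_le_count_iff.2 h
        omega
      · refine hw.mono ?_
        rw [card_tris, hQcard]
        omega

end NTree

namespace NTree

open VertexSystem

variable {E F : Type}

theorem map_plainComb (f : E → F) (B : List (E × E)) (e : E) :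
    (plainComb B e).map f = plainComb (B.map (Prod.map f f)) (f e) := by
  induction B with
  | nil => rfl
  | cons q B ih => obtain ⟨x, a⟩ := q; simp [map, ih]

theorem map_loopComb (f : E → F) (A : List (E × E × E)) (r : NTree E) :
    (loopComb A r).map f = loopComb (A.map (Prod.map f (Prod.map f f))) (r.map f) := by
  induction A with
  | nil => rfl
  | cons q A ih => obtain ⟨x, z, y⟩ := q; simp [map, ih]

theorem map_combNames (f : E → F) (A : List (E × E × E)) (B : List (E × E)) :
    (combNames A B).map f =
      combNames (A.map (Prod.map f (Prod.map f f))) (B.map (Prod.map f f)) := by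
  simp [combNames, List.map_flatMap, List.flatMap_map]

/-- The names are listed in a fixed order, so that the list determines the tree once its shape is
known. -/
theorem combNames_inj {A A' : List (E × E × E)} {B B' : List (E × E)}
    (hA : A.length = A'.length) (hB : B.length = B'.length)
    (h : combNames A B = combNames A' B') : A = A' ∧ B = B' := by
  induction A generalizing A' with
  | nil =>
    obtain rfl : A' = [] := List.length_eq_zero_iff.1 hA.symm
    refine ⟨rfl, ?_⟩
    induction B generalizing B' with
    | nil => exact (List.length_eq_zero_iff.1 hB.symm).symm
    | cons q B ih =>
      obtain ⟨x, a⟩ := q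
      match B', hB with
      | (x', a') :: B', hB =>
        simp only [combNames, List.flatMap_nil, List.flatMap_cons, List.nil_append,
          List.cons_append, List.cons.injEq] at h ih
        obtain ⟨rfl, rfl, h⟩ := h
        rw [ih (by simpa using hB) h]
  | cons q A ih =>
    obtain ⟨x, z, y⟩ := q
    match A', hA with
    | (x', z', y') :: A', hA =>
      simp only [combNames, List.flatMap_cons, List.nil_append,
        List.cons_append, List.cons.injEq] at h ih
      obtain ⟨rfl, rfl, rfl, h⟩ := h
      obtain ⟨rfl, rfl⟩ := ih (by simpa using hA) h
      exact ⟨rfl, rfl⟩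

theorem length_combNames (A : List (E × E × E)) (B : List (E × E)) :
    (combNames A B).length = 3 * A.length + 2 * B.length := by
  simp [combNames, List.length_flatMap, mul_comm]

/-- Two duplicate-free lists of the same length correspond to each other under an injection. -/
theorem exists_map_eq_of_nodup [Nonempty F] {l : List E} {l' : List F} (h : l.Nodup)
    (h' : l'.Nodup) (hlen : l.length = l'.length) :
    ∃ f : E → F, l.map f = l' ∧ Set.InjOn f {x | x ∈ l} := by
  induction l generalizing l' with
  | nil =>
    obtain rfl : l' = [] := List.length_eq_zero_iff.1 hlen.symm
    exact ⟨fun _ => Classical.arbitrary F, rfl, fun x hx => by simp at hx⟩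
  | cons a l ih =>
    match l', hlen with
    | b :: l', hlen =>
      rw [List.nodup_cons] at h h'
      obtain ⟨f, hf, hinj⟩ := ih h.2 h'.2 (by simpa using hlen)
      classical
      have hcongr : ∀ x ∈ l, Function.update f a b x = f x := fun x hx =>
        Function.update_of_ne (by rintro rfl; exact h.1 hx) _ _
      have hb : ∀ x ∈ l, f x ≠ b := fun x hx hxb =>
        h'.1 (by rw [← hf, ← hxb]; exact List.mem_map_of_mem hx)
      refine ⟨Function.update f a b, ?_, ?_⟩
      · rw [List.map_cons, Function.update_self, List.map_congr_left hcongr, hf]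
      · intro x hx y hy hxy
        rcases List.mem_cons.1 hx with rfl | hx' <;> rcases List.mem_cons.1 hy with rfl | hy'
        · rfl
        · rw [Function.update_self, hcongr y hy'] at hxy
          exact absurd hxy.symm (hb y hy')
        · rw [Function.update_self, hcongr x hx'] at hxy
          exact absurd hxy (hb x hx')
        · rw [hcongr x hx', hcongr y hy'] at hxy
          exact hinj hx' hy' hxy

theorem mem_combNames_of_mem_join {A : List (E × E × E)} {B : List (E × E)} {e x : E}
    (hx : x ∈ (loopComb A (plainComb B e)).tris.join) : x ∈ combNames A B ∨ x = e := by
  have h1 : x ∈ (loopComb A (plainComb B e)).tris.join + {(loopComb A (plainComb B e)).name} :=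
    Multiset.mem_add.2 (.inl hx)
  rw [join_tris, leaves_loopComb, leaves_plainComb] at h1
  rw [← Multiset.mem_coe, coe_combNames A B e]
  simp only [Multiset.mem_add, two_smul, Multiset.mem_singleton] at h1 ⊢
  tauto

/-- The normal form is unique: its shape depends only on `g` and `p`, and matching the names in the
order in which they are listed is a renaming. -/
theorem renaming_of_isNormalForm {g p : ℕ} {A : List (E × E × E)} {B : List (E × E)} {e : E}
    {A' : List (F × F × F)} {B' : List (F × F)} {e' : F} (h : IsNormalForm g p A B e)
    (h' : IsNormalForm g p A' B' e') :
    Renaming (loopComb A (plainComb B e)).tris (loopComb A' (plainComb B' e')).tris := by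
  have : Nonempty F := ⟨e'⟩
  obtain ⟨hnd, hcase⟩ := h
  obtain ⟨hnd', hcase'⟩ := h'
  have hlen : A.length = A'.length ∧ B.length = B'.length := by
    rcases hcase with ⟨rfl, h1, rfl, -⟩ | ⟨rfl, h1, z, rfl⟩ | ⟨hp, h1, h2, -⟩ <;>
      rcases hcase' with ⟨h0', h1', rfl, -⟩ | ⟨h0', h1', z, rfl⟩ | ⟨hp', h1', h2', -⟩ <;>
      constructor <;> (try simp only [List.length_nil, List.length_cons]) <;> omega
  suffices H : ∃ f : E → F, (combNames A B).map f = combNames A' B' ∧ f e = e' ∧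
      Set.InjOn f {x | x ∈ combNames A B ∨ x = e} by
    obtain ⟨f, hf, rfl, hinj⟩ := H
    rw [map_combNames] at hf
    obtain ⟨rfl, rfl⟩ := combNames_inj (by simpa using hlen.1) (by simpa using hlen.2) hf
    refine ⟨f, hinj.mono fun x hx => mem_combNames_of_mem_join hx, ?_⟩
    rw [← tris_map, map_loopComb, map_plainComb]
  have hlen' : (combNames A B).length = (combNames A' B').length := by
    rw [length_combNames, length_combNames, hlen.1, hlen.2]
  by_cases hp : 2 ≤ p
  · have he : e ∉ combNames A B := by
      rcases hcase with ⟨h0, -⟩ | ⟨h0, -⟩ | ⟨-, -, -, h⟩ <;> first | exact h | omega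
    have he' : e' ∉ combNames A' B' := by
      rcases hcase' with ⟨h0, -⟩ | ⟨h0, -⟩ | ⟨-, -, -, h⟩ <;> first | exact h | omega
    obtain ⟨f, hf, hinj⟩ := exists_map_eq_of_nodup (List.nodup_cons.2 ⟨he, hnd⟩)
      (List.nodup_cons.2 ⟨he', hnd'⟩) (by simpa using hlen')
    rw [List.map_cons, List.cons.injEq] at hf
    refine ⟨f, hf.2, hf.1, hinj.mono fun x hx => ?_⟩
    exact List.mem_cons.2 hx.symm
  · obtain ⟨f, hf, hinj⟩ := exists_map_eq_of_nodup hnd hnd' hlen'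
    have hf' := hf
    rw [map_combNames] at hf'
    obtain ⟨hA, hB⟩ := combNames_inj (by simpa using hlen.1) (by simpa using hlen.2) hf'
    -- the tip is one of the listed names, at the same place in both normal forms
    have key : f e = e' ∧ e ∈ combNames A B := by
      rcases hcase with ⟨h0, -, -, z, y, A₁, rfl⟩ | ⟨h0, -, z, rfl⟩ | ⟨h0, -⟩
      · rcases hcase' with ⟨-, -, -, z', y', A₁', rfl⟩ | ⟨h0', -⟩ | ⟨h0', -⟩
        · simp only [List.map_cons, Prod.map_apply, List.cons.injEq, Prod.mk.injEq] at hA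
          exact ⟨hA.1.1, by simp [combNames]⟩
        all_goals omega
      · rcases hcase' with ⟨h0', -⟩ | ⟨-, -, z', rfl⟩ | ⟨h0', -⟩
        · omega
        · simp only [List.map_cons, Prod.map_apply, List.cons.injEq, Prod.mk.injEq] at hB
          exact ⟨hB.1.2, by simp [combNames]⟩
        · omega
      · omega
    refine ⟨f, hf, key.1, hinj.mono fun x hx => ?_⟩
    rcases hx with hx | rfl
    · exact hx
    · exact key.2

end NTree

/-! ### Graphs and their vertex systems -/

namespace FinMultigraph

open VertexSystem

variable {E F : Type}

instance instFiniteV (G : FinMultigraph) : Finite G.V := G.finiteV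
instance instFiniteH (G : FinMultigraph) : Finite G.H := G.finiteH
noncomputable instance instFintypeV (G : FinMultigraph) : Fintype G.V := Fintype.ofFinite G.V
noncomputable instance instFintypeH (G : FinMultigraph) : Fintype G.H := Fintype.ofFinite G.H

/-- A naming of the edges of a graph, as a function on half-edges. -/
def IsNaming (G : FinMultigraph) (ν : G.H → E) : Prop :=
  ∀ h h', ν h' = ν h ↔ h' = h ∨ h' = G.opp h

open Classical in
/-- The half-edges at a vertex. -/
noncomputable def star (G : FinMultigraph) (v : G.V) : Finset G.H :=
  Finset.univ.filter fun h => G.base h = v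

/-- The vertices of valence three. -/
noncomputable def trivalent (G : FinMultigraph) : Finset G.V :=
  Finset.univ.filter fun v => G.valence v = 3

/-- The vertex system of a graph with named edges. -/
noncomputable def system (G : FinMultigraph) (ν : G.H → E) : VertexSystem E :=
  G.trivalent.val.map fun v => (G.star v).val.map ν

/-- The vertex system `S` describes the graph `G` for some naming of the edges. -/
def Presents (G : FinMultigraph) (S : VertexSystem E) : Prop :=
  ∃ ν : G.H → E, G.IsNaming ν ∧ G.system ν = S

@[simp] theorem mem_star {G : FinMultigraph} {v : G.V} {h : G.H} :
    h ∈ G.star v ↔ G.base h = v := by simp [star]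

@[simp] theorem mem_trivalent {G : FinMultigraph} {v : G.V} :
    v ∈ G.trivalent ↔ G.valence v = 3 := by simp [trivalent]

theorem card_star (G : FinMultigraph) (v : G.V) : (G.star v).card = G.valence v := by
  classical
  rw [valence, Nat.card_eq_fintype_card, Fintype.card_subtype, star]

theorem opp_injective (G : FinMultigraph) : Function.Injective G.opp :=
  Function.LeftInverse.injective G.opp_opp

theorem IsNaming.opp {G : FinMultigraph} {ν : G.H → E} (hν : G.IsNaming ν) (h : G.H) :
    ν (G.opp h) = ν h := (hν h (G.opp h)).2 (.inr rfl)

theorem mem_join_system {G : FinMultigraph} {ν : G.H → E} {x : E} :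
    x ∈ (G.system ν).join ↔ ∃ h, G.valence (G.base h) = 3 ∧ ν h = x := by
  simp only [system, Multiset.mem_join, Multiset.mem_map, Finset.mem_val, mem_trivalent]
  constructor
  · rintro ⟨_, ⟨v, hv, rfl⟩, hx⟩
    obtain ⟨h, hh, rfl⟩ := Multiset.mem_map.1 hx
    rw [Finset.mem_val, mem_star] at hh
    exact ⟨h, hh ▸ hv, rfl⟩
  · rintro ⟨h, hv, rfl⟩
    exact ⟨_, ⟨_, hv, rfl⟩, Multiset.mem_map.2 ⟨h, by simp, rfl⟩⟩

theorem system_comp (G : FinMultigraph) (ν : G.H → E) (f : E → F) :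
    G.system (f ∘ ν) = (G.system ν).map (Multiset.map f) := by
  simp [system, Multiset.map_map]

/-- Two vertex systems of the same graph are renamings of each other. -/
theorem Presents.renaming [Nonempty F] {G : FinMultigraph} {S : VertexSystem E}
    {S' : VertexSystem F} (h : G.Presents S) (h' : G.Presents S') : Renaming S S' := by
  classical
  obtain ⟨ν, hν, rfl⟩ := h
  obtain ⟨ν', hν', rfl⟩ := h'
  have hf : ∀ h, (Function.extend ν ν' fun _ => Classical.arbitrary F) (ν h) = ν' h := by
    intro h
    have hex : ∃ a, ν a = ν h := ⟨h, rfl⟩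
    rw [Function.extend_def, dif_pos hex]
    exact (hν' h _).2 ((hν h _).1 (Classical.choose_spec hex))
  refine ⟨Function.extend ν ν' fun _ => Classical.arbitrary F, ?_, ?_⟩
  · intro x hx y hy hxy
    obtain ⟨h₁, -, rfl⟩ := mem_join_system.1 hx
    obtain ⟨h₂, -, rfl⟩ := mem_join_system.1 hy
    rw [hf, hf] at hxy
    exact (hν h₂ h₁).2 ((hν' h₂ h₁).1 hxy)
  · rw [← system_comp]
    congr 1
    funext h
    exact (hf h).symm

theorem Presents.map {G : FinMultigraph} {S : VertexSystem E} (h : G.Presents S)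
    {f : E → F} (hf : Set.InjOn f {x | x ∈ S.join})
    (hG : ∀ h, G.valence (G.base h) = 3 ∨ G.valence (G.base (G.opp h)) = 3) :
    G.Presents (S.map (Multiset.map f)) := by
  obtain ⟨ν, hν, rfl⟩ := h
  refine ⟨f ∘ ν, fun h h' => ?_, system_comp G ν f⟩
  have hmem : ∀ h, ν h ∈ (G.system ν).join := fun h => by
    rcases hG h with h1 | h1
    · exact mem_join_system.2 ⟨h, h1, rfl⟩
    · exact mem_join_system.2 ⟨_, h1, hν.opp h⟩
  rw [← hν h h']
  exact ⟨fun hh => hf (hmem h') (hmem h) hh, fun hh => congrArg f hh⟩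

/-! ### Whitehead moves on graphs and steps between vertex systems -/

theorem valence_exchange (G : FinMultigraph) (a b : G.H) (v : G.V) :
    (G.exchange a b).valence v = G.valence v := by
  classical
  refine Nat.card_congr ((Equiv.swap a b).subtypeEquiv fun h => ?_)
  simp only [exchange]

open Classical in
theorem system_exchange (G : FinMultigraph) (a b : G.H) (ν : G.H → E) :
    (G.exchange a b).system ν = G.system (ν ∘ Equiv.swap a b) := by
  have h1 : ((G.exchange a b).trivalent : Finset G.V) = G.trivalent :=
    Finset.ext fun v =>
      ⟨fun h => mem_trivalent.2 ((valence_exchange G a b v).symm.trans (mem_trivalent.1 h)),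
        fun h => mem_trivalent.2 ((valence_exchange G a b v).trans (mem_trivalent.1 h))⟩
  have h2 : ∀ v : G.V, ((G.exchange a b).star v : Finset G.H) =
      (G.star v).map (Equiv.swap a b).toEmbedding := fun v => by
    have h3 : ∀ h : G.H, G.base (Equiv.swap a b h) = v ↔
        h ∈ (G.star v).map (Equiv.swap a b).toEmbedding := fun h => by
      rw [Finset.mem_map_equiv, mem_star, Equiv.symm_swap]
    exact Finset.ext fun h => ⟨fun hh => (h3 h).1 (mem_star (G := G.exchange a b).1 hh),
      fun hh => mem_star (G := G.exchange a b).2 ((h3 h).2 hh)⟩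
  change Multiset.map (fun v : G.V => Multiset.map ν ((G.exchange a b).star v : Finset G.H).val)
    ((G.exchange a b).trivalent : Finset G.V).val = _
  rw [h1]
  refine Multiset.map_congr rfl fun v _ => ?_
  rw [h2 v, Finset.map_val, Multiset.map_map]
  rfl

theorem exists_map_eq_cons {α β : Type*} {f : α → β} {s : Multiset α} {b : β} {t : Multiset β}
    (h : s.map f = b ::ₘ t) : ∃ a s', s = a ::ₘ s' ∧ f a = b ∧ s'.map f = t := by
  obtain ⟨a, ha, rfl⟩ := Multiset.mem_map.1 (by rw [h]; exact Multiset.mem_cons_self b t)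
  obtain ⟨s', rfl⟩ := Multiset.exists_cons_of_mem ha
  rw [Multiset.map_cons, Multiset.cons_inj_right] at h
  exact ⟨a, s', rfl, rfl, h⟩

theorem exists_map_eq_tri {α β : Type} {f : α → β} {s : Multiset α} {x y z : β}
    (h : s.map f = tri x y z) : ∃ a b c, s = tri a b c ∧ f a = x ∧ f b = y ∧ f c = z := by
  rw [tri, Multiset.insert_eq_cons, Multiset.insert_eq_cons] at h
  obtain ⟨a, s, rfl, ha, h⟩ := exists_map_eq_cons h
  obtain ⟨b, s, rfl, hb, h⟩ := exists_map_eq_cons h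
  obtain ⟨c, rfl, hc⟩ := Multiset.map_eq_singleton.1 h
  exact ⟨a, b, c, rfl, ha, hb, hc⟩

/-- The effect on the vertex system of exchanging a half-edge `a` at the vertex `v` with a
half-edge `b` at the vertex `w`. -/
theorem system_exchange_eq (G : FinMultigraph) (ν : G.H → E) {v w : G.V} {T : Multiset G.V}
    (hT : G.trivalent.val = v ::ₘ w ::ₘ T) {h a a' k b b' : G.H}
    (hv : (G.star v).val = tri h a a') (hw : (G.star w).val = tri k b b') :
    G.system ν = tri (ν h) (ν a) (ν a') ::ₘ tri (ν k) (ν b) (ν b') ::ₘ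
        T.map (fun u => (G.star u).val.map ν) ∧
      (G.exchange a b).system ν = tri (ν h) (ν b) (ν a') ::ₘ tri (ν k) (ν a) (ν b') ::ₘ
        T.map (fun u => (G.star u).val.map ν) := by
  classical
  have hnd := G.trivalent.nodup
  rw [hT, Multiset.nodup_cons, Multiset.nodup_cons] at hnd
  have hvw : v ≠ w := fun h => hnd.1 (by simp [h])
  have hvnd := (G.star v).nodup
  have hwnd := (G.star w).nodup
  rw [hv] at hvnd
  rw [hw] at hwnd
  simp only [tri, Multiset.insert_eq_cons, Multiset.nodup_cons, Multiset.mem_cons,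
    Multiset.mem_singleton, not_or] at hvnd hwnd
  have hbv : ∀ x, G.base x = v ↔ x = h ∨ x = a ∨ x = a' := fun x => by
    rw [← mem_star, ← Finset.mem_val, hv, mem_tri]
  have hbw : ∀ x, G.base x = w ↔ x = k ∨ x = b ∨ x = b' := fun x => by
    rw [← mem_star, ← Finset.mem_val, hw, mem_tri]
  have hne : ∀ {x y}, G.base x = v → G.base y = w → x ≠ y := fun hx hy hxy =>
    hvw (by rw [← hx, ← hy, hxy])
  have ha : G.base a = v := (hbv a).2 (by simp)
  have hb : G.base b = w := (hbw b).2 (by simp)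
  constructor
  · simp [system, hT, hv, hw, tri]
  · rw [system_exchange, system, hT, Multiset.map_cons, Multiset.map_cons, hv, hw]
    have e1 : Equiv.swap a b h = h := Equiv.swap_apply_of_ne_of_ne hvnd.1.1
      (hne ((hbv h).2 (by simp)) hb)
    have e2 : Equiv.swap a b a' = a' := Equiv.swap_apply_of_ne_of_ne (Ne.symm hvnd.2.1)
      (hne ((hbv a').2 (by simp)) hb)
    have e3 : Equiv.swap a b k = k := Equiv.swap_apply_of_ne_of_ne
      (hne ha ((hbw k).2 (by simp))).symm hwnd.1.1
    have e4 : Equiv.swap a b b' = b' := Equiv.swap_apply_of_ne_of_ne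
      (hne ha ((hbw b').2 (by simp))).symm (Ne.symm hwnd.2.1)
    have e5 : T.map (fun u => (G.star u).val.map (ν ∘ Equiv.swap a b)) =
        T.map (fun u => (G.star u).val.map ν) := by
      refine Multiset.map_congr rfl fun u hu => Multiset.map_congr rfl fun x hx => ?_
      rw [Finset.mem_val, mem_star] at hx
      have huv : u ≠ v := fun h => hnd.1 (by simp [← h, hu])
      have huw : u ≠ w := fun h => hnd.2.1 (by simp [← h, hu])
      rw [Function.comp_apply, Equiv.swap_apply_of_ne_of_ne]
      · rintro rfl; exact huv (hx.symm.trans ha)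
      · rintro rfl; exact huw (hx.symm.trans hb)
    rw [e5]
    simp [tri, e1, e2, e3, e4]

/-- A Whitehead move on a graph is a step of its vertex system. -/
theorem exists_step_of_exchange {G : FinMultigraph} {ν : G.H → E} (hν : G.IsNaming ν)
    {h a b : G.H} (hne : G.base h ≠ G.base (G.opp h)) (h3 : G.valence (G.base h) = 3)
    (h3' : G.valence (G.base (G.opp h)) = 3) (ha : G.base a = G.base h) (hah : a ≠ h)
    (hb : G.base b = G.base (G.opp h)) (hbh : b ≠ G.opp h) :
    Step (G.system ν) ((G.exchange a b).system ν) := by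
  have key : ∀ (v : G.V) (x y : G.H), G.valence v = 3 → G.base x = v → G.base y = v → y ≠ x →
      ∃ z, (G.star v).val = tri x y z := by
    intro v x y hv hx hy hxy
    obtain ⟨s, hs⟩ := Multiset.exists_cons_of_mem (show x ∈ (G.star v).val from mem_star.2 hx)
    have hys : y ∈ s := by
      have : y ∈ (G.star v).val := mem_star.2 hy
      rw [hs, Multiset.mem_cons] at this
      exact this.resolve_left hxy
    obtain ⟨s', rfl⟩ := Multiset.exists_cons_of_mem hys
    have hc := congrArg Multiset.card hs
    rw [Finset.card_val, card_star, hv, Multiset.card_cons, Multiset.card_cons] at hc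
    obtain ⟨z, rfl⟩ := Multiset.card_eq_one.1 (by omega : s'.card = 1)
    exact ⟨z, hs⟩
  obtain ⟨a', hv⟩ := key _ h a h3 rfl ha hah
  obtain ⟨b', hw⟩ := key _ (G.opp h) b h3' rfl hb hbh
  obtain ⟨T, hT⟩ := Multiset.exists_cons_of_mem
    (show G.base h ∈ G.trivalent.val from mem_trivalent.2 h3)
  have hwT : G.base (G.opp h) ∈ T := by
    have : G.base (G.opp h) ∈ G.trivalent.val := mem_trivalent.2 h3'
    rw [hT, Multiset.mem_cons] at this
    exact this.resolve_left hne.symm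
  obtain ⟨T, rfl⟩ := Multiset.exists_cons_of_mem hwT
  obtain ⟨h1, h2⟩ := system_exchange_eq G ν hT hv hw
  rw [h1, h2, hν.opp]
  refine ⟨ν h, ν a', ν a, ν b, ν b', T.map fun u => (G.star u).val.map ν, ?_, ?_⟩
  · rw [tri_swap_right _ (ν a)]
  · rw [tri_swap_right _ (ν b)]

/-- A step of the vertex system of a graph comes from a Whitehead move on the graph. -/
theorem exists_exchange_of_step {G : FinMultigraph} {S S' : VertexSystem E} (hG : G.Presents S)
    (hS : Step S S') : ∃ a b : G.H, (G.exchange a b).Presents S' ∧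
      G.valence (G.base a) = 3 ∧ G.valence (G.base b) = 3 ∧
      G.WhiteheadMove (G.exchange a b) := by
  obtain ⟨ν, hν, rfl⟩ := hG
  obtain ⟨e, x, y, z, w, M, h1, rfl⟩ := hS
  obtain ⟨v₁, T, hT, hv₁, h1⟩ := exists_map_eq_cons h1
  obtain ⟨v₂, T, rfl, hv₂, rfl⟩ := exists_map_eq_cons h1
  obtain ⟨h, a', a, hs₁, rfl, rfl, rfl⟩ := exists_map_eq_tri hv₁
  obtain ⟨k, b, b', hs₂, hk, rfl, rfl⟩ := exists_map_eq_tri hv₂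
  have hnd := G.trivalent.nodup
  rw [hT, Multiset.nodup_cons, Multiset.nodup_cons] at hnd
  have hne : v₁ ≠ v₂ := fun h => hnd.1 (by simp [h])
  have hb₁ : ∀ x, G.base x = v₁ ↔ x = h ∨ x = a' ∨ x = a := fun x => by
    rw [← mem_star, ← Finset.mem_val, hs₁, mem_tri]
  have hb₂ : ∀ x, G.base x = v₂ ↔ x = k ∨ x = b ∨ x = b' := fun x => by
    rw [← mem_star, ← Finset.mem_val, hs₂, mem_tri]
  have hh : G.base h = v₁ := (hb₁ h).2 (by simp)
  have hk₂ : G.base k = v₂ := (hb₂ k).2 (by simp)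
  have hkh : k = G.opp h := by
    refine ((hν h k).1 hk).resolve_left fun hkh => hne ?_
    rw [← hh, ← hk₂, hkh]
  have hs₁' := hs₁
  rw [tri_swap_right] at hs₁'
  have hval : ∀ v, v ∈ G.trivalent.val → G.valence v = 3 := fun v hv => mem_trivalent.1 hv
  have hnd₁ := (G.star v₁).nodup
  have hnd₂ := (G.star v₂).nodup
  rw [hs₁] at hnd₁
  rw [hs₂] at hnd₂
  simp only [tri, Multiset.insert_eq_cons, Multiset.nodup_cons, Multiset.mem_cons,
    Multiset.mem_singleton, not_or] at hnd₁ hnd₂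
  have ha₁ : G.base a = v₁ := (hb₁ a).2 (by simp)
  have hb₂' : G.base b = v₂ := (hb₂ b).2 (by simp)
  refine ⟨a, b, ⟨ν, hν, ?_⟩, ?_, ?_, h, a, b, ?_, ?_, ?_, ?_, ?_, ?_, ?_, ⟨Iso.refl _⟩⟩
  · rw [(system_exchange_eq G ν hT hs₁' hs₂).2, hk, tri_swap_right _ (ν b)]
  · rw [ha₁]; exact hval _ (by simp [hT])
  · rw [hb₂']; exact hval _ (by simp [hT])
  · rw [← hkh, hh, hk₂]; exact hne
  · rw [hh]; exact hval _ (by simp [hT])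
  · rw [← hkh, hk₂]; exact hval _ (by simp [hT])
  · rw [hh]; exact ha₁
  · exact fun h => hnd₁.1.2 h.symm
  · rw [← hkh, hk₂]; exact hb₂'
  · rw [← hkh]; exact fun h => hnd₂.1.1 h.symm

end FinMultigraph

namespace FinMultigraph

open VertexSystem

variable {E F : Type}

/-! ### Connectedness, and the conditions on a marked graph -/

/-- In a connected graph, a set of names that contains all or none of the names at each vertex
contains all or none of the names. -/
theorem IsConnected.names {G : FinMultigraph} (hG : G.IsConnected) {ν : G.H → E}
    (hν : G.IsNaming ν) (N : Set E)
    (hN : ∀ v, (∀ h, G.base h = v → ν h ∈ N) ∨ ∀ h, G.base h = v → ν h ∉ N) :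
    (∀ h, ν h ∈ N) ∨ ∀ h, ν h ∉ N := by
  have edge : ∀ h, (∀ k, G.base k = G.base h → ν k ∈ N) →
      ∀ k, G.base k = G.base (G.opp h) → ν k ∈ N := fun h hh =>
    (hN _).resolve_right fun hcon => hcon (G.opp h) rfl (by rw [hν.opp]; exact hh h rfl)
  have adj : ∀ u v, G.adjacency.Adj u v → (∀ h, G.base h = u → ν h ∈ N) →
      ∀ h, G.base h = v → ν h ∈ N := by
    intro u v huv
    rw [adjacency, SimpleGraph.fromRel_adj] at huv
    obtain ⟨-, ⟨h, rfl, rfl⟩ | ⟨h, rfl, rfl⟩⟩ := huv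
    · exact edge h
    · have := edge (G.opp h)
      rwa [G.opp_opp] at this
  have reach : ∀ u v, G.adjacency.Reachable u v → (∀ h, G.base h = u → ν h ∈ N) →
      ∀ h, G.base h = v → ν h ∈ N := by
    rintro u v ⟨w⟩
    induction w with
    | nil => exact id
    | cons hadj _ ih => exact fun hu => ih (adj _ _ hadj hu)
  by_contra! hcon
  obtain ⟨⟨h₁, h1⟩, h₂, h2⟩ := hcon
  have h3 := (hN (G.base h₂)).resolve_right fun h => h h₂ rfl h2
  exact h1 (reach _ _ (hG.preconnected _ _) h3 h₁ rfl)

theorem forall_mem_star_map {G : FinMultigraph} {ν : G.H → E} {v : G.V} {P : E → Prop} :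
    (∀ x ∈ (G.star v).val.map ν, P x) ↔ ∀ h, G.base h = v → P (ν h) := by
  simp [Multiset.mem_map]

theorem conn_iff {G : FinMultigraph} {ν : G.H → E} : (G.system ν).Conn ↔ ∀ N : Set E,
    (∀ v, G.valence v = 3 → (∀ h, G.base h = v → ν h ∈ N) ∨ ∀ h, G.base h = v → ν h ∉ N) →
    (∀ h, G.valence (G.base h) = 3 → ν h ∈ N) ∨ ∀ h, G.valence (G.base h) = 3 → ν h ∉ N := by
  have key : ∀ P : Multiset E → Prop, (∀ v ∈ G.system ν, P v) ↔
      ∀ v, G.valence v = 3 → P ((G.star v).val.map ν) := by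
    intro P
    simp only [system, Multiset.mem_map, Finset.mem_val, mem_trivalent]
    exact ⟨fun h v hv => h _ ⟨v, hv, rfl⟩, by rintro h _ ⟨v, hv, rfl⟩; exact h v hv⟩
  simp only [Conn, key, forall_mem_star_map]
  constructor
  · intro h N hN
    exact (h N hN).imp (fun h k hk => h _ hk k rfl) fun h k hk => h _ hk k rfl
  · intro h N hN
    refine (h N hN).imp ?_ ?_ <;>
    · rintro h v hv k rfl
      exact h k hv

/-- If the vertex system is connected and every edge has an end of valence three, then the graph
is connected. -/
theorem isConnected_of_conn {G : FinMultigraph} {ν : G.H → E} (hν : G.IsNaming ν)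
    (hc : (G.system ν).Conn) (hval : ∀ v, G.valence v ≠ 0)
    (hG : ∀ h, G.valence (G.base h) = 3 ∨ G.valence (G.base (G.opp h)) = 3) [Nonempty G.V] :
    G.IsConnected := by
  have hhalf : ∀ v, ∃ h, G.base h = v := by
    intro v
    obtain ⟨h, hh⟩ := Finset.card_pos.1 (by rw [card_star]; exact Nat.pos_of_ne_zero (hval v) :
      0 < (G.star v).card)
    exact ⟨h, mem_star.1 hh⟩
  have hedge : ∀ h, G.adjacency.Reachable (G.base h) (G.base (G.opp h)) := by
    intro h
    by_cases hne : G.base h = G.base (G.opp h)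
    · rw [← hne]
    · refine SimpleGraph.Adj.reachable ?_
      rw [adjacency, SimpleGraph.fromRel_adj]
      exact ⟨hne, .inl ⟨h, rfl, rfl⟩⟩
  rw [IsConnected, SimpleGraph.connected_iff_exists_forall_reachable]
  obtain ⟨v₀⟩ := ‹Nonempty G.V›
  refine ⟨v₀, ?_⟩
  -- the names of the edges met by the component of `v₀`
  have key := conn_iff.1 hc {x | ∃ h, G.adjacency.Reachable v₀ (G.base h) ∧ ν h = x} (by
    intro v _
    by_cases hv : G.adjacency.Reachable v₀ v
    · exact .inl fun h hh => ⟨h, by rwa [hh], rfl⟩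
    · refine .inr ?_
      rintro h rfl ⟨k, hk, hkh⟩
      rcases (hν h k).1 hkh with rfl | rfl
      · exact hv hk
      · exact hv (hk.trans (hedge h).symm))
  have hall : ∀ h, G.adjacency.Reachable v₀ (G.base h) := by
    have h3 : ∀ h, G.valence (G.base h) = 3 → G.adjacency.Reachable v₀ (G.base h) := by
      rcases key with key | key
      · intro h hh
        obtain ⟨k, hk, hkh⟩ := key h hh
        rcases (hν h k).1 hkh with rfl | rfl
        · exact hk
        · exact hk.trans (hedge h).symm
      · exfalso
        obtain ⟨h, hh⟩ := hhalf v₀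
        have hr : G.adjacency.Reachable v₀ (G.base h) := by rw [hh]
        rcases hG h with h3 | h3
        · exact key h h3 ⟨h, hr, rfl⟩
        · exact key _ h3 ⟨_, hr.trans (hedge h), rfl⟩
    intro h
    rcases hG h with hh | hh
    · exact h3 h hh
    · exact (h3 _ hh).trans (hedge h).symm
  intro v
  obtain ⟨h, rfl⟩ := hhalf v
  exact hall h

theorem mem_star_of_valence_one {G : FinMultigraph} {h k : G.H} (hh : G.valence (G.base h) = 1)
    (hk : G.base k = G.base h) : k = h := by
  rw [← card_star, Finset.card_eq_one] at hh
  obtain ⟨a, ha⟩ := hh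
  have h1 := mem_star.2 hk
  have h2 : h ∈ G.star (G.base h) := mem_star.2 rfl
  rw [ha, Finset.mem_singleton] at h1 h2
  rw [h1, h2]

open Classical in
/-- The number of times that a name occurs in the vertex system of a graph is the number of ends
of valence three of the edge. -/
theorem count_join_system (G : FinMultigraph) (ν : G.H → E) (x : E) :
    (G.system ν).join.count x =
      (Finset.univ.filter fun h => G.valence (G.base h) = 3 ∧ ν h = x).card := by
  have h1 : (G.system ν).join.count x = ∑ v ∈ G.trivalent, ((G.star v).filter (ν · = x)).card := by
    rw [system, Multiset.join, Multiset.count_sum]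
    refine Finset.sum_congr rfl fun v _ => ?_
    rw [Multiset.count_map]
    simp only [eq_comm (a := x)]
    rfl
  rw [h1, Finset.card_eq_sum_card_fiberwise (f := G.base) (t := G.trivalent)]
  · refine Finset.sum_congr rfl fun v hv => congrArg _ ?_
    rw [mem_trivalent] at hv
    ext h
    simp only [Finset.mem_filter, mem_star, Finset.mem_univ, true_and]
    constructor
    · rintro ⟨rfl, h2⟩; exact ⟨⟨hv, h2⟩, rfl⟩
    · rintro ⟨⟨-, h2⟩, rfl⟩; exact ⟨rfl, h2⟩
  · intro h hh
    simp only [Finset.coe_filter, Finset.mem_univ, true_and, Set.mem_ofPred_eq] at hh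
    exact mem_trivalent.2 hh.1

theorem card_system (G : FinMultigraph) (ν : G.H → E) :
    (G.system ν).card = Nat.card {v // G.valence v = 3} := by
  classical
  rw [system, Multiset.card_map, Finset.card_val, trivalent, Nat.card_eq_fintype_card,
    Fintype.card_subtype]

/-- The edges themselves can serve as names. -/
theorem isNaming_edge (G : FinMultigraph) : G.IsNaming fun h => s(h, G.opp h) := by
  intro k k'
  simp only [Sym2.eq_iff]
  constructor
  · rintro (⟨h, -⟩ | ⟨h, -⟩)
    · exact .inl h
    · exact .inr h
  · rintro (rfl | rfl)
    · exact .inl ⟨rfl, rfl⟩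
    · exact .inr ⟨rfl, G.opp_opp _⟩

end FinMultigraph

namespace MarkedGraph

open VertexSystem FinMultigraph

variable {E F : Type} {g p : ℕ}

theorem card_trivalent (G : MarkedGraph g p) :
    Nat.card {v // G.valence v = 3} + 2 = 2 * g + p := by
  have := G.card_three
  omega

/-- An edge joining two vertices of valence one would be a connected component. -/
theorem valence_or (G : MarkedGraph g p) (hgp : 2 < 2 * g + p) (h : G.H) :
    G.valence (G.base h) = 3 ∨ G.valence (G.base (G.opp h)) = 3 := by
  by_contra! hcon
  have h1 := (G.valence_eq (G.base h)).resolve_right hcon.1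
  have h2 := (G.valence_eq (G.base (G.opp h))).resolve_right hcon.2
  have hν := G.isNaming_edge
  have key := IsConnected.names G.connected hν {s(h, G.opp h)} (by
    intro v
    by_cases hv : v = G.base h
    · subst hv
      exact .inl fun k hk => by rw [mem_star_of_valence_one h1 hk]; rfl
    by_cases hv' : v = G.base (G.opp h)
    · subst hv'
      refine .inl fun k hk => ?_
      rw [mem_star_of_valence_one h2 hk]
      exact hν.opp h
    · refine .inr fun k hk hkh => ?_
      rcases (hν h k).1 hkh with rfl | rfl
      · exact hv hk.symm
      · exact hv' hk.symm)
  have hcard := G.card_trivalent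
  obtain ⟨v, hv⟩ : Nonempty {v // G.valence v = 3} := by
    by_contra hemp
    rw [not_nonempty_iff] at hemp
    rw [Nat.card_of_isEmpty] at hcard
    omega
  obtain ⟨k, hk⟩ := Finset.card_pos.1 (by rw [card_star, hv]; omega : 0 < (G.star v).card)
  rw [mem_star] at hk
  rcases key with key | key
  · rcases (hν h k).1 (key k) with rfl | rfl
    · rw [hk] at h1; omega
    · rw [hk] at h2; omega
  · exact key h rfl

/-- The edges to the vertices of valence one are plain in the vertex system; the count of
vertices of valence three is part of the definition of a marked graph. -/
theorem isMarked_system (G : MarkedGraph g p) (hgp : 2 < 2 * g + p) {ν : G.H → E}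
    (hν : G.IsNaming ν) : (G.system ν).IsMarked g p := by
  classical
  have hor := G.valence_or hgp
  refine ⟨conn_iff.2 fun N hN => ?_, ?_, ?_, ?_, ?_⟩
  · refine (IsConnected.names G.connected hν N fun v => ?_).imp (fun h k _ => h k)
      fun h k _ => h k
    rcases G.valence_eq v with hv | hv
    · by_cases hk : ∃ k, G.base k = v ∧ ν k ∈ N
      · obtain ⟨k, rfl, hk⟩ := hk
        exact .inl fun k' hk' => by rwa [mem_star_of_valence_one hv hk']
      · exact .inr fun k hkv hkN => hk ⟨k, hkv, hkN⟩
    · exact hN v hv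
  · intro v hv
    obtain ⟨w, hw, rfl⟩ := Multiset.mem_map.1 hv
    rw [Multiset.card_map, Finset.card_val, card_star]
    exact mem_trivalent.1 hw
  · intro x
    rw [count_join_system]
    rcases Finset.eq_empty_or_nonempty
      (Finset.univ.filter fun h => G.valence (G.base h) = 3 ∧ ν h = x) with he | ⟨h, hh⟩
    · rw [he]; simp
    · rw [Finset.mem_filter] at hh
      obtain ⟨-, -, rfl⟩ := hh
      refine (Finset.card_le_card (t := {h, G.opp h}) fun k hk => ?_).trans Finset.card_le_two
      rw [Finset.mem_filter] at hk
      simpa using (hν h k).1 hk.2.2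
  · rw [card_system]
    exact G.card_trivalent
  · -- plain names correspond to the vertices of valence one
    have hset : {x | (G.system ν).join.count x = 1} = ν '' {h | G.valence (G.base h) = 1} := by
      ext x
      simp only [Set.mem_ofPred_eq, Set.mem_image]
      rw [count_join_system]
      constructor
      · intro hx
        obtain ⟨h, hh⟩ := Finset.card_eq_one.1 hx
        have hmem : ∀ k, (G.valence (G.base k) = 3 ∧ ν k = x) ↔ k = h := by
          intro k
          have := Finset.ext_iff.1 hh k
          simpa using this
        have h1 := (hmem h).2 rfl
        refine ⟨G.opp h, (G.valence_eq _).resolve_right fun h3 => ?_, (hν.opp h).trans h1.2⟩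
        exact G.opp_ne h ((hmem _).1 ⟨h3, (hν.opp h).trans h1.2⟩)
      · rintro ⟨h, hh, rfl⟩
        rw [Finset.card_eq_one]
        refine ⟨G.opp h, Finset.ext fun k => ?_⟩
        have h3 := (hor h).resolve_left (by omega)
        simp only [Finset.mem_filter, Finset.mem_univ, true_and, Finset.mem_singleton]
        constructor
        · rintro ⟨hk3, hk⟩
          refine ((hν h k).1 hk).resolve_left ?_
          rintro rfl
          omega
        · rintro rfl
          exact ⟨h3, hν.opp h⟩
    have hinj : Set.InjOn ν {h | G.valence (G.base h) = 1} := by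
      intro h hh k hk hkh
      rw [Set.mem_ofPred_eq] at hh hk
      rcases (hν k h).1 hkh with rfl | rfl
      · rfl
      · rcases hor k with h3 | h3 <;> omega
    rw [hset, hinj.ncard_image, ← Nat.card_coe_set_eq]
    refine Eq.trans ?_ G.card_one
    refine Nat.card_congr (Equiv.ofBijective
      (fun h => ⟨G.base h.1, h.2⟩) ⟨fun h k hhk => ?_, fun v => ?_⟩)
    · exact Subtype.ext (mem_star_of_valence_one k.2 (Subtype.ext_iff.1 hhk))
    · obtain ⟨h, hh⟩ := Finset.card_pos.1
        (by rw [card_star, v.2]; omega : 0 < (G.star v.1).card)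
      rw [mem_star] at hh
      exact ⟨⟨h, by rw [Set.mem_ofPred_eq, hh]; exact v.2⟩, Subtype.ext hh⟩

end MarkedGraph

namespace FinMultigraph

open VertexSystem

variable {E F : Type}

/-! ### Isomorphisms and renamings -/

theorem Iso.valence_eq {G G' : FinMultigraph} (f : Iso G G') (v : G.V) :
    G'.valence (f.onV v) = G.valence v :=
  (Nat.card_congr (f.onH.subtypeEquiv fun h => by
    rw [f.base_onH, f.onV.apply_eq_iff_eq])).symm

theorem Iso.presents {G G' : FinMultigraph} (f : Iso G G') {S : VertexSystem E}
    (h : G.Presents S) : G'.Presents S := by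
  obtain ⟨ν, hν, rfl⟩ := h
  refine ⟨ν ∘ f.onH.symm, fun h h' => ?_, ?_⟩
  · rw [Function.comp_apply, Function.comp_apply, hν]
    rw [f.onH.symm.apply_eq_iff_eq, Equiv.symm_apply_eq, ← f.opp_onH, Equiv.apply_symm_apply]
  · have h1 : G'.trivalent = G.trivalent.map f.onV.toEmbedding := by
      ext v
      rw [Finset.mem_map_equiv, mem_trivalent, mem_trivalent, ← f.valence_eq,
        Equiv.apply_symm_apply]
    have h2 : ∀ v, G'.star (f.onV v) = (G.star v).map f.onH.toEmbedding := by
      intro v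
      ext h
      rw [Finset.mem_map_equiv, mem_star, mem_star, ← f.onV.apply_eq_iff_eq, ← f.base_onH,
        Equiv.apply_symm_apply]
    rw [system, h1, Finset.map_val, Multiset.map_map, system]
    refine Multiset.map_congr rfl fun v _ => ?_
    rw [Function.comp_apply, Equiv.coe_toEmbedding, h2, Finset.map_val, Multiset.map_map]
    refine Multiset.map_congr rfl fun h _ => ?_
    simp

/-- An isomorphism of graphs without isolated vertices is determined by half-edges. -/
theorem nonempty_iso_of_equiv {G G' : FinMultigraph} (e : G.H ≃ G'.H)
    (hopp : ∀ h, G'.opp (e h) = e (G.opp h))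
    (hbase : ∀ h k, G'.base (e h) = G'.base (e k) ↔ G.base h = G.base k)
    (hG : Function.Surjective G.base) (hG' : Function.Surjective G'.base) :
    Nonempty (Iso G G') := by
  choose s hs using hG
  have hspec : ∀ h, G'.base (e (s (G.base h))) = G'.base (e h) := fun h =>
    (hbase _ _).2 (hs _)
  refine ⟨⟨Equiv.ofBijective (fun v => G'.base (e (s v))) ⟨fun v w hvw => ?_, fun v => ?_⟩, e,
    fun h => (hspec h).symm, hopp⟩⟩
  · have := (hbase _ _).1 hvw
    rwa [hs, hs] at this
  · obtain ⟨h, rfl⟩ := hG' v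
    obtain ⟨k, rfl⟩ := e.surjective h
    exact ⟨G.base k, hspec k⟩

/-- Two families with the same multiset of values correspond to each other under a bijection of
their index sets. -/
theorem exists_equiv_of_map_val_eq {α β γ : Type} {s : Finset α} {t : Finset β} {f : α → γ}
    {f' : β → γ} (h : s.val.map f = t.val.map f') : ∃ e : s ≃ t, ∀ x, f' (e x) = f x := by
  classical
  have key : ∀ c, Nonempty ({x : s // f x = c} ≃ {x : t // f' x = c}) := by
    intro c
    rw [← Fintype.card_eq]
    have h1 : ∀ {α : Type} (s : Finset α) (f : α → γ),
        Fintype.card {x : s // f x = c} = (s.val.map f).count c := by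
      intro α s f
      rw [Multiset.count_map, Fintype.card_subtype,
        ← Finset.card_map (Function.Embedding.subtype _),
        ← Finset.card_val]
      congr 1
      have : (Finset.univ.filter fun x : s => f x = c).map (Function.Embedding.subtype _) =
          s.filter fun a => c = f a := by
        ext a
        simp only [Finset.mem_map, Finset.mem_filter, Finset.mem_univ, true_and,
          Function.Embedding.subtype_apply, eq_comm (a := c)]
        constructor
        · rintro ⟨⟨x, hx⟩, rfl, rfl⟩; exact ⟨hx, rfl⟩
        · rintro ⟨hx, rfl⟩; exact ⟨⟨a, hx⟩, rfl, rfl⟩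
      rw [this]; rfl
    rw [h1, h1, h]
  exact ⟨Equiv.ofFiberEquiv (f := fun x : s => f x) (g := fun x : t => f' x)
    fun c => (key c).some, fun x => Equiv.ofFiberEquiv_map (f := fun x : s => f x)
      (g := fun x : t => f' x) (fun c => (key c).some) x⟩

/-- Graphs with vertices of valence one and three, in which every edge has an end of valence
three, are isomorphic if they have the same vertex system. -/
theorem nonempty_iso_of_presents {G G' : FinMultigraph} {S : VertexSystem E}
    (hG : G.Presents S) (hG' : G'.Presents S)
    (hv : ∀ v, G.valence v = 1 ∨ G.valence v = 3) (hv' : ∀ v, G'.valence v = 1 ∨ G'.valence v = 3)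
    (ho : ∀ h, G.valence (G.base h) = 3 ∨ G.valence (G.base (G.opp h)) = 3)
    (ho' : ∀ h, G'.valence (G'.base h) = 3 ∨ G'.valence (G'.base (G'.opp h)) = 3) :
    Nonempty (Iso G G') := by
  classical
  obtain ⟨ν, hν, hS⟩ := hG
  obtain ⟨ν', hν', hS'⟩ := hG'
  -- a bijection of the trivalent vertices, and bijections of the half-edges at them
  obtain ⟨ψ, hψ⟩ := exists_equiv_of_map_val_eq (hS.trans hS'.symm)
  have hloc : ∀ v : G.trivalent, ∃ e : G.star v ≃ G'.star (ψ v), ∀ x, ν' (e x) = ν x :=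
    fun v => exists_equiv_of_map_val_eq (hψ v).symm
  choose e he using hloc
  have htri : ∀ h : {h // G.valence (G.base h) = 3}, G.base h.1 ∈ G.trivalent :=
    fun h => mem_trivalent.2 h.2
  let φ : {h // G.valence (G.base h) = 3} → G'.H := fun h =>
    (e ⟨G.base h.1, htri h⟩ ⟨h.1, mem_star.2 rfl⟩).1
  have hφν : ∀ h, ν' (φ h) = ν h.1 := fun h => he _ _
  have hφbase : ∀ h, G'.base (φ h) = (ψ ⟨G.base h.1, htri h⟩).1 := fun h =>
    mem_star.1 (e ⟨G.base h.1, htri h⟩ ⟨h.1, mem_star.2 rfl⟩).2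
  have hφ3 : ∀ h, G'.valence (G'.base (φ h)) = 3 := fun h => by
    rw [hφbase]; exact mem_trivalent.1 (ψ ⟨G.base h.1, htri h⟩).2
  have hφbase' : ∀ h k, G'.base (φ h) = G'.base (φ k) ↔ G.base h.1 = G.base k.1 := by
    intro h k
    rw [hφbase, hφbase, ← Subtype.ext_iff, ψ.apply_eq_iff_eq, Subtype.mk.injEq]
  have hφinj : Function.Injective φ := by
    rintro ⟨h, hh⟩ ⟨k, hk⟩ hhk
    have h1 : G.base h = G.base k := (hφbase' ⟨h, hh⟩ ⟨k, hk⟩).1 (by rw [hhk])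
    have key : ∀ (v w : G.trivalent) (hvw : v = w) (x : G.star v) (y : G.star w),
        (e v x).1 = (e w y).1 → x.1 = y.1 := by
      rintro v _ rfl x y hxy
      exact congrArg Subtype.val ((e v).injective (Subtype.ext hxy))
    exact Subtype.ext (key _ _ (Subtype.ext h1) ⟨h, mem_star.2 rfl⟩ ⟨k, mem_star.2 rfl⟩ hhk)
  have hφsurj : ∀ k, G'.valence (G'.base k) = 3 → ∃ h, φ h = k := by
    intro k hk
    obtain ⟨⟨v, hv3⟩, hvk⟩ := ψ.surjective ⟨G'.base k, mem_trivalent.2 hk⟩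
    have hk' : k ∈ G'.star (ψ ⟨v, hv3⟩) := by rw [hvk]; exact mem_star.2 rfl
    obtain ⟨⟨h, hh⟩, hhk⟩ := (e ⟨v, hv3⟩).surjective ⟨k, hk'⟩
    obtain rfl := mem_star.1 hh
    exact ⟨⟨h, mem_trivalent.1 hv3⟩, congrArg Subtype.val hhk⟩
  -- the two half-edges of an edge are both trivalent in `G` if and only if they are so in `G'`
  have hopp3 : ∀ h (h3 : G.valence (G.base (G.opp h.1)) = 3), φ ⟨G.opp h.1, h3⟩ = G'.opp (φ h) := by
    intro h h3
    refine ((hν' (φ h) _).1 ?_).resolve_left fun hcon => ?_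
    · rw [hφν, hφν]; exact hν.opp _
    · exact G.opp_ne h.1 (congrArg Subtype.val (hφinj hcon))
  have hopp3' : ∀ h, G'.valence (G'.base (G'.opp (φ h))) = 3 →
      G.valence (G.base (G.opp h.1)) = 3 := by
    intro h h3
    obtain ⟨k, hk⟩ := hφsurj _ h3
    have h1 : ν k.1 = ν h.1 := by rw [← hφν, ← hφν, hk, hν'.opp]
    rcases (hν h.1 k.1).1 h1 with h2 | h2
    · rw [Subtype.ext h2] at hk
      exact absurd hk.symm (G'.opp_ne _)
    · rw [← h2]; exact k.2
  have hor : ∀ h, G.valence (G.base h) ≠ 3 → G.valence (G.base (G.opp h)) = 3 := fun h hh =>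
    (ho h).resolve_left hh
  let Φ : G.H → G'.H := fun h => if hh : G.valence (G.base h) = 3 then φ ⟨h, hh⟩ else
    G'.opp (φ ⟨G.opp h, hor h hh⟩)
  have hΦ3 : ∀ h (hh : G.valence (G.base h) = 3), Φ h = φ ⟨h, hh⟩ := fun h hh => dif_pos hh
  have hΦ1 : ∀ h (hh : G.valence (G.base h) ≠ 3), Φ h = G'.opp (φ ⟨G.opp h, hor h hh⟩) :=
    fun h hh => dif_neg hh
  have hΦval : ∀ h, G'.valence (G'.base (Φ h)) = 3 ↔ G.valence (G.base h) = 3 := by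
    intro h
    by_cases hh : G.valence (G.base h) = 3
    · rw [hΦ3 h hh]; exact ⟨fun _ => hh, fun _ => hφ3 _⟩
    · rw [hΦ1 h hh]
      refine ⟨fun h3 => ?_, fun h3 => absurd h3 hh⟩
      have := hopp3' _ h3
      rwa [G.opp_opp] at this
  have hΦν : ∀ h, ν' (Φ h) = ν h := by
    intro h
    by_cases hh : G.valence (G.base h) = 3
    · rw [hΦ3 h hh, hφν]
    · rw [hΦ1 h hh, hν'.opp, hφν, hν.opp]
  have hΦinj : Function.Injective Φ := by
    intro h k hhk
    by_cases hh : G.valence (G.base h) = 3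
    · have hk : G.valence (G.base k) = 3 := by rwa [← hΦval, ← hhk, hΦval]
      rw [hΦ3 h hh, hΦ3 k hk] at hhk
      exact congrArg Subtype.val (hφinj hhk)
    · have hk : G.valence (G.base k) ≠ 3 := by rwa [Ne, ← hΦval, ← hhk, hΦval]
      rw [hΦ1 h hh, hΦ1 k hk] at hhk
      exact G.opp_injective (congrArg Subtype.val (hφinj (G'.opp_injective hhk)))
  have hΦsurj : Function.Surjective Φ := by
    intro k
    by_cases hk : G'.valence (G'.base k) = 3
    · obtain ⟨h, rfl⟩ := hφsurj k hk
      exact ⟨h.1, hΦ3 h.1 h.2⟩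
    · obtain ⟨h, hh⟩ := hφsurj _ ((ho' k).resolve_left hk)
      have h1 : G.valence (G.base (G.opp h.1)) ≠ 3 := by
        intro h3
        apply hk
        have := hφ3 ⟨_, h3⟩
        rwa [hopp3, hh, G'.opp_opp] at this
      refine ⟨G.opp h.1, ?_⟩
      rw [hΦ1 _ h1]
      have h2 : (⟨G.opp (G.opp h.1), hor _ h1⟩ : {h // G.valence (G.base h) = 3}) = h :=
        Subtype.ext (G.opp_opp _)
      rw [h2, hh, G'.opp_opp]
  have hsurj : ∀ {G : FinMultigraph}, (∀ v, G.valence v = 1 ∨ G.valence v = 3) →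
      Function.Surjective G.base := by
    intro G hv v
    obtain ⟨h, hh⟩ := Finset.card_pos.1 (by rw [card_star]; rcases hv v with h | h <;> omega :
      0 < (G.star v).card)
    exact ⟨h, mem_star.1 hh⟩
  refine nonempty_iso_of_equiv (Equiv.ofBijective Φ ⟨hΦinj, hΦsurj⟩) (fun h => ?_) (fun h k => ?_)
    (hsurj hv) (hsurj hv')
  · change G'.opp (Φ h) = Φ (G.opp h)
    refine (((hν' (Φ h) _).1 ?_).resolve_left fun hcon => ?_).symm
    · rw [hΦν, hΦν]; exact hν.opp h
    · exact G.opp_ne h (hΦinj hcon)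
  · change G'.base (Φ h) = G'.base (Φ k) ↔ _
    by_cases hh : G.valence (G.base h) = 3
    · by_cases hk : G.valence (G.base k) = 3
      · rw [hΦ3 h hh, hΦ3 k hk, hφbase']
      · refine iff_of_false (fun hcon => hk ?_) fun hcon => hk ?_
        · rwa [← hΦval, ← hcon, hΦval]
        · rwa [← hcon]
    · constructor
      · intro hcon
        have h1 := (hv' (G'.base (Φ k))).resolve_right (by rwa [← hcon, hΦval])
        rw [hΦinj (mem_star_of_valence_one h1 hcon)]
      · intro hcon
        have h1 := (hv (G.base k)).resolve_right (by rwa [← hcon])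
        rw [mem_star_of_valence_one h1 hcon]

end FinMultigraph

namespace MarkedGraph

open VertexSystem FinMultigraph

variable {E F : Type} {g p : ℕ}

theorem nonempty_iso_of_renaming {G G' : MarkedGraph g p} (hgp : 2 < 2 * g + p)
    {S : VertexSystem E} {S' : VertexSystem F} (hG : G.Presents S) (hG' : G'.Presents S')
    (h : Renaming S S') : Nonempty (Iso G.toFinMultigraph G'.toFinMultigraph) := by
  obtain ⟨f, hf, rfl⟩ := h
  exact nonempty_iso_of_presents (hG.map hf (G.valence_or hgp)) hG' G.valence_eq G'.valence_eq
    (G.valence_or hgp) (G'.valence_or hgp)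

theorem isMarked {G : MarkedGraph g p} (hgp : 2 < 2 * g + p) {S : VertexSystem E}
    (hG : G.Presents S) : S.IsMarked g p := by
  obtain ⟨ν, hν, rfl⟩ := hG
  exact G.isMarked_system hgp hν

/-- A step of the vertex system of a marked graph leads to the vertex system of a marked graph
that differs from it by a Whitehead move. -/
theorem exists_whiteheadMove {G : MarkedGraph g p} (hgp : 2 < 2 * g + p) {S S' : VertexSystem E}
    (hG : G.Presents S) (h : Step S S') :
    ∃ G' : MarkedGraph g p, G'.Presents S' ∧
      WhiteheadMove G.toFinMultigraph G'.toFinMultigraph := by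
  obtain ⟨a, b, hp, ha, hb, hmove⟩ := exists_exchange_of_step hG h
  have hval : ∀ v : (G.exchange a b).V, (G.exchange a b).valence v = G.valence v :=
    valence_exchange G.toFinMultigraph a b
  have hbase : ∀ h : (G.exchange a b).H,
      (G.exchange a b).valence ((G.exchange a b).base h) = G.valence (G.base h) := by
    classical
    intro h
    rw [hval]
    have h0 : ∀ x : G.H, G.valence (G.base (Equiv.swap a b x)) = G.valence (G.base x) := by
      intro x
      by_cases h1 : x = a
      · rw [h1, Equiv.swap_apply_left, ha, hb]
      · by_cases h2 : x = b
        · rw [h2, Equiv.swap_apply_right, ha, hb]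
        · rw [Equiv.swap_apply_of_ne_of_ne h1 h2]
    convert h0 h using 2
    simp only [exchange]
  have hconn : (G.exchange a b).IsConnected := by
    obtain ⟨ν, hν, rfl⟩ := hp
    have : Nonempty (G.exchange a b).V := G.connected.nonempty
    refine isConnected_of_conn hν (h.conn (G.isMarked hgp hG).conn) (fun v => ?_) fun k => ?_
    · rw [hval]; rcases G.valence_eq v with h | h <;> omega
    · rw [hbase, hbase]
      exact G.valence_or hgp k
  have hcard : ∀ k, Nat.card {v // (G.exchange a b).valence v = k} =
      Nat.card {v // G.valence v = k} := fun k =>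
    Nat.card_congr (Equiv.subtypeEquiv (Equiv.refl G.V) fun v =>
      iff_of_eq (congrArg (· = k) (hval v)))
  refine ⟨⟨G.exchange a b, hconn, G.rank_eq, fun v => ?_, ?_, ?_⟩, hp, hmove⟩
  · rw [hval]; exact G.valence_eq v
  · rw [hcard]; exact G.card_one
  · rw [hcard]; exact G.card_three

theorem exists_step_of_whiteheadMove {G G' : FinMultigraph} {S : VertexSystem E}
    (hG : G.Presents S) (h : WhiteheadMove G G') :
    ∃ S', Step S S' ∧ G'.Presents S' := by
  obtain ⟨ν, hν, rfl⟩ := hG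
  obtain ⟨h, a, b, h1, h2, h3, h4, h5, h6, h7, ⟨f⟩⟩ := h
  exact ⟨_, exists_step_of_exchange hν h1 h2 h3 h4 h5 h6 h7, f.presents ⟨ν, hν, rfl⟩⟩

end MarkedGraph

/-! ### The graph with a given vertex system -/

namespace VertexSystem

variable {E : Type} {W : Type} [Fintype W]

/-- The vertex system whose vertices are indexed by `W`, with three half-edges at each of them. -/
def ofFun (ν : W → Fin 3 → E) : VertexSystem E :=
  (Finset.univ : Finset W).val.map fun w => tri (ν w 0) (ν w 1) (ν w 2)

theorem map_univ_eq_tri (f : Fin 3 → E) :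
    (Finset.univ : Finset (Fin 3)).val.map f = tri (f 0) (f 1) (f 2) := by
  rw [Fin.univ_val_map]
  rfl

theorem count_join_ofFun [DecidableEq E] (ν : W → Fin 3 → E) (x : E) :
    (ofFun ν).join.count x = (Finset.univ.filter fun q : W × Fin 3 => ν q.1 q.2 = x).card := by
  rw [ofFun, Multiset.join, Multiset.count_sum, Finset.card_filter, Fintype.sum_prod_type]
  refine Finset.sum_congr rfl fun w _ => ?_
  rw [← Finset.card_filter, ← map_univ_eq_tri, Multiset.count_map]
  simp only [eq_comm (a := x)]
  rfl

theorem mem_join_ofFun {ν : W → Fin 3 → E} {x : E} :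
    x ∈ (ofFun ν).join ↔ ∃ w i, ν w i = x := by
  classical
  rw [← Multiset.one_le_count_iff_mem, count_join_ofFun, Nat.one_le_iff_ne_zero,
    Finset.card_ne_zero]
  constructor
  · rintro ⟨⟨w, i⟩, h⟩
    exact ⟨w, i, (Finset.mem_filter.1 h).2⟩
  · rintro ⟨w, i, h⟩
    exact ⟨(w, i), by simpa using h⟩

theorem card_ofFun (ν : W → Fin 3 → E) : (ofFun ν).card = Fintype.card W := by
  simp [ofFun]

theorem conn_ofFun {ν : W → Fin 3 → E} : (ofFun ν).Conn ↔ ∀ N : Set E,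
    (∀ w, (∀ i, ν w i ∈ N) ∨ ∀ i, ν w i ∉ N) → (∀ w i, ν w i ∈ N) ∨ ∀ w i, ν w i ∉ N := by
  simp [Conn, ofFun, Fin.forall_fin_succ]

theorem card_of_mem_ofFun {ν : W → Fin 3 → E} {v : Multiset E} (hv : v ∈ ofFun ν) :
    v.card = 3 := by
  obtain ⟨w, -, rfl⟩ := Multiset.mem_map.1 hv
  rfl

end VertexSystem

namespace FinMultigraph

variable {E : Type}

/-- The number of half-edges is twice the number of edges. -/
theorem two_mul_card_edges (G : FinMultigraph) : 2 * Nat.card G.edges = Nat.card G.H := by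
  classical
  have h1 : Nat.card G.edges = (Finset.univ.image fun h => s(h, G.opp h)).card := by
    rw [Nat.card_coe_set_eq, ← Set.ncard_coe_finset]
    simp [edges]
  rw [h1, Nat.card_eq_fintype_card, ← Finset.card_univ,
    Finset.card_eq_sum_card_image (fun h => s(h, G.opp h)) Finset.univ,
    Finset.sum_congr rfl (g := fun _ => 2), Finset.sum_const, smul_eq_mul, mul_comm]
  intro x hx
  obtain ⟨h, -, rfl⟩ := Finset.mem_image.1 hx
  rw [← Finset.card_pair (G.opp_ne h).symm]
  congr 1
  ext k
  simpa using G.isNaming_edge h k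

/-- The graph whose half-edges are attached according to `base`, two of them forming an edge if
they have the same name. -/
noncomputable def ofNaming (V H : Type) [Finite V] [Finite H] (base : H → V) (ν : H → E)
    (hν : ∀ h, ∃ h', h' ≠ h ∧ ∀ k, ν k = ν h ↔ k = h ∨ k = h') : FinMultigraph where
  V := V
  H := H
  finiteV := inferInstance
  finiteH := inferInstance
  base := base
  opp h := (hν h).choose
  opp_opp h := by
    have h1 := (hν h).choose_spec
    have h2 := (hν (hν h).choose).choose_spec
    have h3 : ν (hν (hν h).choose).choose = ν h :=
      ((h2.2 _).2 (.inr rfl)).trans ((h1.2 _).2 (.inr rfl))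
    exact ((h1.2 _).1 h3).resolve_right h2.1
  opp_ne h := (hν h).choose_spec.1

theorem isNaming_ofNaming {V H : Type} [Finite V] [Finite H] {base : H → V} {ν : H → E}
    (hν : ∀ h, ∃ h', h' ≠ h ∧ ∀ k, ν k = ν h ↔ k = h ∨ k = h') :
    (ofNaming V H base ν hν).IsNaming ν := fun h k => (hν h).choose_spec.2 k

end FinMultigraph

namespace MarkedGraph

open VertexSystem FinMultigraph

variable {E : Type} {W : Type} [Fintype W] {g p : ℕ}

/-- Every vertex system satisfying the conditions on a marked graph is the vertex system of a
marked graph. -/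
theorem exists_presents_ofFun (ν : W → Fin 3 → E) (hS : (ofFun ν).IsMarked g p)
    (hgp : 2 < 2 * g + p) : ∃ G : MarkedGraph g p, G.Presents (ofFun ν) := by
  classical
  have hfin := finite_plain (ofFun ν)
  let L := {x | (ofFun ν).join.count x = 1}
  have : Finite L := hfin
  let name : (W × Fin 3) ⊕ L → E := Sum.elim (fun q => ν q.1 q.2) Subtype.val
  have hname : ∀ h, ∃ h', h' ≠ h ∧ ∀ k, name k = name h ↔ k = h ∨ k = h' := by
    have hL : ∀ x : L, ∃ q : W × Fin 3, ∀ q' : W × Fin 3, ν q'.1 q'.2 = x.1 ↔ q' = q := by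
      rintro ⟨x, hx⟩
      obtain ⟨q, hq⟩ := Finset.card_eq_one.1 ((count_join_ofFun ν x).symm.trans hx)
      exact ⟨q, fun q' => by simpa using Finset.ext_iff.1 hq q'⟩
    rintro (q | x)
    · have h2 := hS.count_le (ν q.1 q.2)
      rw [count_join_ofFun] at h2
      have h1 : 1 ≤ (Finset.univ.filter fun q' : W × Fin 3 => ν q'.1 q'.2 = ν q.1 q.2).card :=
        Finset.card_pos.2 ⟨q, by simp⟩
      obtain h3 | h3 : (Finset.univ.filter fun q' : W × Fin 3 =>
          ν q'.1 q'.2 = ν q.1 q.2).card = 1 ∨ (Finset.univ.filter fun q' : W × Fin 3 =>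
          ν q'.1 q'.2 = ν q.1 q.2).card = 2 := by omega
      · have hqL : ν q.1 q.2 ∈ L := (count_join_ofFun ν _).trans h3
        obtain ⟨q₀, hq₀⟩ := hL ⟨_, hqL⟩
        refine ⟨.inr ⟨_, hqL⟩, by simp, ?_⟩
        rintro (q' | x)
        · have h4 := hq₀ q'
          have h5 := (hq₀ q).1 rfl
          subst h5
          simpa [name] using h4
        · simp [name, Subtype.ext_iff]
      · obtain ⟨q', hq', hne⟩ := Finset.exists_mem_ne (by omega) q (s := Finset.univ.filter
          fun q' : W × Fin 3 => ν q'.1 q'.2 = ν q.1 q.2)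
        have hpair : Finset.univ.filter (fun q' : W × Fin 3 => ν q'.1 q'.2 = ν q.1 q.2) =
            {q, q'} := by
          refine (Finset.eq_of_subset_of_card_le ?_ ?_).symm
          · intro k hk
            rcases Finset.mem_insert.1 hk with rfl | hk
            · simp
            · rw [Finset.mem_singleton.1 hk]; exact hq'
          · rw [h3, Finset.card_pair hne.symm]
        refine ⟨.inl q', by simpa using hne, ?_⟩
        rintro (k | ⟨x, hx⟩)
        · have := Finset.ext_iff.1 hpair k
          simpa [name] using this
        · have hxL : (ofFun ν).join.count x = 1 := hx
          simp only [name, Sum.elim_inr, Sum.elim_inl, reduceCtorEq, or_self, iff_false]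
          rintro rfl
          rw [count_join_ofFun] at hxL
          omega
    · obtain ⟨q, hq⟩ := hL x
      refine ⟨.inl q, by simp, ?_⟩
      rintro (k | y)
      · simpa [name] using hq k
      · simp [name, Subtype.ext_iff]
  let G := ofNaming (W ⊕ L) ((W × Fin 3) ⊕ L) (Sum.map Prod.fst id) name hname
  have hνG : G.IsNaming name := isNaming_ofNaming hname
  have hv3 : ∀ w : W, G.valence (.inl w) = 3 := by
    intro w
    rw [← Nat.card_fin 3]
    refine Nat.card_congr ⟨fun h => match h with
      | ⟨.inl q, _⟩ => q.2
      | ⟨.inr x, hx⟩ => absurd hx (by simp [G, ofNaming]), fun i => ⟨.inl (w, i), rfl⟩, ?_, ?_⟩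
    · rintro ⟨⟨w', i⟩ | x, hx⟩
      · have : w' = w := by simpa [G, ofNaming] using hx
        subst this
        rfl
      · exact absurd hx (by simp [G, ofNaming])
    · intro i
      rfl
  have hv1 : ∀ x : L, G.valence (.inr x) = 1 := by
    intro x
    refine Nat.card_eq_one_iff_unique.2 ⟨⟨?_⟩, ⟨⟨.inr x, rfl⟩⟩⟩
    have : ∀ h : {h // G.base h = .inr x}, h.1 = .inr x := by
      rintro ⟨q | y, hy⟩
      · exact absurd hy (by simp [G, ofNaming])
      · have : y = x := by simpa [G, ofNaming] using hy
        exact congrArg Sum.inr this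
    exact fun a b => Subtype.ext ((this a).trans (this b).symm)
  have hcardW : (Fintype.card W : ℤ) + 2 = 2 * g + p := by
    have := hS.card
    rw [card_ofFun] at this
    exact_mod_cast this
  have hcardL : Nat.card L = p := hS.plain
  have hsys : G.system name = ofFun ν := by
    have h1 : (G.trivalent : Finset (W ⊕ L)) = Finset.univ.map Function.Embedding.inl := by
      refine Finset.ext fun v => ?_
      rcases v with w | x
      · exact iff_of_true (mem_trivalent.2 (hv3 w)) (Finset.mem_map.2 ⟨w, Finset.mem_univ _, rfl⟩)
      · refine iff_of_false (fun h => ?_) fun h => ?_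
        · exact absurd ((hv1 x).symm.trans (mem_trivalent.1 h)) (by decide)
        · obtain ⟨w, -, hw⟩ := Finset.mem_map.1 h
          cases hw
    have h2 : ∀ w : W, (G.star (Sum.inl w : W ⊕ L) : Finset ((W × Fin 3) ⊕ L)) = Finset.univ.map
        ((⟨fun i => .inl (w, i), fun i j hij => by simpa using hij⟩ :
          Fin 3 ↪ (W × Fin 3) ⊕ L)) := by
      intro w
      refine Finset.ext fun h => ?_
      rcases h with ⟨w', i⟩ | x
      · constructor
        · intro h
          have h3 : (Sum.inl w' : W ⊕ L) = Sum.inl w := mem_star.1 h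
          obtain rfl := Sum.inl_injective h3
          exact Finset.mem_map.2 ⟨i, Finset.mem_univ _, rfl⟩
        · intro h
          obtain ⟨j, -, hj⟩ := Finset.mem_map.1 h
          cases hj
          exact mem_star.2 rfl
      · refine iff_of_false (fun h => ?_) fun h => ?_
        · have h3 : (Sum.inr x : W ⊕ L) = Sum.inl w := mem_star.1 h
          cases h3
        · obtain ⟨j, -, hj⟩ := Finset.mem_map.1 h
          cases hj
    change Multiset.map (fun v : W ⊕ L => Multiset.map name
      (G.star v : Finset ((W × Fin 3) ⊕ L)).val) (G.trivalent : Finset (W ⊕ L)).val = _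
    rw [h1, Finset.map_val, Multiset.map_map, ofFun]
    refine Multiset.map_congr rfl fun w _ => ?_
    change Multiset.map name (G.star (Sum.inl w : W ⊕ L) : Finset ((W × Fin 3) ⊕ L)).val = _
    rw [h2, Finset.map_val, Multiset.map_map, ← map_univ_eq_tri]
    rfl
  have hor : ∀ h, G.valence (G.base h) = 3 ∨ G.valence (G.base (G.opp h)) = 3 := by
    rintro (q | x)
    · exact .inl (hv3 q.1)
    · right
      rcases ho : G.opp (.inr x) with q | y
      · exact hv3 q.1
      · exfalso
        have h1 : name (G.opp (.inr x)) = name (.inr x) := hνG.opp _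
        have h2 : y = x := Subtype.ext (by rw [ho] at h1; exact h1)
        rw [h2] at ho
        exact G.opp_ne _ ho
  have hnonempty : Nonempty W := by
    rw [← Fintype.card_pos_iff]
    omega
  have : Nonempty G.V := hnonempty.map .inl
  refine ⟨⟨G, isConnected_of_conn hνG (hsys ▸ hS.conn) ?_ hor, ?_, ?_, ?_, ?_⟩, name, hνG, hsys⟩
  · rintro (w | x)
    · rw [hv3]; omega
    · rw [hv1]; omega
  · have h1 := G.two_mul_card_edges
    have h2 : Nat.card G.H = Fintype.card W * 3 + p := by
      change Nat.card ((W × Fin 3) ⊕ L) = _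
      rw [Nat.card_sum, Nat.card_prod, hcardL]
      simp
    have h3 : Nat.card G.V = Fintype.card W + p := by
      change Nat.card (W ⊕ L) = _
      rw [Nat.card_sum, hcardL]
      simp
    rw [rank, h3]
    push_cast
    omega
  · rintro (w | x)
    · exact .inr (hv3 w)
    · exact .inl (hv1 x)
  · rw [← hcardL]
    refine (Nat.card_congr (Equiv.ofBijective (fun x : L => ⟨.inr x, hv1 x⟩) ⟨?_, ?_⟩)).symm
    · exact fun x y hxy => Sum.inr_injective (congrArg Subtype.val hxy)
    · rintro ⟨w | x, hx⟩
      · rw [hv3] at hx; omega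
      · exact ⟨x, rfl⟩
  · have : Nat.card {v // G.valence v = 3} = Fintype.card W := by
      rw [← Nat.card_eq_fintype_card]
      refine (Nat.card_congr (Equiv.ofBijective (fun w : W => ⟨.inl w, hv3 w⟩) ⟨?_, ?_⟩)).symm
      · exact fun x y hxy => Sum.inl_injective (congrArg Subtype.val hxy)
      · rintro ⟨w | x, hx⟩
        · exact ⟨w, rfl⟩
        · rw [hv1] at hx; omega
    rw [this]
    omega

end MarkedGraph

/-! ### Distances in the space of graphs -/

namespace MarkedGraph

open VertexSystem FinMultigraph

variable {E F : Type} {g p : ℕ}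

/-- The point of the space of graphs represented by a marked graph. -/
def cls (G : MarkedGraph g p) : GraphSpace g p := Quotient.mk (markedGraphSetoid g p) G

theorem cls_eq_iff {G G' : MarkedGraph g p} :
    G.cls = G'.cls ↔ Nonempty (Iso G.toFinMultigraph G'.toFinMultigraph) :=
  Quotient.eq (r := markedGraphSetoid g p)

theorem exists_cls_eq (X : GraphSpace g p) : ∃ G : MarkedGraph g p, G.cls = X :=
  Quotient.exists_rep X

/-- Steps between vertex systems are covered by a path in the space of graphs. -/
theorem edist_cls_le {G : MarkedGraph g p} (hgp : 2 < 2 * g + p) {S T : VertexSystem E} {k : ℕ}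
    (hG : G.Presents S) (h : Steps k S T) :
    ∃ G' : MarkedGraph g p, G'.Presents T ∧ (whiteheadGraph g p).edist G.cls G'.cls ≤ k := by
  induction h with
  | refl => exact ⟨G, hG, by simp⟩
  | tail _ hs ih =>
    obtain ⟨G₁, h1, h2⟩ := ih hG
    obtain ⟨G₂, h3, h4⟩ := G₁.exists_whiteheadMove hgp h1 hs
    refine ⟨G₂, h3, (SimpleGraph.edist_triangle (v := G₁.cls)).trans ?_⟩
    push_cast
    refine add_le_add h2 (SimpleGraph.edist_le_one_iff_adj_or_eq.2 ?_)
    by_cases heq : G₁.cls = G₂.cls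
    · exact .inr heq
    · left
      rw [whiteheadGraph, SimpleGraph.fromRel_adj]
      exact ⟨heq, .inl ⟨G₁, G₂, rfl, rfl, h4⟩⟩

/-- Any two graphs are joined by a path through their common normal form. -/
theorem edist_le (hgp : 2 < 2 * g + p) (X Y : GraphSpace g p) :
    (whiteheadGraph g p).edist X Y ≤
      (2 * (2 * (2 * g + p) + g * (2 * Nat.clog 2 (2 * g + p) + 3) + (p + 2)) : ℕ) := by
  obtain ⟨G, rfl⟩ := exists_cls_eq X
  obtain ⟨G', rfl⟩ := exists_cls_eq Y
  have key : ∀ G : MarkedGraph g p, ∃ (A : List (Sym2 G.H × Sym2 G.H × Sym2 G.H))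
      (B : List (Sym2 G.H × Sym2 G.H)) (e : Sym2 G.H) (G₁ : MarkedGraph g p),
      NTree.IsNormalForm g p A B e ∧
      G₁.Presents (NTree.loopComb A (NTree.plainComb B e)).tris ∧
      (whiteheadGraph g p).edist G.cls G₁.cls ≤
        (2 * (2 * g + p) + g * (2 * Nat.clog 2 (2 * g + p) + 3) + (p + 2) : ℕ) := by
    intro G
    have hν := G.isNaming_edge
    have hS := G.isMarked_system hgp hν
    obtain ⟨A, B, e, hnf, k, hk, hs⟩ := NTree.exists_normalForm hS hgp
    obtain ⟨G₁, h1, h2⟩ := edist_cls_le hgp ⟨_, hν, rfl⟩ hs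
    refine ⟨A, B, e, G₁, hnf, h1, h2.trans ?_⟩
    have hcard : (G.system fun h => s(h, G.opp h)).card ≤ 2 * g + p := by
      have := hS.card
      omega
    have hlog := Nat.clog_mono_right 2 hcard
    have := Nat.mul_le_mul_left g (show 2 * Nat.clog 2 (G.system fun h => s(h, G.opp h)).card + 3 ≤
      2 * Nat.clog 2 (2 * g + p) + 3 by omega)
    exact_mod_cast (by omega)
  obtain ⟨A, B, e, G₁, hnf, hp, hd⟩ := key G
  obtain ⟨A', B', e', G₁', hnf', hp', hd'⟩ := key G'
  have heq : G₁.cls = G₁'.cls :=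
    cls_eq_iff.2 (nonempty_iso_of_renaming hgp hp hp' (NTree.renaming_of_isNormalForm hnf hnf'))
  rw [two_mul (2 * (2 * g + p) + _ + _)]
  push_cast at hd hd' ⊢
  refine (SimpleGraph.edist_triangle (v := G₁.cls)).trans (add_le_add hd ?_)
  rw [heq, SimpleGraph.edist_comm]
  exact hd'

/-- A walk in the space of graphs is covered by Whitehead steps of vertex systems. -/
theorem exists_steps_of_walk [Nonempty E] (hgp : 2 < 2 * g + p) {X Y : GraphSpace g p}
    (w : (whiteheadGraph g p).Walk X Y)
    {G G' : MarkedGraph g p} (hX : G.cls = X) (hY : G'.cls = Y) {S : VertexSystem E}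
    (hG : G.Presents S) : ∃ T, Steps w.length S T ∧ G'.Presents T := by
  induction w generalizing G S with
  | nil =>
    obtain ⟨f⟩ := cls_eq_iff.1 (hX.trans hY.symm)
    exact ⟨S, .refl S, f.presents hG⟩
  | cons hadj w ih =>
    rw [whiteheadGraph, SimpleGraph.fromRel_adj] at hadj
    obtain ⟨-, ⟨G₁, G₂, h1, h2, hm⟩ | ⟨G₂, G₁, h2, h1, hm⟩⟩ := hadj
    · obtain ⟨f⟩ := cls_eq_iff.1 (hX.trans h1.symm)
      obtain ⟨S₁, hs, hp⟩ := exists_step_of_whiteheadMove (f.presents hG) hm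
      obtain ⟨T, hT, hp'⟩ := ih h2 hY hp
      refine ⟨T, ?_, hp'⟩
      have := ((Steps.refl S).tail hs).trans hT
      rwa [zero_add, add_comm] at this
    · -- the move is reversed, and the names of its target are transported to its source
      obtain ⟨f⟩ := cls_eq_iff.1 (hX.trans h1.symm)
      obtain ⟨T₁, hs, hp⟩ := exists_step_of_whiteheadMove ⟨_, G₂.isNaming_edge, rfl⟩ hm
      obtain ⟨r, hr, rfl⟩ := hp.renaming (f.presents hG)
      rw [hs.join_eq] at hr
      have hp₂ := Presents.map ⟨_, G₂.isNaming_edge, rfl⟩ hr (G₂.valence_or hgp)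
      obtain ⟨T, hT, hp'⟩ := ih h2 hY hp₂
      refine ⟨T, ?_, hp'⟩
      have := ((Steps.refl _).tail (hs.symm.map r)).trans hT
      rwa [zero_add, add_comm] at this

end MarkedGraph

/-! ### Counting the ends of a graph -/

namespace VertexSystem

variable {E F : Type}

open Classical in
/-- A vertex is an end of the graph if it carries a loop or two edges leading to vertices of
valence one; `J` is the multiset of all names at the trivalent vertices. -/
def IsEnd (J : Multiset E) (v : Multiset E) : Prop :=
  ∃ x y z, v = tri x y z ∧ (x = y ∨ (J.count x = 1 ∧ J.count y = 1))

open Classical in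
/-- The number of ends of a graph. A Whitehead move changes it by at most two, since only the two
vertices at the edge in question can become or cease to be ends. -/
noncomputable def ends (S : VertexSystem E) : ℕ := S.countP (IsEnd S.join)

theorem Step.ends_le {S S' : VertexSystem E} (h : Step S S') : S'.ends ≤ S.ends + 2 := by
  classical
  rw [ends, ends, h.join_eq]
  generalize S.join = J
  obtain ⟨e, x, y, z, w, M, rfl, rfl⟩ := h
  simp only [Multiset.countP_cons]
  split_ifs <;> omega

theorem Steps.ends_le {k : ℕ} {S S' : VertexSystem E} (h : Steps k S S') :
    S'.ends ≤ S.ends + 2 * k := by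
  induction h with
  | refl => simp
  | tail _ hs ih =>
    have := hs.ends_le
    omega

theorem join_map (f : E → F) (S : VertexSystem E) :
    (S.map (Multiset.map f)).join = S.join.map f := by
  induction S using Multiset.induction with
  | empty => simp
  | cons v S ih =>
    rw [Multiset.map_cons, Multiset.join_cons, Multiset.join_cons, Multiset.map_add, ih]

open Classical in
theorem count_map_of_injOn {f : E → F} {J : Multiset E} (hf : Set.InjOn f {x | x ∈ J}) {x : E}
    (hx : x ∈ J) : (J.map f).count (f x) = J.count x := by
  rw [Multiset.count_map, ← Multiset.countP_eq_card_filter, Multiset.count]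
  refine Multiset.countP_congr rfl fun y hy => ?_
  exact propext ⟨fun h => hf hx hy h, fun h => congrArg f h⟩

theorem Renaming.ends_eq {S : VertexSystem E} {S' : VertexSystem F} (h : Renaming S S') :
    S'.ends = S.ends := by
  classical
  obtain ⟨f, hf, rfl⟩ := h
  rw [ends, ends, join_map, Multiset.countP_map, ← Multiset.countP_eq_card_filter]
  refine Multiset.countP_congr rfl fun v hv => propext ?_
  have hmem : ∀ x ∈ v, x ∈ S.join := fun x hx => Multiset.mem_join.2 ⟨v, hv, hx⟩
  constructor
  · rintro ⟨x, y, z, h1, h2⟩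
    obtain ⟨a, b, c, rfl, rfl, rfl, rfl⟩ := FinMultigraph.exists_map_eq_tri h1
    refine ⟨a, b, c, rfl, h2.imp (fun h => hf (hmem a (by simp)) (hmem b (by simp)) h) fun h => ?_⟩
    rwa [count_map_of_injOn hf (hmem a (by simp)), count_map_of_injOn hf (hmem b (by simp))] at h
  · rintro ⟨a, b, c, rfl, h2⟩
    refine ⟨f a, f b, f c, rfl, h2.imp (congrArg f) fun h => ?_⟩
    rwa [count_map_of_injOn hf (hmem a (by simp)), count_map_of_injOn hf (hmem b (by simp))]

/-! ### Attaching vertices at plain edges -/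

open Classical in
/-- Attaching a vertex with two new plain edges to a plain edge `r`. -/
theorem IsMarked.attach_tri {S : VertexSystem E} {g p : ℕ} (hS : S.IsMarked g p) {r a b : E}
    (hr : S.join.count r = 1) (ha : a ∉ S.join) (hb : b ∉ S.join) (hab : a ≠ b) :
    IsMarked (tri r a b ::ₘ S) g (p + 1) := by
  have hrJ : r ∈ S.join := Multiset.one_le_count_iff_mem.1 hr.ge
  have hra : r ≠ a := by rintro rfl; exact ha hrJ
  have hrb : r ≠ b := by rintro rfl; exact hb hrJ
  have hcount : ∀ x, (tri r a b ::ₘ S).join.count x = S.join.count x +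
      ((if x = r then 1 else 0) + (if x = a then 1 else 0) + if x = b then 1 else 0) := by
    intro x
    rw [Multiset.join_cons, Multiset.count_add, tri, Multiset.insert_eq_cons,
      Multiset.insert_eq_cons, Multiset.count_cons, Multiset.count_cons, Multiset.count_singleton]
    omega
  have ha0 := Multiset.count_eq_zero.2 ha
  have hb0 := Multiset.count_eq_zero.2 hb
  refine ⟨fun N hN => ?_, ?_, fun x => ?_, ?_, ?_⟩
  · simp only [Multiset.mem_cons, forall_eq_or_imp, mem_tri] at hN ⊢
    simp only [forall_eq] at hN ⊢
    obtain ⟨v, hv, hrv⟩ := Multiset.mem_join.1 hrJ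
    rcases hS.conn N hN.2 with h | h
    · have := h v hv r hrv
      exact .inl ⟨by tauto, h⟩
    · have := h v hv r hrv
      exact .inr ⟨by tauto, h⟩
  · intro v hv
    rcases Multiset.mem_cons.1 hv with rfl | hv
    · rfl
    · exact hS.card_vertex v hv
  · rw [hcount]
    have := hS.count_le x
    by_cases h1 : x = r
    · subst h1; rw [if_pos rfl, if_neg hra, if_neg hrb]; omega
    · by_cases h2 : x = a
      · subst h2; rw [if_neg h1, if_pos rfl, if_neg hab]; omega
      · rw [if_neg h1, if_neg h2]; split_ifs with h3
        · subst h3; omega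
        · omega
  · have := hS.card
    rw [Multiset.card_cons]
    omega
  · have hset : {x | (tri r a b ::ₘ S).join.count x = 1} =
        insert a (insert b ({x | S.join.count x = 1} \ {r})) := by
      ext x
      simp only [Set.mem_ofPred_eq, Set.mem_insert_iff, Set.mem_sdiff, Set.mem_singleton_iff]
      rw [hcount]
      by_cases h1 : x = r
      · subst h1; simp [hr, hra, hrb]
      · by_cases h2 : x = a
        · subst h2; simp [ha0, h1, hab]
        · by_cases h3 : x = b
          · subst h3; simp [hb0, h1, h2]
          · simp [h1, h2, h3]
    have hfin := (finite_plain S).subset (Set.sdiff_subset (t := {r}))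
    rw [hset, Set.ncard_insert_of_notMem _ (hfin.insert b), Set.ncard_insert_of_notMem _ hfin,
      Set.ncard_sdiff_singleton_of_mem
        (show r ∈ {x | S.join.count x = 1} from hr), hS.plain]
    · have : 0 < p := by
        rw [← hS.plain, Set.ncard_pos (finite_plain S)]
        exact ⟨r, hr⟩
      omega
    · simp [hb0]
    · simp [ha0, hab]

open Classical in
/-- Attaching a vertex with a loop to a plain edge `r`. -/
theorem IsMarked.attach_loop {S : VertexSystem E} {g p : ℕ} (hS : S.IsMarked g (p + 1)) {r a : E}
    (hr : S.join.count r = 1) (ha : a ∉ S.join) : IsMarked (tri r a a ::ₘ S) (g + 1) p := by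
  have hrJ : r ∈ S.join := Multiset.one_le_count_iff_mem.1 hr.ge
  have hra : r ≠ a := by rintro rfl; exact ha hrJ
  have hcount : ∀ x, (tri r a a ::ₘ S).join.count x = S.join.count x +
      ((if x = r then 1 else 0) + 2 * if x = a then 1 else 0) := by
    intro x
    rw [Multiset.join_cons, Multiset.count_add, tri, Multiset.insert_eq_cons,
      Multiset.insert_eq_cons, Multiset.count_cons, Multiset.count_cons, Multiset.count_singleton]
    omega
  have ha0 := Multiset.count_eq_zero.2 ha
  refine ⟨fun N hN => ?_, ?_, fun x => ?_, ?_, ?_⟩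
  · simp only [Multiset.mem_cons, forall_eq_or_imp, mem_tri] at hN ⊢
    simp only [forall_eq] at hN ⊢
    obtain ⟨v, hv, hrv⟩ := Multiset.mem_join.1 hrJ
    rcases hS.conn N hN.2 with h | h
    · have := h v hv r hrv
      exact .inl ⟨by tauto, h⟩
    · have := h v hv r hrv
      exact .inr ⟨by tauto, h⟩
  · intro v hv
    rcases Multiset.mem_cons.1 hv with rfl | hv
    · rfl
    · exact hS.card_vertex v hv
  · rw [hcount]
    have := hS.count_le x
    by_cases h1 : x = r
    · subst h1; rw [if_pos rfl, if_neg hra]; omega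
    · by_cases h2 : x = a
      · subst h2; rw [if_neg h1, if_pos rfl]; omega
      · rw [if_neg h1, if_neg h2]; omega
  · have := hS.card
    rw [Multiset.card_cons]
    omega
  · have hset : {x | (tri r a a ::ₘ S).join.count x = 1} = {x | S.join.count x = 1} \ {r} := by
      ext x
      simp only [Set.mem_ofPred_eq, Set.mem_sdiff, Set.mem_singleton_iff]
      rw [hcount]
      by_cases h1 : x = r
      · subst h1; simp [hr, hra]
      · by_cases h2 : x = a
        · subst h2; simp [ha0, h1]
        · simp [h1, h2]
    rw [hset, Set.ncard_sdiff_singleton_of_mem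
        (show r ∈ {x | S.join.count x = 1} from hr), hS.plain, Nat.add_sub_cancel]

theorem countP_le_countP {α : Type*} {s : Multiset α} {P Q : α → Prop} [DecidablePred P]
    [DecidablePred Q] (h : ∀ a ∈ s, P a → Q a) : s.countP P ≤ s.countP Q := by
  induction s using Multiset.induction with
  | empty => simp
  | cons a s ih =>
    have h1 := ih fun b hb => h b (Multiset.mem_cons_of_mem hb)
    have h2 := h a (Multiset.mem_cons_self a s)
    rw [Multiset.countP_cons, Multiset.countP_cons]
    split_ifs <;> first | omega | tauto

open Classical in
/-- A vertex is an end off the edge `r` if it is an end for a reason that does not involve `r`. -/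
def IsEndOff (J : Multiset E) (r : E) (v : Multiset E) : Prop :=
  ∃ x y z, v = tri x y z ∧ (x = y ∨ (J.count x = 1 ∧ J.count y = 1 ∧ x ≠ r ∧ y ≠ r))

open Classical in
/-- The number of ends off the edge `r`. -/
noncomputable def endsOff (S : VertexSystem E) (r : E) : ℕ := S.countP (IsEndOff S.join r)

theorem endsOff_le_ends (S : VertexSystem E) (r : E) : S.endsOff r ≤ S.ends := by
  classical
  refine countP_le_countP ?_
  rintro v - ⟨x, y, z, rfl, h⟩
  exact ⟨x, y, z, rfl, h.imp_right fun h => ⟨h.1, h.2.1⟩⟩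

open Classical in
/-- The plain edge `r` is involved at one vertex only. -/
theorem ends_le_endsOff (S : VertexSystem E) (r : E) (hr : S.join.count r = 1) :
    S.ends ≤ S.endsOff r + 1 := by
  have h1 : S.countP (r ∈ ·) ≤ S.join.count r := by
    clear hr
    induction S using Multiset.induction with
    | empty => simp
    | cons v S ih =>
      rw [Multiset.countP_cons, Multiset.join_cons, Multiset.count_add]
      split_ifs with h
      · have := Multiset.one_le_count_iff_mem.2 h
        omega
      · omega
  have h2 : S.ends ≤ S.countP (fun v => IsEndOff S.join r v ∨ r ∈ v) := by
    refine countP_le_countP ?_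
    rintro v - ⟨x, y, z, rfl, h⟩
    by_cases hrv : r ∈ tri x y z
    · exact .inr hrv
    · rw [mem_tri] at hrv
      refine .inl ⟨x, y, z, rfl, h.imp_right fun h => ⟨h.1, h.2, ?_, ?_⟩⟩ <;>
      · rintro rfl
        simp at hrv
  have h3 : ∀ (T : VertexSystem E) (P Q : Multiset E → Prop) [DecidablePred P]
      [DecidablePred Q], T.countP (fun v => P v ∨ Q v) ≤ T.countP P + T.countP Q := by
    intro T P Q _ _
    induction T using Multiset.induction with
    | empty => simp
    | cons v T ih =>
      simp only [Multiset.countP_cons]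
      split_ifs <;> first | omega | tauto
  have h4 := h3 S (IsEndOff S.join r) (r ∈ ·)
  rw [endsOff]
  omega

/-! ### Graphs with few and with many ends -/

open Classical in
theorem count_join_cons_tri (S : VertexSystem E) (a b c x : E) :
    (tri a b c ::ₘ S).join.count x = S.join.count x +
      ((if x = a then 1 else 0) + (if x = b then 1 else 0) + if x = c then 1 else 0) := by
  rw [Multiset.join_cons, Multiset.count_add, tri, Multiset.insert_eq_cons,
    Multiset.insert_eq_cons, Multiset.count_cons, Multiset.count_cons, Multiset.count_singleton]
  omega

open Classical in
/-- The graph with a single trivalent vertex and three plain edges. -/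
theorem isMarked_singleton_tri {a b c : E} (hab : a ≠ b) (hac : a ≠ c) (hbc : b ≠ c) :
    IsMarked ({tri a b c} : VertexSystem E) 0 3 := by
  have hcount : ∀ x, ({tri a b c} : VertexSystem E).join.count x =
      ((if x = a then 1 else 0) + (if x = b then 1 else 0) + if x = c then 1 else 0) := by
    intro x
    have := count_join_cons_tri 0 a b c x
    simpa using this
  refine ⟨fun N hN => ?_, ?_, fun x => ?_, rfl, ?_⟩
  · simp only [Multiset.mem_singleton, forall_eq] at hN ⊢
    exact hN
  · intro v hv
    rw [Multiset.mem_singleton.1 hv]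
    rfl
  · rw [hcount]
    by_cases h1 : x = a
    · subst h1; simp [hab, hac]
    · by_cases h2 : x = b
      · subst h2; simp [h1, hbc]
      · simp [h1, h2]; split_ifs <;> omega
  · have hset : {x | ({tri a b c} : VertexSystem E).join.count x = 1} = {a, b, c} := by
      ext x
      simp only [Set.mem_ofPred_eq, Set.mem_insert_iff, Set.mem_singleton_iff]
      rw [hcount]
      by_cases h1 : x = a
      · subst h1; simp [hab, hac]
      · by_cases h2 : x = b
        · subst h2; simp [h1, hbc]
        · simp [h1, h2]
    rw [hset, Set.ncard_insert_of_notMem (by simp [hab, hac]), Set.ncard_pair hbc]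

open Classical in
/-- The graph with a single trivalent vertex, one plain edge and a loop. -/
theorem isMarked_singleton_loop {a b : E} (hab : a ≠ b) :
    IsMarked ({tri a b b} : VertexSystem E) 1 1 := by
  have hcount : ∀ x, ({tri a b b} : VertexSystem E).join.count x =
      ((if x = a then 1 else 0) + (if x = b then 1 else 0) + if x = b then 1 else 0) := by
    intro x
    have := count_join_cons_tri 0 a b b x
    simpa using this
  refine ⟨fun N hN => ?_, ?_, fun x => ?_, rfl, ?_⟩
  · simp only [Multiset.mem_singleton, forall_eq] at hN ⊢
    exact hN
  · intro v hv
    rw [Multiset.mem_singleton.1 hv]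
    rfl
  · rw [hcount]
    by_cases h1 : x = a
    · subst h1; simp [hab]
    · simp [h1]; split_ifs <;> omega
  · have hset : {x | ({tri a b b} : VertexSystem E).join.count x = 1} = {a} := by
      ext x
      simp only [Set.mem_ofPred_eq, Set.mem_singleton_iff]
      rw [hcount]
      by_cases h1 : x = a
      · subst h1; simp [hab]
      · simp [h1]; split_ifs <;> omega
    rw [hset, Set.ncard_singleton]

open Classical in
theorem exists_notMem [Infinite E] (J : Multiset E) : ∃ a, a ∉ J := by
  obtain ⟨a, ha⟩ := Infinite.exists_notMem_finset J.toFinset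
  exact ⟨a, by simpa using ha⟩

theorem exists_three (E : Type) [Infinite E] : ∃ a b c : E, a ≠ b ∧ a ≠ c ∧ b ≠ c := by
  obtain ⟨a, -⟩ := exists_notMem (0 : Multiset E)
  obtain ⟨b, hb⟩ := exists_notMem ({a} : Multiset E)
  obtain ⟨c, hc⟩ := exists_notMem ({a, b} : Multiset E)
  simp only [Multiset.insert_eq_cons, Multiset.mem_cons, Multiset.mem_singleton, not_or] at hb hc
  exact ⟨a, b, c, Ne.symm hb, Ne.symm hc.1, Ne.symm hc.2⟩

open Classical in
/-- The caterpillar: growing a tree always at its newest leaf creates no new ends but the last. -/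
theorem exists_few_ends_tree [Infinite E] (q : ℕ) :
    ∃ S : VertexSystem E, S.IsMarked 0 (q + 3) ∧ S.ends ≤ 2 := by
  suffices H : ∃ (S : VertexSystem E) (r : E), S.IsMarked 0 (q + 3) ∧ S.join.count r = 1 ∧
      S.endsOff r ≤ 1 by
    obtain ⟨S, r, hS, hr, hle⟩ := H
    exact ⟨S, hS, (ends_le_endsOff S r hr).trans (by omega)⟩
  induction q with
  | zero =>
    obtain ⟨a, b, c, hab, hac, hbc⟩ := exists_three E
    refine ⟨{tri a b c}, a, isMarked_singleton_tri hab hac hbc, ?_, ?_⟩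
    · simp [tri, hab, hac]
    · refine (Multiset.countP_le_card _ _).trans ?_
      simp
  | succ q ih =>
    obtain ⟨S, r, hS, hr, hle⟩ := ih
    obtain ⟨a, ha⟩ := exists_notMem S.join
    obtain ⟨b, hb⟩ := exists_notMem (a ::ₘ S.join)
    rw [Multiset.mem_cons, not_or] at hb
    have hrJ : r ∈ S.join := Multiset.one_le_count_iff_mem.1 hr.ge
    have hra : r ≠ a := by rintro rfl; exact ha hrJ
    have hrb : r ≠ b := by rintro rfl; exact hb.2 hrJ
    have ha0 := Multiset.count_eq_zero.2 ha
    have hcount := count_join_cons_tri S r a b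
    refine ⟨tri r a b ::ₘ S, a, hS.attach_tri hr ha hb.2 (Ne.symm hb.1), ?_, ?_⟩
    · rw [hcount, ha0, if_neg hra.symm, if_pos rfl, if_neg (Ne.symm hb.1)]
    · rw [endsOff, Multiset.countP_cons, if_neg]
      · refine le_trans (countP_le_countP ?_) hle
        rintro v hv ⟨x, y, z, rfl, h⟩
        refine ⟨x, y, z, rfl, h.imp_right ?_⟩
        have key : ∀ w ∈ tri x y z, (tri r a b ::ₘ S).join.count w = 1 →
            S.join.count w = 1 ∧ w ≠ r := by
          intro w hw h1
          have h2 := Multiset.one_le_count_iff_mem.2 (Multiset.mem_join.2 ⟨_, hv, hw⟩)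
          rw [hcount] at h1
          refine ⟨by omega, ?_⟩
          rintro rfl
          rw [if_pos rfl] at h1
          omega
        rintro ⟨h1, h2, -, -⟩
        exact ⟨(key x (by simp) h1).1, (key y (by simp) h2).1, (key x (by simp) h1).2,
          (key y (by simp) h2).2⟩
      · -- of the names `r`, `a`, `b` only `b` is plain and different from `a`
        rintro ⟨x, y, z, h1, h2⟩
        have hb1 : ∀ w ∈ tri x y z, (tri r a b ::ₘ S).join.count w = 1 → w ≠ a → w = b := by
          intro w hw h3 h4
          rw [← h1, mem_tri] at hw
          rcases hw with rfl | rfl | rfl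
          · rw [hcount, if_pos rfl] at h3; omega
          · exact absurd rfl h4
          · rfl
        have hxy : x = y := by
          rcases h2 with h2 | ⟨h2, h3, h4, h5⟩
          · exact h2
          · rw [hb1 x (by simp) h2 h4, hb1 y (by simp) h3 h5]
        subst hxy
        have hnd : (tri r a b).Nodup := by simp [tri, hra, hrb, Ne.symm hb.1]
        rw [h1] at hnd
        simp [tri] at hnd

open Classical in
/-- Graphs to which ornaments (a loop on a stalk, or two plain edges on a stalk) are attached
successively, each time at the newest plain edge of the spine. -/
theorem exists_many_ends_odd [Infinite E] (g k : ℕ) (hgk : 1 ≤ g + k) :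
    ∃ (S : VertexSystem E) (r : E), S.IsMarked g (2 * k + 1) ∧ S.join.count r = 1 ∧
      g + k ≤ S.endsOff r := by
  -- attaching one more ornament
  have attach : ∀ (S : VertexSystem E) (r : E) (g k : ℕ), S.IsMarked g (2 * k + 1) →
      S.join.count r = 1 → ∃ (a z : E) (T : VertexSystem E), T.IsMarked g (2 * k + 2) ∧
        T.join.count a = 1 ∧ T.join.count z = 1 ∧ a ≠ z ∧ ∀ (b c : E), b ∉ T.join → c ∉ T.join →
        (b = c ∨ b ≠ c) → (tri z b c ::ₘ T).join.count a = 1 ∧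
        S.endsOff r + 1 ≤ VertexSystem.endsOff (tri z b c ::ₘ T) a := by
    intro S r g k hS hr
    obtain ⟨a, ha⟩ := exists_notMem S.join
    obtain ⟨z, hz⟩ := exists_notMem (a ::ₘ S.join)
    rw [Multiset.mem_cons, not_or] at hz
    have hrJ : r ∈ S.join := Multiset.one_le_count_iff_mem.1 hr.ge
    have hra : r ≠ a := by rintro rfl; exact ha hrJ
    have hrz : r ≠ z := by rintro rfl; exact hz.2 hrJ
    have ha0 := Multiset.count_eq_zero.2 ha
    have hz0 := Multiset.count_eq_zero.2 hz.2
    have hcount := count_join_cons_tri S r a z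
    have haT : (tri r a z ::ₘ S).join.count a = 1 := by
      rw [hcount, ha0, if_neg hra.symm, if_pos rfl, if_neg (Ne.symm hz.1)]
    have hzT : (tri r a z ::ₘ S).join.count z = 1 := by
      rw [hcount, hz0, if_neg hrz.symm, if_neg hz.1, if_pos rfl]
    refine ⟨a, z, tri r a z ::ₘ S, hS.attach_tri hr ha hz.2 (Ne.symm hz.1), haT, hzT, Ne.symm hz.1,
      fun b c hb hc hbc => ?_⟩
    have hcount' := count_join_cons_tri (tri r a z ::ₘ S) z b c
    have hb0 := Multiset.count_eq_zero.2 hb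
    have hc0 := Multiset.count_eq_zero.2 hc
    have hab : a ≠ b := by rintro rfl; omega
    have hac : a ≠ c := by rintro rfl; omega
    have hzb : z ≠ b := by rintro rfl; omega
    have hzc : z ≠ c := by rintro rfl; omega
    refine ⟨by rw [hcount', haT, if_neg (Ne.symm hz.1), if_neg hab, if_neg hac], ?_⟩
    rw [endsOff, endsOff, Multiset.countP_cons, if_pos, Multiset.countP_cons]
    · refine Nat.succ_le_succ (le_trans (countP_le_countP ?_) (Nat.le_add_right _ _))
      rintro v hv ⟨x, y, t, rfl, h⟩
      refine ⟨x, y, t, rfl, h.imp_right ?_⟩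
      have key : ∀ w ∈ tri x y t, S.join.count w = 1 → w ≠ r →
          (tri z b c ::ₘ tri r a z ::ₘ S).join.count w = 1 ∧ w ≠ a := by
        intro w hw h1 h2
        have hwJ : w ∈ S.join := Multiset.mem_join.2 ⟨_, hv, hw⟩
        have h3 : w ≠ a := by rintro rfl; exact ha hwJ
        have h4 : w ≠ z := by rintro rfl; exact hz.2 hwJ
        have h5 : (tri r a z ::ₘ S).join.count w = 1 := by
          rw [hcount, h1, if_neg h2, if_neg h3, if_neg h4]
        have h6 : w ≠ b := by rintro rfl; omega
        have h7 : w ≠ c := by rintro rfl; omega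
        exact ⟨by rw [hcount', h5, if_neg h4, if_neg h6, if_neg h7], h3⟩
      rintro ⟨h1, h2, h3, h4⟩
      exact ⟨(key x (by simp) h1 h3).1, (key y (by simp) h2 h4).1, (key x (by simp) h1 h3).2,
        (key y (by simp) h2 h4).2⟩
    · refine ⟨b, c, z, tri_rotate z b c, hbc.imp_right fun hne => ⟨?_, ?_, hab.symm, hac.symm⟩⟩
      · rw [hcount', hb0, if_neg hzb.symm, if_pos rfl, if_neg hne]
      · rw [hcount', hc0, if_neg hzc.symm, if_neg hne.symm, if_pos rfl]
  have addLoop : ∀ (S : VertexSystem E) (r : E) (g k m : ℕ), S.IsMarked g (2 * k + 1) →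
      S.join.count r = 1 → m ≤ S.endsOff r → ∃ (S' : VertexSystem E) (r' : E),
      S'.IsMarked (g + 1) (2 * k + 1) ∧ S'.join.count r' = 1 ∧ m + 1 ≤ S'.endsOff r' := by
    intro S r g k m hS hr hm
    obtain ⟨a, z, T, hT, -, hz, -, h⟩ := attach S r g k hS hr
    obtain ⟨b, hb⟩ := exists_notMem T.join
    obtain ⟨h1, h2⟩ := h b b hb hb (.inl rfl)
    exact ⟨_, a, hT.attach_loop hz hb, h1, by omega⟩
  have addTwo : ∀ (S : VertexSystem E) (r : E) (g k m : ℕ), S.IsMarked g (2 * k + 1) →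
      S.join.count r = 1 → m ≤ S.endsOff r → ∃ (S' : VertexSystem E) (r' : E),
      S'.IsMarked g (2 * (k + 1) + 1) ∧ S'.join.count r' = 1 ∧ m + 1 ≤ S'.endsOff r' := by
    intro S r g k m hS hr hm
    obtain ⟨a, z, T, hT, -, hz, -, h⟩ := attach S r g k hS hr
    obtain ⟨b, hb⟩ := exists_notMem T.join
    obtain ⟨c, hc⟩ := exists_notMem (b ::ₘ T.join)
    rw [Multiset.mem_cons, not_or] at hc
    obtain ⟨h1, h2⟩ := h b c hb hc.2 (.inr (Ne.symm hc.1))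
    exact ⟨_, a, hT.attach_tri hz hb hc.2 (Ne.symm hc.1), h1, by omega⟩
  induction g with
  | zero =>
    induction k with
    | zero => omega
    | succ k ih =>
      rcases Nat.eq_zero_or_pos k with rfl | hk
      · obtain ⟨a, b, c, hab, hac, hbc⟩ := exists_three E
        refine ⟨{tri a b c}, c, isMarked_singleton_tri hab hac hbc, ?_, ?_⟩
        · simp [tri, hac.symm, hbc.symm]
        · refine Multiset.countP_pos.2 ⟨_, Multiset.mem_singleton_self _, a, b, c, rfl, .inr ?_⟩
          simp [tri, hab, hac, hbc, hab.symm]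
      · obtain ⟨S, r, h1, h2, h3⟩ := ih (by omega)
        exact addTwo S r 0 k _ h1 h2 h3
  | succ g ih =>
    rcases Nat.eq_zero_or_pos (g + k) with h0 | h0
    · obtain ⟨rfl, rfl⟩ : g = 0 ∧ k = 0 := by omega
      obtain ⟨a, b, c, hab, hac, hbc⟩ := exists_three E
      refine ⟨{tri a b b}, a, isMarked_singleton_loop hab, ?_, ?_⟩
      · simp [tri, hab]
      · refine Multiset.countP_pos.2 ⟨_, Multiset.mem_singleton_self _, b, b, a, ?_, .inl rfl⟩
        exact tri_rotate a b b
    · obtain ⟨S, r, h1, h2, h3⟩ := ih h0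
      obtain ⟨S', r', h4, h5, h6⟩ := addLoop S r g k _ h1 h2 h3
      exact ⟨S', r', h4, h5, by omega⟩

open Classical in
/-- There are graphs with a loop for each unit of rank and an end for each pair of plain edges. -/
theorem exists_many_ends [Infinite E] (g p : ℕ) (hgp : 2 < 2 * g + p) :
    ∃ S : VertexSystem E, S.IsMarked g p ∧ g + p / 2 ≤ S.ends := by
  have attach_ends : ∀ (S : VertexSystem E) (r a b : E), S.join.count r = 1 → a ∉ S.join →
      b ∉ S.join → (a = b ∨ a ≠ b) → S.endsOff r + 1 ≤ ends (tri r a b ::ₘ S) := by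
    intro S r a b hr ha hb hab
    have hrJ : r ∈ S.join := Multiset.one_le_count_iff_mem.1 hr.ge
    have hra : a ≠ r := by rintro rfl; exact ha hrJ
    have hrb : b ≠ r := by rintro rfl; exact hb hrJ
    have hcount := count_join_cons_tri S r a b
    rw [endsOff, ends, Multiset.countP_cons, if_pos]
    · refine Nat.succ_le_succ (countP_le_countP ?_)
      rintro v hv ⟨x, y, z, rfl, h⟩
      refine ⟨x, y, z, rfl, h.imp_right ?_⟩
      have key : ∀ w ∈ tri x y z, S.join.count w = 1 → w ≠ r →
          (tri r a b ::ₘ S).join.count w = 1 := by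
        intro w hw h1 h2
        have hwJ : w ∈ S.join := Multiset.mem_join.2 ⟨_, hv, hw⟩
        have h3 : w ≠ a := by rintro rfl; exact ha hwJ
        have h4 : w ≠ b := by rintro rfl; exact hb hwJ
        rw [hcount, h1, if_neg h2, if_neg h3, if_neg h4]
      rintro ⟨h1, h2, h3, h4⟩
      exact ⟨key x (by simp) h1 h3, key y (by simp) h2 h4⟩
    · refine ⟨a, b, r, tri_rotate r a b, hab.imp_right fun hne => ⟨?_, ?_⟩⟩
      · rw [hcount, Multiset.count_eq_zero.2 ha, if_neg hra, if_pos rfl, if_neg hne]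
      · rw [hcount, Multiset.count_eq_zero.2 hb, if_neg hrb, if_neg hne.symm, if_pos rfl]
  obtain ⟨k, rfl | rfl⟩ := Nat.even_or_odd' p
  · rcases Nat.eq_zero_or_pos k with rfl | hk
    · -- without plain edges, a loop is attached to the last plain edge
      obtain ⟨g, rfl⟩ : ∃ g', g = g' + 1 := ⟨g - 1, by omega⟩
      obtain ⟨S, r, hS, hr, hle⟩ := exists_many_ends_odd (E := E) g 0 (by omega)
      obtain ⟨a, ha⟩ := exists_notMem S.join
      refine ⟨_, hS.attach_loop hr ha, ?_⟩
      have := attach_ends S r a a hr ha ha (.inl rfl)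
      omega
    · -- the last plain edge becomes an end with two plain edges
      obtain ⟨k, rfl⟩ : ∃ k', k = k' + 1 := ⟨k - 1, by omega⟩
      obtain ⟨S, r, hS, hr, hle⟩ := exists_many_ends_odd (E := E) g k (by omega)
      obtain ⟨a, ha⟩ := exists_notMem S.join
      obtain ⟨b, hb⟩ := exists_notMem (a ::ₘ S.join)
      rw [Multiset.mem_cons, not_or] at hb
      refine ⟨_, hS.attach_tri hr ha hb.2 (Ne.symm hb.1), ?_⟩
      have := attach_ends S r a b hr ha hb.2 (.inr (Ne.symm hb.1))
      omega
  · obtain ⟨S, r, hS, -, hle⟩ := exists_many_ends_odd (E := E) g k (by omega)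
    exact ⟨S, hS, by have := endsOff_le_ends S r; omega⟩

end VertexSystem

/-! ### Cycles with chords and plain edges -/

namespace VertexSystem

variable {E F : Type} {W : Type} [Fintype W]

theorem card_filter_ofFun [DecidableEq E] (ν : W → Fin 3 → E) (x : E) :
    (Finset.univ.filter fun q : W × Fin 3 => ν q.1 q.2 = x).card =
      (∑ w, if ν w 0 = x then 1 else 0) + (∑ w, if ν w 1 = x then 1 else 0) +
        ∑ w, if ν w 2 = x then 1 else 0 := by
  rw [Finset.card_filter, Fintype.sum_prod_type, ← Finset.sum_add_distrib,
    ← Finset.sum_add_distrib]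
  exact Finset.sum_congr rfl fun w _ => Fin.sum_univ_three _

/-- The cycle of length `k + m`, each vertex of which carries one more edge. These `k + m` edges
are numbered so that the first `k` of them are joined to the last `m` ones according to `j`; the
unused ones among the latter are plain. -/
def cycleFun {k m : ℕ} (j : Fin k → Fin m) (v : Fin (k + m)) : Fin 3 → Fin (k + m) ⊕ Fin m :=
  ![.inl v, .inl (finRotate _ v), .inr (Sum.elim j id (finSumFinEquiv.symm v))]

variable {k m : ℕ} (j : Fin k → Fin m)

@[simp] theorem cycleFun_zero (v : Fin (k + m)) : cycleFun j v 0 = .inl v := rfl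
@[simp] theorem cycleFun_one (v : Fin (k + m)) : cycleFun j v 1 = .inl (finRotate _ v) := rfl
@[simp] theorem cycleFun_two (v : Fin (k + m)) :
    cycleFun j v 2 = .inr (Sum.elim j id (finSumFinEquiv.symm v)) := rfl

theorem count_cycle_inl [DecidableEq (Fin (k + m) ⊕ Fin m)] (v : Fin (k + m)) :
    (ofFun (cycleFun j)).join.count (.inl v) = 2 := by
  rw [count_join_ofFun, card_filter_ofFun]
  have h1 : ∀ w, (finRotate (k + m) w = v) ↔ w = (finRotate (k + m)).symm v := fun w =>
    (Equiv.eq_symm_apply _).symm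
  simp [h1, -finRotate_apply]

theorem count_cycle_inr [DecidableEq (Fin (k + m) ⊕ Fin m)] (u : Fin m) :
    (ofFun (cycleFun j)).join.count (.inr u) = (Finset.univ.filter fun a => j a = u).card + 1 := by
  rw [count_join_ofFun, card_filter_ofFun,
    ← (finSumFinEquiv (m := k) (n := m)).sum_comp fun w => if cycleFun j w 2 = .inr u then 1 else 0,
    Fintype.sum_sum_type]
  simp

/-- A property of the elements of `Fin n` that is invariant under rotation holds for all of them or
for none. -/
theorem forall_or_forall_not_of_rotate {n : ℕ} {P : Fin n → Prop}
    (h : ∀ v, P v ↔ P (finRotate n v)) : (∀ v, P v) ∨ ∀ v, ¬ P v := by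
  obtain _ | n := n
  · exact .inl fun v => v.elim0
  · have key : ∀ v, P v ↔ P 0 := by
      intro v
      induction v using Fin.induction with
      | zero => rfl
      | succ i ih =>
        rw [← ih, h i.castSucc, finRotate_apply, Fin.coeSucc_eq_succ]
    by_cases h0 : P 0
    · exact .inl fun v => (key v).2 h0
    · exact .inr fun v hv => h0 ((key v).1 hv)

theorem ne_finRotate {n : ℕ} (hn : 2 ≤ n) (v : Fin n) : v ≠ finRotate n v := by
  obtain ⟨n, rfl⟩ : ∃ l, n = l + 2 := ⟨n - 2, by omega⟩
  rw [finRotate_apply]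
  simp

/-- A cycle with `k` chords has rank `k + 1`; of the `k + p` edges that can be chosen as partners,
`p` are left plain. -/
theorem isMarked_cycle {p : ℕ} (hm : m = k + p) (hj : Function.Injective j) :
    (ofFun (cycleFun j)).IsMarked (k + 1) p := by
  classical
  have hfib : ∀ u, (Finset.univ.filter fun a => j a = u).card =
      if u ∈ Set.range j then 1 else 0 := by
    intro u
    split_ifs with h
    · obtain ⟨a, rfl⟩ := h
      rw [Finset.card_eq_one]
      exact ⟨a, by ext b; simp [hj.eq_iff]⟩
    · rw [Finset.card_eq_zero, Finset.filter_eq_empty_iff]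
      exact fun a _ ha => h ⟨a, ha⟩
  refine ⟨conn_ofFun.2 fun N hN => ?_, fun v => card_of_mem_ofFun, fun x => ?_, ?_, ?_⟩
  · have h1 : ∀ v, (Sum.inl v ∈ N ↔ ∀ i, cycleFun j v i ∈ N) ∧
        (Sum.inl (finRotate _ v) ∈ N ↔ ∀ i, cycleFun j v i ∈ N) := by
      intro v
      rcases hN v with h | h
      · exact ⟨iff_of_true (h 0) h, iff_of_true (h 1) h⟩
      · exact ⟨iff_of_false (h 0) fun h' => h 0 (h' 0), iff_of_false (h 1) fun h' => h 0 (h' 0)⟩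
    rcases forall_or_forall_not_of_rotate (P := fun v => Sum.inl v ∈ N)
      fun v => (h1 v).1.trans (h1 v).2.symm with h | h
    · exact .inl fun v => (h1 v).1.1 (h v)
    · exact .inr fun v => (hN v).resolve_left fun h' => h v (h' 0)
  · rcases x with v | u
    · rw [count_cycle_inl]
    · rw [count_cycle_inr, hfib]
      split_ifs <;> omega
  · rw [card_ofFun, Fintype.card_fin]
    omega
  · have hset : {x | (ofFun (cycleFun j)).join.count x = 1} = Sum.inr '' (Set.range j)ᶜ := by
      ext x
      rcases x with v | u
      · simp only [Set.mem_ofPred_eq, count_cycle_inl]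
        simp
      · simp only [Set.mem_ofPred_eq, count_cycle_inr, hfib]
        simp
    have h1 : (Set.range j).ncard = k := by
      rw [← Set.image_univ, hj.injOn.ncard_image, Set.ncard_univ, Nat.card_fin]
    have h2 := Set.ncard_add_ncard_compl (Set.range j)
    rw [Nat.card_fin] at h2
    have h3 := congrArg Set.ncard hset
    rw [Sum.inr_injective.injOn.ncard_image] at h3
    refine Eq.trans ?_ (h3.trans (by omega : _ = p))
    congr! with x

/-- In a cycle of length at least two, no vertex is an end. -/
theorem ends_cycle (hkm : 2 ≤ k + m) : (ofFun (cycleFun j)).ends = 0 := by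
  classical
  rw [ends, Multiset.countP_eq_zero]
  rintro v hv ⟨x, y, z, rfl, h⟩
  obtain ⟨w, -, hw⟩ := Multiset.mem_map.1 hv
  rw [cycleFun_zero, cycleFun_one, cycleFun_two] at hw
  have hne := ne_finRotate hkm w
  have hnd : (tri x y z).Nodup := by
    rw [← hw]
    simp [tri, hne, -finRotate_apply]
  have hplain : ∀ u ∈ tri x y z, (∀ [DecidableEq (Fin (k + m) ⊕ Fin m)],
      (ofFun (cycleFun j)).join.count u = 1) →
        u = .inr (Sum.elim j id (finSumFinEquiv.symm w)) := by
    intro u hu h1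
    rw [← hw, mem_tri] at hu
    rcases hu with rfl | rfl | rfl
    · have := h1.symm.trans (count_cycle_inl j w); omega
    · have := h1.symm.trans (count_cycle_inl j _); omega
    · rfl
  have hxy : x = y := by
    rcases h with h | ⟨h1, h2⟩
    · exact h
    · rw [hplain x (by simp) (by intro; convert h1), hplain y (by simp) (by intro; convert h2)]
  subst hxy
  simp [tri] at hnd

/-! ### How often a graph occurs among the cycles with chords -/

/-- Two systems of indexed vertices that are renamings of each other correspond under an injection
of vertices and injections of the half-edges at each vertex. -/
theorem Renaming.exists_maps {ν : W → Fin 3 → E} {ν' : W → Fin 3 → F}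
    (h : Renaming (ofFun ν) (ofFun ν')) : ∃ (f : E → F) (ψ : W → W) (σ : W → Fin 3 → Fin 3),
      Set.InjOn f {x | x ∈ (ofFun ν).join} ∧ Function.Injective ψ ∧
      (∀ w, Function.Injective (σ w)) ∧ ∀ w i, ν' (ψ w) (σ w i) = f (ν w i) := by
  obtain ⟨f, hf, h⟩ := h
  have h1 : (Finset.univ : Finset W).val.map (fun w => tri (f (ν w 0)) (f (ν w 1)) (f (ν w 2))) =
      (Finset.univ : Finset W).val.map (fun w => tri (ν' w 0) (ν' w 1) (ν' w 2)) := by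
    rw [← ofFun, h, ofFun, Multiset.map_map]
    rfl
  obtain ⟨e, he⟩ := FinMultigraph.exists_equiv_of_map_val_eq h1
  have h2 : ∀ w, ∃ s : (Finset.univ : Finset (Fin 3)) ≃ (Finset.univ : Finset (Fin 3)),
      ∀ i, ν' (e ⟨w, Finset.mem_univ w⟩) (s i) = f (ν w i) := by
    intro w
    refine FinMultigraph.exists_equiv_of_map_val_eq
      (f := fun i => f (ν w i)) (f' := fun i => ν' (e ⟨w, Finset.mem_univ w⟩) i) ?_
    rw [map_univ_eq_tri, map_univ_eq_tri]
    exact (he ⟨w, Finset.mem_univ w⟩).symm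
  choose s hs using h2
  refine ⟨f, fun w => e ⟨w, Finset.mem_univ w⟩, fun w i => s w ⟨i, Finset.mem_univ i⟩, hf, ?_, ?_,
    fun w i => hs w ⟨i, Finset.mem_univ i⟩⟩
  · intro v w hvw
    exact congrArg Subtype.val (e.injective (Subtype.ext hvw))
  · intro w i i' hii
    exact congrArg Subtype.val ((s w).injective (Subtype.ext hii))

open Classical in
/-- A half-edge has at most one opposite half-edge. -/
theorem eq_of_count_le_two {ν : W → Fin 3 → E} (h2 : ∀ x, (ofFun ν).join.count x ≤ 2)
    {q q' q'' : W × Fin 3} (h' : ν q'.1 q'.2 = ν q.1 q.2) (h'' : ν q''.1 q''.2 = ν q.1 q.2)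
    (hne' : q' ≠ q) (hne'' : q'' ≠ q) : q' = q'' := by
  by_contra hne
  have h3 := h2 (ν q.1 q.2)
  rw [count_join_ofFun] at h3
  have h4 : ({q, q', q''} : Finset (W × Fin 3)) ⊆
      Finset.univ.filter fun r : W × Fin 3 => ν r.1 r.2 = ν q.1 q.2 := by
    intro r hr
    simp only [Finset.mem_insert, Finset.mem_singleton] at hr
    rcases hr with rfl | rfl | rfl <;> simp [h', h'']
  have h5 := Finset.card_le_card h4
  rw [Finset.card_eq_three.2 ⟨q, q', q'', hne'.symm, hne''.symm, hne, rfl⟩] at h5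
  omega

open Classical in
/-- A renaming of a cycle with chords is determined by the image of one vertex and by its effect
on the three half-edges at each vertex: the images of the other vertices are found by walking
along the cycle. -/
theorem cycle_eq_of_maps {ν : Fin (k + m) → Fin 3 → E} (h2 : ∀ x, (ofFun ν).join.count x ≤ 2)
    {j₁ j₂ : Fin k → Fin m} {f₁ f₂ : Fin (k + m) ⊕ Fin m → E} {ψ₁ ψ₂ : Fin (k + m) → Fin (k + m)}
    {σ : Fin (k + m) → Fin 3 → Fin 3} (hf₂ : Set.InjOn f₂ {x | x ∈ (ofFun (cycleFun j₂)).join})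
    (hσ : ∀ w, Function.Injective (σ w))
    (hψ₁ : Function.Injective ψ₁) (hψ₂ : Function.Injective ψ₂)
    (h₁ : ∀ w i, ν (ψ₁ w) (σ w i) = f₁ (cycleFun j₁ w i))
    (h₂ : ∀ w i, ν (ψ₂ w) (σ w i) = f₂ (cycleFun j₂ w i)) {v₀ : Fin (k + m)}
    (h₀ : ψ₁ v₀ = ψ₂ v₀) : j₁ = j₂ := by
  have hstep : ∀ v, ψ₁ v = ψ₂ v ↔ ψ₁ (finRotate _ v) = ψ₂ (finRotate _ v) := by
    have hinj : ∀ {ψ : Fin (k + m) → Fin (k + m)}, Function.Injective ψ → ∀ v,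
        (ψ (finRotate _ v), σ (finRotate _ v) 0) ≠ (ψ v, σ v 1) := by
      intro ψ hψ v h
      rw [Prod.mk.injEq] at h
      have h3 := hψ h.1
      rw [h3] at h
      exact absurd (hσ _ h.2) (by decide)
    intro v
    have e₁ : ν (ψ₁ (finRotate _ v)) (σ (finRotate _ v) 0) = ν (ψ₁ v) (σ v 1) := by
      rw [h₁, h₁]; rfl
    have e₂ : ν (ψ₂ (finRotate _ v)) (σ (finRotate _ v) 0) = ν (ψ₂ v) (σ v 1) := by
      rw [h₂, h₂]; rfl
    constructor
    · intro h
      have := eq_of_count_le_two h2 (q := (ψ₁ v, σ v 1))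
        (q' := (ψ₁ (finRotate _ v), σ (finRotate _ v) 0))
        (q'' := (ψ₂ (finRotate _ v), σ (finRotate _ v) 0)) e₁ (by rw [h]; exact e₂)
        (hinj hψ₁ v) (by rw [h]; exact hinj hψ₂ v)
      exact congrArg Prod.fst this
    · intro h
      have := eq_of_count_le_two h2 (q := (ψ₁ (finRotate _ v), σ (finRotate _ v) 0))
        (q' := (ψ₁ v, σ v 1)) (q'' := (ψ₂ v, σ v 1)) e₁.symm (by rw [h]; exact e₂.symm)
        (hinj hψ₁ v).symm (by rw [h]; exact (hinj hψ₂ v).symm)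
      exact congrArg Prod.fst this
  have hψ : ∀ v, ψ₁ v = ψ₂ v :=
    (forall_or_forall_not_of_rotate hstep).resolve_right fun h => h v₀ h₀
  funext a
  have hmem : ∀ v i, cycleFun j₂ v i ∈ (ofFun (cycleFun j₂)).join := fun v i =>
    mem_join_ofFun.2 ⟨v, i, rfl⟩
  have e₁ : cycleFun j₁ (finSumFinEquiv (.inl a)) 2 =
      cycleFun j₁ (finSumFinEquiv (.inr (j₁ a))) 2 := by
    simp
  have e₂ : f₂ (cycleFun j₂ (finSumFinEquiv (.inl a)) 2) =
      f₂ (cycleFun j₂ (finSumFinEquiv (.inr (j₁ a))) 2) := by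
    rw [← h₂, ← h₂, ← hψ, ← hψ, h₁, h₁, e₁]
  have e₃ := hf₂ (hmem _ _) (hmem _ _) e₂
  simpa using e₃.symm

end VertexSystem

/-! ### Words in place of tuples of lists -/

namespace VertexSystem

/-- The lists are written one after the other, each followed by the separator `none`. -/
def flattenLists {A : Type} : List (List A) → List (Option A)
  | [] => []
  | l :: ls => l.map some ++ none :: flattenLists ls

theorem length_flattenLists {A : Type} (ls : List (List A)) :
    (flattenLists ls).length = ls.length + (ls.map List.length).sum := by
  induction ls with
  | nil => rfl
  | cons l ls ih =>
    simp only [flattenLists, List.length_append, List.length_map, List.length_cons, ih,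
      List.map_cons, List.sum_cons]
    omega

theorem map_some_append_none_inj {A : Type} {l l' : List A} {s s' : List (Option A)}
    (h : l.map some ++ none :: s = l'.map some ++ none :: s') : l = l' ∧ s = s' := by
  induction l generalizing l' with
  | nil => cases l' <;> simp_all
  | cons a l ih =>
    cases l' with
    | nil => simp at h
    | cons a' l' =>
      simp only [List.map_cons, List.cons_append, List.cons.injEq, Option.some.injEq] at h
      obtain ⟨rfl, rfl⟩ := ih h.2 |>.imp_left fun e => e
      simp [h.1]

theorem flattenLists_append_inj {A : Type} {ls ls' : List (List A)} {s s' : List (Option A)}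
    (hlen : ls.length = ls'.length) (h : flattenLists ls ++ s = flattenLists ls' ++ s') :
    ls = ls' := by
  induction ls generalizing ls' with
  | nil => exact (List.length_eq_zero_iff.1 hlen.symm).symm
  | cons l ls ih =>
    cases ls' with
    | nil => simp at hlen
    | cons l' ls' =>
      simp only [flattenLists, List.append_assoc, List.cons_append] at h
      obtain ⟨rfl, h2⟩ := map_some_append_none_inj h
      rw [ih (by simpa using hlen) h2]

/-- Tuples of `n` lists of total length at most `M` are determined by words of length `n + M`. -/
theorem exists_decoding (A : Type) (n M : ℕ) :
    ∃ dec : List.Vector (Option A) (n + M) → Fin n → List A,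
      ∀ L : Fin n → List A, ∑ v, (L v).length ≤ M → ∃ c, dec c = L := by
  have hlen : ∀ L : {L : Fin n → List A // ∑ v, (L v).length ≤ M},
      (flattenLists (List.ofFn L.1)).length = n + ∑ v, (L.1 v).length := by
    intro L
    rw [length_flattenLists, List.length_ofFn, List.map_ofFn, List.sum_ofFn]
    rfl
  let enc : {L : Fin n → List A // ∑ v, (L v).length ≤ M} → List.Vector (Option A) (n + M) :=
    fun L => ⟨flattenLists (List.ofFn L.1) ++ List.replicate (M - ∑ v, (L.1 v).length) none, by
      have := L.2
      rw [List.length_append, hlen, List.length_replicate]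
      omega⟩
  have henc : Function.Injective enc := fun L L' h =>
    Subtype.ext (List.ofFn_injective (flattenLists_append_inj (by simp) (congrArg Subtype.val h)))
  have : Nonempty {L : Fin n → List A // ∑ v, (L v).length ≤ M} := ⟨⟨fun _ => [], by simp⟩⟩
  exact ⟨fun c => (Function.invFun enc c).1, fun L hL =>
    ⟨enc ⟨L, hL⟩, congrArg Subtype.val (Function.leftInverse_invFun henc ⟨L, hL⟩)⟩⟩

/-! ### Sequences of moves as instructions at the vertices -/

variable {E : Type} {W : Type}

/-- Each name is attached to at most two half-edges. -/
def AtMostTwice (ν : W × Fin 3 → E) : Prop :=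
  ∀ q q' q'', ν q' = ν q → ν q'' = ν q → q' ≠ q → q'' ≠ q → q' = q''

theorem AtMostTwice.comp {ν : W × Fin 3 → E} (h : AtMostTwice ν) (e : Equiv.Perm (W × Fin 3)) :
    AtMostTwice (ν ∘ e) := fun _ _ _ h1 h2 h3 h4 =>
  e.injective (h _ _ _ h1 h2 (e.injective.ne h3) (e.injective.ne h4))

open Classical in
/-- A list of instructions is given at each vertex. The instruction `(h, a)` at `v` asks for a
Whitehead move on the edge with half-edge `h` at `v`, moving the half-edge `a`. The move is carried
out when the vertex at the other end of that edge asks for it, too; both instructions are then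
deleted. -/
inductive Execute :
    (W × Fin 3 → E) × (W → List (Fin 3 × Fin 3)) → (W × Fin 3 → E) × (W → List (Fin 3 × Fin 3)) →
      Prop
  | intro {ν : W × Fin 3 → E} {L : W → List (Fin 3 × Fin 3)} {v w : W} {h a k b : Fin 3}
      {l l' : List (Fin 3 × Fin 3)} (hν : AtMostTwice ν) (hvw : v ≠ w) (hv : L v = (h, a) :: l)
      (hw : L w = (k, b) :: l') (hedge : ν (v, h) = ν (w, k)) :
      Execute (ν, L) (ν ∘ Equiv.swap (v, a) (w, b), Function.update (Function.update L v l) w l')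

/-- Two different moves that can be carried out at the same time concern disjoint pairs of vertices,
because a vertex asks for one move at a time. They commute. -/
theorem Execute.diamond {s t t' : (W × Fin 3 → E) × (W → List (Fin 3 × Fin 3))}
    (ht : Execute s t) (ht' : Execute s t') : t = t' ∨ ∃ u, Execute t u ∧ Execute t' u := by
  classical
  obtain @⟨ν, L, v, w, h, a, k, b, l, l', hν, hvw, hv, hw, hedge⟩ := ht
  obtain @⟨_, _, v', w', h', a', k', b', m, m', -, hvw', hv', hw', hedge'⟩ := ht'
  -- if the pairs of vertices meet, then they are the same and so are the moves
  by_cases h1 : v = v'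
  · subst h1
    rw [hv, List.cons.injEq, Prod.mk.injEq] at hv'
    obtain ⟨⟨rfl, rfl⟩, rfl⟩ := hv'
    have := hν (v, h) (w, k) (w', k') hedge.symm hedge'.symm
      (fun e => hvw (congrArg Prod.fst e).symm) (fun e => hvw' (congrArg Prod.fst e).symm)
    rw [Prod.mk.injEq] at this
    obtain ⟨rfl, rfl⟩ := this
    rw [hw, List.cons.injEq, Prod.mk.injEq] at hw'
    obtain ⟨⟨-, rfl⟩, rfl⟩ := hw'
    exact .inl rfl
  by_cases h2 : w = w'
  · subst h2
    rw [hw, List.cons.injEq, Prod.mk.injEq] at hw'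
    obtain ⟨⟨rfl, rfl⟩, rfl⟩ := hw'
    have := hν (w, k) (v, h) (v', h') hedge hedge'
      (fun e => hvw (congrArg Prod.fst e)) (fun e => hvw' (congrArg Prod.fst e))
    exact absurd (congrArg Prod.fst this) h1
  by_cases h3 : v = w'
  · subst h3
    rw [hv, List.cons.injEq, Prod.mk.injEq] at hw'
    obtain ⟨⟨rfl, rfl⟩, rfl⟩ := hw'
    have := hν (v, h) (w, k) (v', h') hedge.symm hedge'
      (fun e => hvw (congrArg Prod.fst e).symm) (fun e => hvw' (congrArg Prod.fst e))
    rw [Prod.mk.injEq] at this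
    obtain ⟨rfl, rfl⟩ := this
    rw [hw, List.cons.injEq, Prod.mk.injEq] at hv'
    obtain ⟨⟨-, rfl⟩, rfl⟩ := hv'
    left
    rw [Equiv.swap_comm, Function.update_comm hvw]
  by_cases h4 : w = v'
  · subst h4
    rw [hw, List.cons.injEq, Prod.mk.injEq] at hv'
    obtain ⟨⟨rfl, rfl⟩, rfl⟩ := hv'
    have := hν (w, k) (v, h) (w', k') hedge hedge'.symm
      (fun e => hvw (congrArg Prod.fst e)) (fun e => hvw' (congrArg Prod.fst e).symm)
    exact absurd (congrArg Prod.fst this) h3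
  right
  have hfix : ∀ {v w u : W} {a b i : Fin 3}, u ≠ v → u ≠ w →
      (ν ∘ Equiv.swap (v, a) (w, b)) (u, i) = ν (u, i) := by
    intro v w u a b i h5 h6
    rw [Function.comp_apply, Equiv.swap_apply_of_ne_of_ne] <;>
      exact fun e => by simp_all [Prod.ext_iff]
  have e1 := Execute.intro (L := Function.update (Function.update L v l) w l') (a := a') (b := b')
    (l := m) (l' := m') (hν.comp (Equiv.swap (v, a) (w, b))) hvw' (h := h') (k := k')
    (by rw [Function.update_of_ne (Ne.symm h4), Function.update_of_ne (Ne.symm h1), hv'])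
    (by rw [Function.update_of_ne (Ne.symm h2), Function.update_of_ne (Ne.symm h3), hw'])
    (by rw [hfix (Ne.symm h1) (Ne.symm h4), hfix (Ne.symm h3) (Ne.symm h2), hedge'])
  have e2 := Execute.intro (L := Function.update (Function.update L v' m) w' m') (a := a) (b := b)
    (l := l) (l' := l') (hν.comp (Equiv.swap (v', a') (w', b'))) hvw (h := h) (k := k)
    (by rw [Function.update_of_ne h3, Function.update_of_ne h1, hv])
    (by rw [Function.update_of_ne h2, Function.update_of_ne h4, hw])
    (by rw [hfix h1 h3, hfix h4 h2, hedge])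
  refine ⟨_, e1, ?_⟩
  convert e2 using 2
  · rw [Function.comp_assoc, Function.comp_assoc]
    congr 1
    rw [← Equiv.Perm.coe_mul, ← Equiv.Perm.coe_mul]
    congr 1
    refine (Equiv.Perm.Disjoint.commute fun q => ?_).eq
    by_cases h5 : q.1 = v ∨ q.1 = w
    · right
      rcases h5 with h5 | h5
      · rw [Equiv.swap_apply_of_ne_of_ne] <;> rintro rfl <;> simp_all
      · rw [Equiv.swap_apply_of_ne_of_ne] <;> rintro rfl <;> simp_all
    · left
      rw [Equiv.swap_apply_of_ne_of_ne] <;> rintro rfl <;> simp_all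
  · funext u
    simp only [Function.update_apply]
    split_ifs <;> simp_all

/-- The result of carrying out all instructions does not depend on the order. -/
theorem Execute.unique {s : (W × Fin 3 → E) × (W → List (Fin 3 × Fin 3))} {ν ν' : W × Fin 3 → E}
    (h : Relation.ReflTransGen Execute s (ν, fun _ => []))
    (h' : Relation.ReflTransGen Execute s (ν', fun _ => [])) : ν = ν' := by
  have hend : ∀ {ν : W × Fin 3 → E} {t}, Relation.ReflTransGen Execute (ν, fun _ => []) t →
      t = (ν, fun _ => []) := by
    intro ν t ht
    refine (Relation.ReflTransGen.cases_head ht).elim Eq.symm ?_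
    rintro ⟨u, hu, -⟩
    cases hu with
    | intro _ _ hv => simp at hv
  obtain ⟨t, h1, h2⟩ := Relation.church_rosser (fun a b c hb hc => by
    rcases hb.diamond hc with rfl | ⟨u, hu, hu'⟩
    · exact ⟨b, .refl, .refl⟩
    · exact ⟨u, .single hu, .single hu'⟩) h h'
  exact congrArg Prod.fst ((hend h1).symm.trans (hend h2))

theorem Steps.exists_head {k : ℕ} {S U : VertexSystem E} (h : Steps (k + 1) S U) :
    ∃ T, Step S T ∧ Steps k T U := by
  generalize hk : k + 1 = l at h
  induction h generalizing k with
  | refl => omega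
  | @tail j S T U h hs ih =>
    obtain rfl : k = j := by omega
    cases k with
    | zero =>
      cases h
      exact ⟨_, hs, .refl _⟩
    | succ k =>
      obtain ⟨T', h1, h2⟩ := ih rfl
      exact ⟨T', h1, h2.tail hs⟩

variable [Fintype W]

open Classical in
/-- A Whitehead step in terms of half-edges. -/
theorem Step.exists_swap {ν : W × Fin 3 → E} {T : VertexSystem E}
    (hT : Step (ofFun (Function.curry ν)) T) : ∃ (v w : W) (h a k b : Fin 3), v ≠ w ∧
      ν (v, h) = ν (w, k) ∧ T = ofFun (Function.curry (ν ∘ Equiv.swap (v, a) (w, b))) := by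
  obtain ⟨e, x, y, z, u, M, hS, rfl⟩ := hT
  obtain ⟨v, s, hs, hv, hM⟩ := FinMultigraph.exists_map_eq_cons hS
  obtain ⟨w, R, rfl, hw, hR⟩ := FinMultigraph.exists_map_eq_cons hM
  have hnd : (v ::ₘ w ::ₘ R).Nodup := hs ▸ Finset.univ.nodup
  simp only [Multiset.nodup_cons, Multiset.mem_cons, not_or] at hnd
  obtain ⟨⟨hvw, hvR⟩, hwR, -⟩ := hnd
  have key : ∀ {v : W} {x y z : E}, tri (ν (v, 0)) (ν (v, 1)) (ν (v, 2)) = tri x y z →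
      ∃ a b c : Fin 3, a ≠ b ∧ a ≠ c ∧ b ≠ c ∧ ν (v, a) = x ∧ ν (v, b) = y ∧ ν (v, c) = z ∧
        ∀ f : Fin 3 → E, tri (f 0) (f 1) (f 2) = tri (f a) (f b) (f c) := by
    intro v x y z h
    rw [← map_univ_eq_tri fun i => ν (v, i)] at h
    obtain ⟨a, b, c, h1, h2, h3, h4⟩ := FinMultigraph.exists_map_eq_tri h
    have hnd : (tri a b c).Nodup := h1 ▸ Finset.univ.nodup
    simp only [tri, Multiset.insert_eq_cons, Multiset.nodup_cons, Multiset.mem_cons,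
      Multiset.mem_singleton, not_or] at hnd
    refine ⟨a, b, c, hnd.1.1, hnd.1.2, hnd.2.1, h2, h3, h4, fun f => ?_⟩
    rw [← map_univ_eq_tri, h1]
    simp [tri]
  obtain ⟨h, c, a, hhc, hha, hca, rfl, rfl, rfl, hf⟩ := key hv
  obtain ⟨k, b, d, hkb, hkd, hbd, h1, rfl, rfl, hf'⟩ := key hw
  refine ⟨v, w, h, a, k, b, hvw, h1.symm, ?_⟩
  have hfix : ∀ q : W × Fin 3, q ≠ (v, a) → q ≠ (w, b) →
      (ν ∘ Equiv.swap (v, a) (w, b)) q = ν q := fun q hq hq' => by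
    rw [Function.comp_apply, Equiv.swap_apply_of_ne_of_ne hq hq']
  rw [ofFun, hs, Multiset.map_cons, Multiset.map_cons, hf, hf', ← hR]
  simp only [Function.curry_apply]
  rw [hfix (v, h) (by simp [hha]) (by simp [hvw]), hfix (v, c) (by simp [hca]) (by simp [hvw]),
    hfix (w, k) (by simp [Ne.symm hvw]) (by simp [hkb]),
    hfix (w, d) (by simp [Ne.symm hvw]) (by simp [hbd.symm])]
  simp only [Function.comp_apply, Equiv.swap_apply_left, Equiv.swap_apply_right, h1]
  congr 2
  refine Multiset.map_congr rfl fun r hr => ?_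
  have h3 : ∀ i, (ν ∘ Equiv.swap (v, a) (w, b)) (r, i) = ν (r, i) := fun i =>
    hfix _ (by rintro ⟨⟩; exact hvR hr) (by rintro ⟨⟩; exact hwR hr)
  simp only [← Function.comp_apply (f := ν), h3]

/-- A sequence of `k` moves is carried out by `2 * k` instructions. -/
theorem Steps.exists_execute {k : ℕ} {ν : W × Fin 3 → E} (hν : AtMostTwice ν) {T : VertexSystem E}
    (hT : Steps k (ofFun (Function.curry ν)) T) :
    ∃ (L : W → List (Fin 3 × Fin 3)) (ν' : W × Fin 3 → E), ∑ v, (L v).length = 2 * k ∧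
      T = ofFun (Function.curry ν') ∧ Relation.ReflTransGen Execute (ν, L) (ν', fun _ => []) := by
  classical
  induction k generalizing ν with
  | zero =>
    cases hT
    exact ⟨fun _ => [], ν, by simp, rfl, .refl⟩
  | succ k ih =>
    obtain ⟨U, hU, hT⟩ := hT.exists_head
    obtain ⟨v, w, h, a, j, b, hvw, hedge, rfl⟩ := hU.exists_swap
    obtain ⟨L, ν', hL, rfl, hex⟩ := ih (hν.comp _) hT
    refine ⟨fun u => if u = v then (h, a) :: L v else if u = w then (j, b) :: L w else L u, ν',
      ?_, rfl, .head ?_ hex⟩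
    · have : ∀ u, (if u = v then (h, a) :: L v else if u = w then (j, b) :: L w else L u).length =
          (L u).length + (if u = v then 1 else 0) + if u = w then 1 else 0 := by
        intro u
        split_ifs <;> simp_all
      simp only [this, Finset.sum_add_distrib, hL]
      simp
      omega
    · convert Execute.intro (L := fun u =>
        if u = v then (h, a) :: L v else if u = w then (j, b) :: L w else L u) hν hvw
        (by simp; exact ⟨rfl, rfl⟩) (by simp [hvw.symm]; exact ⟨rfl, rfl⟩) hedge using 2
      funext u
      simp only [Function.update_apply]
      split_ifs <;> simp_all

open Classical in
/-- At most `10 ^ (n + M)` systems with `n` vertices can be reached from a given one by at most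
`M / 2` moves. -/
theorem exists_code {n M : ℕ} (ν : Fin n → Fin 3 → E) (h2 : ∀ x, (ofFun ν).join.count x ≤ 2) :
    ∃ dec : List.Vector (Option (Fin 3 × Fin 3)) (n + M) → Fin n → Fin 3 → E,
      ∀ k T, 2 * k ≤ M → Steps k (ofFun ν) T → ∃ c, T = ofFun (dec c) := by
  obtain ⟨dec, hdec⟩ := exists_decoding (Fin 3 × Fin 3) n M
  have hν : AtMostTwice (Function.uncurry ν) := fun q q' q'' => eq_of_count_le_two h2
  -- a tuple of lists that cannot be carried out is given the result `ν`
  let run (L : Fin n → List (Fin 3 × Fin 3)) : Fin n → Fin 3 → E :=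
    if h : ∃ ν' : Fin n × Fin 3 → E,
      Relation.ReflTransGen Execute (Function.uncurry ν, L) (ν', fun _ => [])
    then Function.curry h.choose else ν
  refine ⟨fun c => run (dec c), fun k T hk hT => ?_⟩
  obtain ⟨L, ν', hL, rfl, hex⟩ := Steps.exists_execute (ν := Function.uncurry ν) hν hT
  obtain ⟨c, rfl⟩ := hdec L (by omega)
  have h : ∃ ν' : Fin n × Fin 3 → E,
      Relation.ReflTransGen Execute (Function.uncurry ν, dec c) (ν', fun _ => []) := ⟨ν', hex⟩
  refine ⟨c, ?_⟩
  simp only [run]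
  rw [dif_pos h, Execute.unique h.choose_spec hex]

end VertexSystem

/-! ### Lower bounds for the diameter -/

namespace VertexSystem

variable {E : Type}

theorem exists_ofFun_eq {S : VertexSystem E} (hS : ∀ v ∈ S, v.card = 3) :
    ∃ (n : ℕ) (ν : Fin n → Fin 3 → E), ofFun ν = S := by
  induction S using Quotient.inductionOn with | _ l
  have h : ∀ i : Fin l.length, ∃ f : Fin 3 → E, tri (f 0) (f 1) (f 2) = l.get i := by
    intro i
    obtain ⟨x, y, z, h⟩ := Multiset.card_eq_three.1 (hS (l.get i) (List.get_mem l i))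
    exact ⟨![x, y, z], h.symm⟩
  choose ν hν using h
  refine ⟨l.length, ν, ?_⟩
  rw [ofFun, funext hν, Fin.univ_val_map, List.ofFn_get]
  rfl

end VertexSystem

namespace MarkedGraph

open VertexSystem FinMultigraph

variable {E F : Type} {g p : ℕ}

theorem exists_presents (hgp : 2 < 2 * g + p) {S : VertexSystem E} (hS : S.IsMarked g p) :
    ∃ G : MarkedGraph g p, G.Presents S := by
  obtain ⟨n, ν, rfl⟩ := exists_ofFun_eq hS.card_vertex
  exact exists_presents_ofFun ν hS hgp

theorem ediam_ne_top (hgp : 2 < 2 * g + p) : (whiteheadGraph g p).ediam ≠ ⊤ :=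
  ne_top_of_le_ne_top (ENat.natCast_ne_top _) (SimpleGraph.ediam_le_of_edist_le (edist_le hgp))

theorem whiteheadGraph_connected (hgp : 2 < 2 * g + p) : (whiteheadGraph g p).Connected := by
  obtain ⟨S, hS, -⟩ := exists_many_ends (E := ℕ) g p hgp
  obtain ⟨G, -⟩ := exists_presents hgp hS
  have : Nonempty (GraphSpace g p) := ⟨G.cls⟩
  exact SimpleGraph.connected_of_ediam_ne_top (ediam_ne_top hgp)

theorem diam_le (hgp : 2 < 2 * g + p) : (whiteheadGraph g p).diam ≤
    2 * (2 * (2 * g + p) + g * (2 * Nat.clog 2 (2 * g + p) + 3) + (p + 2)) :=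
  ENat.toNat_le_of_le_natCast (SimpleGraph.ediam_le_of_edist_le (edist_le hgp))

/-- Of two graphs, any vertex system of the first one is at most the diameter away from some vertex
system of the second one. -/
theorem exists_steps (hgp : 2 < 2 * g + p) {S : VertexSystem E} {S' : VertexSystem F}
    (hS : S.IsMarked g p) (hS' : S'.IsMarked g p) :
    ∃ (k : ℕ) (T : VertexSystem E), k ≤ (whiteheadGraph g p).diam ∧ Steps k S T ∧
      Renaming S' T := by
  obtain ⟨G, hG⟩ := exists_presents hgp hS
  obtain ⟨G', hG'⟩ := exists_presents hgp hS'
  have : Nonempty E := by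
    by_contra h
    rw [not_nonempty_iff] at h
    have h1 := hS.card
    obtain ⟨v, hv⟩ := Multiset.card_pos_iff_exists_mem.1 (show 0 < S.card by omega)
    obtain ⟨x, -⟩ := Multiset.card_pos_iff_exists_mem.1
      (show 0 < v.card by rw [hS.card_vertex v hv]; omega)
    exact h.elim x
  obtain ⟨w, hw⟩ := (whiteheadGraph_connected hgp).exists_walk_length_eq_dist G.cls G'.cls
  obtain ⟨T, hT, hT'⟩ := exists_steps_of_walk hgp w rfl rfl hG
  exact ⟨w.length, T, hw ▸ SimpleGraph.dist_le_diam (ediam_ne_top hgp), hT, hG'.renaming hT'⟩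

theorem ends_le (hgp : 2 < 2 * g + p) {S : VertexSystem E} {S' : VertexSystem F}
    (hS : S.IsMarked g p) (hS' : S'.IsMarked g p) :
    S'.ends ≤ S.ends + 2 * (whiteheadGraph g p).diam := by
  obtain ⟨k, T, hk, hT, hr⟩ := exists_steps hgp hS hS'
  have := hT.ends_le
  have := hr.ends_eq
  omega

/-- For rank zero, the tree with few ends is compared with the tree with many ends. -/
theorem le_diam_tree (hp : 3 ≤ p) : p / 2 ≤ 2 + 2 * (whiteheadGraph 0 p).diam := by
  obtain ⟨q, rfl⟩ : ∃ q, p = q + 3 := ⟨p - 3, by omega⟩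
  obtain ⟨S, hS, h1⟩ := exists_few_ends_tree (E := ℕ) q
  obtain ⟨S', hS', h2⟩ := exists_many_ends (E := ℕ) 0 (q + 3) (by omega)
  have := ends_le (by omega) hS hS'
  omega

/-- For positive rank, the cycle, which has no ends, is compared with a graph with many ends. -/
theorem le_diam (k p : ℕ) (hkp : 2 ≤ 2 * k + p) :
    k + 1 + p / 2 ≤ 2 * (whiteheadGraph (k + 1) p).diam := by
  obtain ⟨S', hS', h2⟩ := exists_many_ends (E := ℕ) (k + 1) p (by omega)
  have := ends_le (by omega) (isMarked_cycle _ rfl (Fin.castAdd_injective k p)) hS'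
  have := ends_cycle (Fin.castAdd (n := k) p) (by omega)
  omega

/-- The graphs obtained from a cycle by choosing partners for `k` of its vertices are all among
those reached from one of them by the instructions that are coded in `10 ^ (n + 2 * diam)` words.
Given the code, the partners are determined by the position of one vertex and the numbering of the
half-edges. -/
theorem descFactorial_le {n : ℕ} (k p : ℕ) (hn : n = k + (k + p)) (hpos : 0 < n) :
    (k + p).descFactorial k ≤
      10 ^ (n + 2 * (whiteheadGraph (k + 1) p).diam) * (n * 27 ^ n) := by
  classical
  subst hn
  set D := (whiteheadGraph (k + 1) p).diam
  have hgp : 2 < 2 * (k + 1) + p := by omega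
  have h₀ := isMarked_cycle _ rfl (Fin.castAdd_injective k p)
  obtain ⟨dec, hdec⟩ := exists_code (M := 2 * D) (cycleFun (Fin.castAdd p)) h₀.count_le
  have key : ∀ j : Fin k ↪ Fin (k + p), ∃ c,
      (ofFun (dec c)).join = (ofFun (cycleFun (Fin.castAdd p))).join ∧
      Renaming (ofFun (cycleFun j)) (ofFun (dec c)) := by
    intro j
    obtain ⟨l, T, hl, hT, hr⟩ := exists_steps hgp h₀ (isMarked_cycle _ rfl j.injective)
    obtain ⟨c, rfl⟩ := hdec l T (by omega) hT
    exact ⟨c, hT.join_eq, hr⟩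
  choose c hc hr using key
  choose f ψ σ hf hψ hσ hν using fun j => (hr j).exists_maps
  have hinj : Function.Injective fun j => (c j, ψ j ⟨0, hpos⟩, σ j) := by
    intro j₁ j₂ h
    simp only [Prod.mk.injEq] at h
    have h1 := hν j₁
    rw [h.1, h.2.2] at h1
    exact DFunLike.coe_injective
      (cycle_eq_of_maps (fun x => by rw [hc]; exact h₀.count_le x) (hf j₂) (hσ j₂) (hψ j₁)
        (hψ j₂) h1 (hν j₂) h.2.1)
  have := Fintype.card_le_of_injective _ hinj
  simpa [Fintype.card_embedding_eq] using this

end MarkedGraph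

/-! ### The two bounds in terms of logarithms -/

namespace MarkedGraph

variable {g p : ℕ}

theorem clog_two_le {n : ℕ} (hn : 1 ≤ n) : (Nat.clog 2 n : ℝ) ≤ 2 * Real.log n + 1 := by
  have h0 : 0 ≤ Real.log n := Real.log_natCast_nonneg n
  have h1 := Nat.ceil_lt_add_one (a := Real.logb 2 n)
    (Real.logb_nonneg (by norm_num) (by exact_mod_cast hn))
  rw [show Real.logb 2 n = Real.logb (2 : ℕ) n by norm_num, Real.natCeil_logb_natCast] at h1
  have h2 : Real.logb (2 : ℕ) n ≤ 2 * Real.log n := by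
    rw [Real.logb, div_le_iff₀ (Real.log_pos (by norm_num))]
    have := Real.log_two_gt_d9
    push_cast
    nlinarith
  linarith

theorem log_factorial_ge {k : ℕ} (hk : 1 ≤ k) :
    k * Real.log k - k ≤ Real.log k.factorial := by
  have h1 := Real.pow_div_factorial_le_exp (k : ℝ) (Nat.cast_nonneg k) k
  have hk' : (0 : ℝ) < k := by exact_mod_cast hk
  have hf : (0 : ℝ) < k.factorial := by exact_mod_cast k.factorial_pos
  have h2 := Real.log_le_log (by positivity) h1
  rw [Real.log_exp, Real.log_div (by positivity) hf.ne', Real.log_pow] at h2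
  linarith

theorem diam_le_log (hgp : 2 < 2 * g + p) : ((whiteheadGraph g p).diam : ℝ) ≤
    32 * ((g : ℝ) * Real.log ((g : ℝ) + p) + ((g : ℝ) + p)) := by
  have h1 : ((whiteheadGraph g p).diam : ℝ) ≤ ((2 * (2 * (2 * g + p) +
      g * (2 * Nat.clog 2 (2 * g + p) + 3) + (p + 2)) : ℕ) : ℝ) := by exact_mod_cast diam_le hgp
  push_cast at h1
  have hg0 : (0 : ℝ) ≤ g := Nat.cast_nonneg g
  have hp0 : (0 : ℝ) ≤ p := Nat.cast_nonneg p
  have hN : (2 : ℝ) ≤ (g : ℝ) + p := by exact_mod_cast (by omega : 2 ≤ g + p)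
  have h2 : (Nat.clog 2 (2 * g + p) : ℝ) ≤ 2 * Real.log ((g : ℝ) + p) + 3 := by
    have h3 := clog_two_le (n := 2 * (g + p)) (by omega)
    have h4 : (Nat.clog 2 (2 * g + p) : ℝ) ≤ Nat.clog 2 (2 * (g + p)) := by
      exact_mod_cast Nat.clog_mono_right 2 (by omega)
    push_cast at h3
    rw [Real.log_mul (by norm_num) (by linarith)] at h3
    have := Real.log_two_lt_d9
    linarith
  have h3 := mul_le_mul_of_nonneg_left h2 hg0
  have h4 : 0 ≤ (g : ℝ) * Real.log ((g : ℝ) + p) := mul_nonneg hg0 (Real.log_nonneg (by linarith))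
  linarith

/-- The linear part of the lower bound. -/
theorem linear_le_diam (hgp : 2 < 2 * g + p) (h3 : (g, p) ≠ (0, 3)) (h4 : (g, p) ≠ (0, 4))
    (h5 : (g, p) ≠ (0, 5)) (h11 : (g, p) ≠ (1, 1)) : g + p ≤ 24 * (whiteheadGraph g p).diam := by
  simp only [ne_eq, Prod.mk.injEq, not_and] at h3 h4 h5 h11
  rcases g with _ | k
  · have := le_diam_tree (p := p) (by omega)
    omega
  · have := le_diam k p (by omega)
    omega

/-- The part of the lower bound coming from the number of graphs. -/
theorem log_le_diam (k p : ℕ) (hk : 1 ≤ k) : (k : ℝ) * Real.log ((k : ℝ) + 1 + p) ≤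
    34 * ((k : ℝ) + 1 + p) + 12 * (whiteheadGraph (k + 1) p).diam := by
  set D := (whiteheadGraph (k + 1) p).diam
  have hk1 : (1 : ℝ) ≤ k := by exact_mod_cast hk
  have hp0 : (0 : ℝ) ≤ p := Nat.cast_nonneg p
  have hd : (0 : ℝ) < (k + p).descFactorial k := by
    exact_mod_cast Nat.descFactorial_pos.2 (by omega)
  -- two lower bounds for the number of choices, one for large `p` and one for large `k`
  have h1 : (k : ℝ) * Real.log (p + 1) ≤ Real.log ((k + p).descFactorial k) := by
    rw [← Real.log_pow]
    refine Real.log_le_log (by positivity) ?_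
    have := Nat.pow_sub_le_descFactorial (k + p) k
    rw [show k + p + 1 - k = p + 1 by omega] at this
    exact_mod_cast this
  have h2 : (k : ℝ) * Real.log k - k ≤ Real.log ((k + p).descFactorial k) := by
    refine (log_factorial_ge hk).trans (Real.log_le_log (by exact_mod_cast k.factorial_pos) ?_)
    rw [← Nat.descFactorial_self]
    exact_mod_cast Nat.descFactorial_le k (by omega)
  have h3 : Real.log ((k : ℝ) + 1 + p) ≤ 1 + Real.log (p + 1) + Real.log k := by
    -- `a + b ≤ 2 * a * b` for `a, b ≥ 1`
    have h4 : (k : ℝ) + 1 + p ≤ 2 * (p + 1) * k := by nlinarith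
    have h5 := Real.log_le_log (by linarith) h4
    rw [Real.log_mul (by positivity) (by positivity), Real.log_mul (by norm_num) (by positivity)]
      at h5
    have := Real.log_two_lt_d9
    linarith
  have h4 := mul_le_mul_of_nonneg_left h3 (by linarith : (0 : ℝ) ≤ k)
  have hn : (0 : ℝ) < (k + (k + p) : ℕ) := by exact_mod_cast (by omega : 0 < k + (k + p))
  have h5 : Real.log ((k + p).descFactorial k) ≤
      ((k + (k + p) : ℕ) + 2 * (D : ℝ)) * Real.log 10 +
        (Real.log (k + (k + p) : ℕ) + (k + (k + p) : ℕ) * Real.log 27) := by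
    have h6 : (((k + p).descFactorial k : ℕ) : ℝ) ≤
        (10 : ℝ) ^ (k + (k + p) + 2 * D) * ((k + (k + p) : ℕ) * 27 ^ (k + (k + p))) := by
      exact_mod_cast descFactorial_le k p rfl (by omega)
    have h7 := Real.log_le_log hd h6
    rw [Real.log_mul (by positivity) (by positivity), Real.log_mul hn.ne' (by positivity),
      Real.log_pow, Real.log_pow] at h7
    push_cast at h7 ⊢
    exact h7
  have h6 : Real.log 10 ≤ 3 := by
    have : Real.log 10 ≤ Real.log (2 ^ 4) := Real.log_le_log (by norm_num) (by norm_num)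
    rw [Real.log_pow] at this
    have := Real.log_two_lt_d9
    push_cast at *
    linarith
  have h7 : Real.log 27 ≤ 4 := by
    have : Real.log 27 ≤ Real.log (2 ^ 5) := Real.log_le_log (by norm_num) (by norm_num)
    rw [Real.log_pow] at this
    have := Real.log_two_lt_d9
    push_cast at *
    linarith
  have h8 := Real.log_le_sub_one_of_pos hn
  have h9 := mul_le_mul_of_nonneg_left h6
    (by positivity : (0 : ℝ) ≤ (k + (k + p) : ℕ) + 2 * (D : ℝ))
  have h10 := mul_le_mul_of_nonneg_left h7 hn.le
  push_cast at *
  linarith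

theorem log_add_linear_le_diam (hgp : 2 < 2 * g + p) (h3 : (g, p) ≠ (0, 3)) (h4 : (g, p) ≠ (0, 4))
    (h5 : (g, p) ≠ (0, 5)) (h11 : (g, p) ≠ (1, 1)) :
    (g : ℝ) * Real.log ((g : ℝ) + p) + ((g : ℝ) + p) ≤ 2000 * (whiteheadGraph g p).diam := by
  have hlin : (g : ℝ) + p ≤ 24 * (whiteheadGraph g p).diam := by
    exact_mod_cast linear_le_diam hgp h3 h4 h5 h11
  have hN : (2 : ℝ) ≤ (g : ℝ) + p := by exact_mod_cast (by omega : 2 ≤ g + p)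
  have hlog := Real.log_le_sub_one_of_pos (by linarith : (0 : ℝ) < (g : ℝ) + p)
  have hlog0 := Real.log_nonneg (by linarith : (1 : ℝ) ≤ (g : ℝ) + p)
  rcases g with _ | _ | k
  · push_cast at *
    linarith
  · push_cast at *
    linarith
  · have h := log_le_diam (k + 1) p (by omega)
    have hk : (0 : ℝ) ≤ k := Nat.cast_nonneg k
    push_cast at *
    nlinarith

end MarkedGraph

theorem mainTheorem10 :
    ∃ K : ℝ, 0 < K ∧ ∀ g p : ℕ, 2 < 2 * g + p →
      (whiteheadGraph g p).Connected ∧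
      (whiteheadGraph g p).ediam ≠ ⊤ ∧
      ((whiteheadGraph g p).diam : ℝ) ≤
        K * ((g : ℝ) * Real.log ((g : ℝ) + (p : ℝ)) + ((g : ℝ) + (p : ℝ))) ∧
      ((g, p) ≠ (0, 3) → (g, p) ≠ (0, 4) → (g, p) ≠ (0, 5) → (g, p) ≠ (1, 1) →
        (1 / K) * ((g : ℝ) * Real.log ((g : ℝ) + (p : ℝ)) + ((g : ℝ) + (p : ℝ))) ≤
          ((whiteheadGraph g p).diam : ℝ)) := by
  refine ⟨2000, by norm_num, fun g p hgp => ⟨MarkedGraph.whiteheadGraph_connected hgp,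
    MarkedGraph.ediam_ne_top hgp, (MarkedGraph.diam_le_log hgp).trans ?_, fun h3 h4 h5 h11 => ?_⟩⟩
  · have hN : (2 : ℝ) ≤ (g : ℝ) + p := by exact_mod_cast (by omega : 2 ≤ g + p)
    have : 0 ≤ (g : ℝ) * Real.log ((g : ℝ) + p) :=
      mul_nonneg (Nat.cast_nonneg g) (Real.log_nonneg (by linarith))
    linarith
  · have := MarkedGraph.log_add_linear_le_diam hgp h3 h4 h5 h11
    linarith
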